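/- Let $n\ge 3$, $d\ge 1$, $m\ge 1$ and let $f=h+F\in\mathbb{C}[\![x_1,\dots,x_n]\!]$ be semihomogeneous of degree $d$: $h$ is a homogeneous polynomial of degree $d$ whose partial derivatives have no common zero in some punctured neighbourhood of the origin, and $F$ has order $>d$. Let $A\subseteq\mathbb{C}[\![x_1,\dots,x_n]\!]$ be a $\mathbb{C}$-subalgebra containing $x_1,\dots,x_n$ and $f$ such that the elements of $A$ without constant term form the ideal $(x_1,\dots,x_n)A$ (for example $A=\mathbb{C}[x_1,\dots,x_n]$, so $\operatorname{Spec}A=\mathbb{C}^n$, if $f$ is a polynomial, or $A=\mathbb{C}[\![x_1,\dots,x_n]\!]$ in general). Let $\mu:X\to\operatorname{Spec}A$ be the $m$-separating resolution constructed as follows. Blow up the origin; call the exceptional divisor $E_{(0,1)}$ and the strict transform of $\{f=0\}$ $E_{(1,0)}$. For a divisor $E$ write $N_E=\operatorname{ord}_E(f\circ\mu)$ for the largest $k$ such that $f\circ\mu$ is a section of the $k$-th power of the ideal sheaf of $E$. As long as there are neighbouring divisors $E=E_{(\kappa,r)}$, $F=E_{(\kappa',r')}$ in the chain with $E\cap F\ne\varnothing$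 and $N_E+N_F\le m$, blow up $E\cap F$, replace all divisors by their strict transforms and insert the exceptional divisor $E_{(\kappa+\kappa',r+r')}$ between $E$ and $F$. On the final $X$ one has $N_E+N_F>m$ whenever $E\neq F$ and $E\cap F\ne\varnothing$. Let $\mathcal{E}$ be the resulting set of divisors, ordered as a chain from $E_{(0,1)}$ to $E_{(1,0)}$. Let $H=\sum_{E\in\mathcal{E}}b_E E$ be an ample divisor on $X$ with integers $b_E\le 0$ such that $b_E/N_E<b_{F}/N_{F}$ whenever $E$ is closer to $E_{(0,1)}$ in the chain than $F$. Let $\mathcal{X}_m$ be the set of $m$-jets $\gamma(t)=\sum_{j=0}^m\gamma_jt^j$, $\gamma_j\in\mathbb{C}^n$, with $\gamma(0)=0$ and $f(\gamma(t))\equiv t^m \pmod{t^{m+1}}$, and let $\operatorname{ord}_t\gamma=\min\{j:\gamma_j\ne0\}$. For $E\in\mathcal{E}$ let $\mathcal{X}_{m,E}$ be the set of $\gamma\in\mathcal{X}_m$ that are the truncation of an arc $\sigma\in(\mathbb{C}[\![t]\!])^n$ whose lift $\widetilde\sigma:\operatorname{Spec}\mathbb{C}[\![t]\!]\to X$ satisfies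 $\widetilde\sigma(0)\in E$. For $p\in\mathbb{Z}$ put \[F_p\mathcal{X}_m=\{\gamma\in\mathcal{X}_m:\operatorname{ord}_t\gamma\ge -p\},\qquad G_p\mathcal{X}_m=\bigcup_{E\in\mathcal{E},\ N_E\mid m,\ mb_E/N_E\le p}\mathcal{X}_{m,E}.\] Then: 1. There is a strictly increasing function $\iota:\mathbb{Z}\to\mathbb{Z}$ such that $F_p\mathcal{X}_m=G_{\iota(p)}\mathcal{X}_m$ for all $p\in\mathbb{Z}$. 2. For every integer $\rho$ with $0\le\rho\le m/d$, the divisor $E_{-\rho}:=E_{(m-\rho d,\rho)/\gcd(m-\rho d,\rho)}$ belongs to $\mathcal{E}$ and is an $m$-divisor, i.e. $N_{E_{-\rho}}\mid m$, and a jet $\gamma\in\mathcal{X}_m$ has order $\rho$ if and only if $\gamma\in\mathcal{X}_{m,E_{-\rho}}$. Moreover, every $\gamma\in\mathcal{X}_m$ has order $\rho$ for some $\rho$ with $0\le\rho\le m/d$. -/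

import Mathlib

open CategoryTheory AlgebraicGeometry

noncomputable section

namespace ContactLocus

/-! ### Semihomogeneous power series -/

/-- `f = h + F` with `h` a homogeneous polynomial of degree `d` whose critical points other than
the origin do not accumulate at the origin (isolated critical point), and `F` a power series of
order `> d`. For `d ≥ 2` the origin is automatically a critical point of `h`; for `d = 1` the
definition says that `h` is a nonzero linear form. -/
def IsSemihomogeneous {n : ℕ} (d : ℕ) (f : MvPowerSeries (Fin n) ℂ) : Prop :=
  ∃ (h : MvPolynomial (Fin n) ℂ) (F : MvPowerSeries (Fin n) ℂ),
    h.IsHomogeneous d ∧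
    (∀ᶠ x in nhdsWithin (0 : Fin n → ℂ) {0}ᶜ,
      ∃ i, MvPolynomial.eval x (MvPolynomial.pderiv i h) ≠ 0) ∧
    (d : ℕ∞) < F.order ∧
    f = (h : MvPowerSeries (Fin n) ℂ) + F

/-! ### The base: a neighbourhood of the origin of affine space -/

/-- A ring of functions near the origin of `ℂⁿ`: a ring of power series that contains the
coordinates and in which the functions vanishing at the origin form the ideal generated by the
coordinates. Examples are `ℂ[x₁, …, xₙ]` (whose spectrum is `ℂⁿ`), its localization at the origin,
the convergent power series, and `ℂ⟦x₁, …, xₙ⟧` itself. -/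
structure GermRing (n : ℕ) where
  carrier : Subalgebra ℂ (MvPowerSeries (Fin n) ℂ)
  X_mem : ∀ i, MvPowerSeries.X i ∈ carrier
  mem_span : ∀ a : carrier, MvPowerSeries.constantCoeff (a : MvPowerSeries (Fin n) ℂ) = 0 →
    a ∈ Ideal.span (Set.range fun i => (⟨MvPowerSeries.X i, X_mem i⟩ : carrier))

namespace GermRing

variable {n : ℕ} (A : GermRing n)

/-- The base scheme `Spec A`. -/
abbrev base : Scheme.{0} := Spec (CommRingCat.of A.carrier)

/-- The ideal sheaf on `Spec A` attached to an ideal of `A`. -/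
def idealSheaf (I : Ideal A.carrier) : A.base.IdealSheafData :=
  Scheme.IdealSheafData.ofIdealTop
    (I.map (Scheme.ΓSpecIso (CommRingCat.of A.carrier)).inv.hom)

/-- The ideal sheaf of the origin. -/
def origin : A.base.IdealSheafData :=
  A.idealSheaf (Ideal.span (Set.range fun i => (⟨MvPowerSeries.X i, A.X_mem i⟩ : A.carrier)))

/-- The ideal sheaf of the hypersurface `f = 0`. -/
def hypersurface (f : A.carrier) : A.base.IdealSheafData :=
  A.idealSheaf (Ideal.span {f})

end GermRing

/-! ### Blow-ups and strict transforms -/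

/-- The ideal sheaf is that of an effective Cartier divisor: locally generated by one
nonzerodivisor. -/
def IsEffectiveCartier {X : Scheme.{0}} (I : X.IdealSheafData) : Prop :=
  ∀ x : X, ∃ U : X.affineOpens, x ∈ U.1 ∧
    ∃ s ∈ nonZeroDivisors Γ(X, U.1), I.ideal U = Ideal.span {s}

/-- `π : X' ⟶ X` is the blow-up of `X` along the closed subscheme with ideal sheaf `I`: the inverse
image of this subscheme is an effective Cartier divisor, and `π` is universal (terminal) with this
property. -/
def IsBlowUp {X' X : Scheme.{0}} (π : X' ⟶ X) (I : X.IdealSheafData) : Prop :=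
  IsEffectiveCartier (I.comap π) ∧
    ∀ (T : Scheme.{0}) (g : T ⟶ X), IsEffectiveCartier (I.comap g) → ∃! g' : T ⟶ X', g' ≫ π = g

/-- The ideal sheaf of the strict transform under `π : X' ⟶ X` (a blow-up with center `Z`) of the
closed subscheme `D` with ideal sheaf `I`: the scheme-theoretic closure in `X'` of
`π⁻¹(D) \ π⁻¹(Z)`. -/
def strictTransform {X' X : Scheme.{0}} (π : X' ⟶ X) (Z I : X.IdealSheafData) :
    X'.IdealSheafData :=
  let j := (I.comap π).subschemeι
  let U : X'.Opens := (Z.comap π).support.compl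
  Scheme.Hom.ker ((j ⁻¹ᵁ U).ι ≫ j)

/-! ### The resolution -/

/-- A divisor `E` on `X`, given by its ideal sheaf, together with its label `(κ, r)`. -/
abbrev LabelledDivisor (X : Scheme.{0}) : Type := (ℕ × ℕ) × X.IdealSheafData

/-- A scheme `μ : X ⟶ Spec A` with a list of labelled divisors, the components of the total
transform of the hypersurface. They are listed in the order of the chain formed by the dual graph,
starting with the strict transform `E_(0,1)` of the exceptional divisor of the blow-up of the
origin and ending with the strict transform `E_(1,0)` of the hypersurface. -/
structure Model {n : ℕ} (A : GermRing n) where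
  X : Scheme.{0}
  μ : X ⟶ A.base
  chain : List (LabelledDivisor X)

namespace Model

variable {n : ℕ} {A : GermRing n}

/-- The multiplicity `N_E = ord_E f` of the total transform of `f = 0` along `E`: the largest `k`
such that `f ∘ μ` is a section of the `k`-th power of the ideal sheaf of `E`. -/
def mult (M : Model A) (f : A.carrier) (E : LabelledDivisor M.X) : ℕ :=
  sSup {k : ℕ | (A.hypersurface f).comap M.μ ≤ E.2 ^ k}

/-- The blow-up of the origin, with its exceptional divisor `E_(0,1)` and the strict transform
`E_(1,0)` of the hypersurface. -/
def ofOrigin (f : A.carrier) {X : Scheme.{0}} (β : X ⟶ A.base) : Model A where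
  X := X
  μ := β
  chain := [((0, 1), A.origin.comap β), ((1, 0), strictTransform β A.origin (A.hypersurface f))]

/-- The blow-up `π` of the intersection of two neighbours `E`, `F` of the chain `L, E, F, R`: all
divisors are replaced by their strict transforms, and the exceptional divisor, labelled by the sum
of the labels of `E` and `F`, is inserted between `E` and `F`. -/
def blowUp (M : Model A) {X' : Scheme.{0}} (π : X' ⟶ M.X)
    (L : List (LabelledDivisor M.X)) (E F : LabelledDivisor M.X)
    (R : List (LabelledDivisor M.X)) : Model A where
  X := X'
  μ := π ≫ M.μ
  chain :=
    let Z := E.2 ⊔ F.2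
    let st : LabelledDivisor M.X → LabelledDivisor X' := fun D => (D.1, strictTransform π Z D.2)
    L.map st ++ st E :: (E.1 + F.1, Z.comap π) :: st F :: R.map st

/-- The models obtained from the blow-up of the origin by iteratively blowing up nonempty
intersections `E ∩ F` with `N_E + N_F ≤ m`. -/
inductive IsIteratedBlowUp (f : A.carrier) (m : ℕ) : Model A → Prop
  | origin {X : Scheme.{0}} (β : X ⟶ A.base) (hβ : IsBlowUp β A.origin) :
      IsIteratedBlowUp f m (ofOrigin f β)
  | step (M : Model A) (hM : IsIteratedBlowUp f m M)
      (L : List (LabelledDivisor M.X)) (E F : LabelledDivisor M.X)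
      (R : List (LabelledDivisor M.X)) (hchain : M.chain = L ++ E :: F :: R)
      (hne : E.2 ⊔ F.2 ≠ ⊤) (hN : M.mult f E + M.mult f F ≤ m)
      {X' : Scheme.{0}} (π : X' ⟶ M.X) (hπ : IsBlowUp π (E.2 ⊔ F.2)) :
      IsIteratedBlowUp f m (M.blowUp π L E F R)

/-- The index set of the components of the total transform. -/
abbrev Idx (M : Model A) : Type := Fin M.chain.length

/-- The label `(κ, r)` of the `i`-th divisor of the chain. -/
def label (M : Model A) (i : M.Idx) : ℕ × ℕ := (M.chain.get i).1

/-- The ideal sheaf of the `i`-th divisor of the chain. -/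
def divisor (M : Model A) (i : M.Idx) : M.X.IdealSheafData := (M.chain.get i).2

/-- The multiplicity `N_i` of the `i`-th divisor of the chain. -/
def N (M : Model A) (f : A.carrier) (i : M.Idx) : ℕ := M.mult f (M.chain.get i)

/-- `N_E + N_F > m` for all distinct components `E`, `F` with `E ∩ F ≠ ∅`. -/
def IsSeparating (M : Model A) (f : A.carrier) (m : ℕ) : Prop :=
  ∀ i j : M.Idx, i ≠ j → M.divisor i ⊔ M.divisor j ≠ ⊤ → m < M.N f i + M.N f j

/-- The `m`-separating resolution of `f = 0` obtained by iterated blow-ups. -/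
def IsSeparatingResolution (M : Model A) (f : A.carrier) (m : ℕ) : Prop :=
  IsIteratedBlowUp f m M ∧ M.IsSeparating f m

end Model

/-! ### Ample divisors -/

/-- The ideal sheaf generated by a global function. -/
def globalIdeal {X : Scheme.{0}} (s : Γ(X, ⊤)) : X.IdealSheafData :=
  Scheme.IdealSheafData.ofIdealTop (Ideal.span {s})

/-- Ampleness of an invertible ideal sheaf `J`: `X` is quasi-compact and every point lies in an
affine open subset of the form `{y | s generates J ^ k at y}` for some `k ≥ 1` and some global
section `s` of `J ^ k`. -/
def IsAmple {X : Scheme.{0}} (J : X.IdealSheafData) : Prop :=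
  IsEffectiveCartier J ∧ CompactSpace X ∧
    ∀ x : X, ∃ k : ℕ, 1 ≤ k ∧ ∃ s : Γ(X, ⊤), globalIdeal s ≤ J ^ k ∧
      ∃ U : X.Opens, IsAffineOpen U ∧ x ∈ U ∧
        ∀ y : X, y ∈ U ↔ ∃ V : X.affineOpens, y ∈ V.1 ∧ (globalIdeal s).ideal V = (J ^ k).ideal V

namespace Model

variable {n : ℕ} {A : GermRing n}

/-- The divisor `H = ∑ b_E E` is ample, all `b_E` are `≤ 0`, and `b_E / N_E < b_F / N_F` whenever
`E` is closer to `E_(0,1)` than `F` in the chain of divisors. As `b ≤ 0`, the line bundle `𝒪(H)` is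
the product of the ideal sheaves of the `E` to the powers `-b_E`. -/
structure IsMonotoneAmple (M : Model A) (f : A.carrier) (b : M.Idx → ℤ) : Prop where
  nonpos : ∀ i, b i ≤ 0
  ample : IsAmple (∏ i, M.divisor i ^ (-b i).toNat)
  slope_lt : ∀ i j, i < j → (b i : ℚ) / (M.N f i : ℚ) < (b j : ℚ) / (M.N f j : ℚ)

end Model

/-! ### Jets, arcs and the contact locus -/

/-- An `m`-jet `γ(t) = ∑_{j ≤ m} γ_j t^j` in `ℂⁿ`. -/
abbrev Jet (n m : ℕ) : Type := Fin (m + 1) → Fin n → ℂ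

/-- The components of `γ(t)`, as power series without terms of degree `> m`. -/
def Jet.toSeries {n m : ℕ} (γ : Jet n m) (i : Fin n) : PowerSeries ℂ :=
  PowerSeries.mk fun k => if hk : k < m + 1 then γ ⟨k, hk⟩ i else 0

/-- The order of a jet, the least `j` with `γ_j ≠ 0` (and `∞` for the zero jet). -/
def Jet.ord {n m : ℕ} (γ : Jet n m) : ℕ∞ :=
  ⨅ (j : Fin (m + 1)) (_ : γ j ≠ 0), ((j : ℕ) : ℕ∞)

/-- The restricted contact locus `𝒳_m`: jets with `γ(0) = 0` and `f(γ(t)) ≡ t^m mod t^(m+1)`. -/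
def contactLocus {n : ℕ} (f : MvPowerSeries (Fin n) ℂ) (m : ℕ) : Set (Jet n m) :=
  {γ | γ 0 = 0 ∧ ∀ k ≤ m,
    PowerSeries.coeff k (MvPowerSeries.subst γ.toSeries f : PowerSeries ℂ) = if k = m then 1 else 0}

/-- The order filtration `F_p 𝒳_m`, `p ∈ ℤ`: the jets of order at least `-p`. -/
def orderFiltration {n : ℕ} (f : MvPowerSeries (Fin n) ℂ) (m : ℕ) (p : ℤ) : Set (Jet n m) :=
  {γ ∈ contactLocus f m | ((-p).toNat : ℕ∞) ≤ γ.ord}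

/-- An arc in `ℂⁿ` through the origin: `n` power series in `t` without constant term. -/
structure Arc (n : ℕ) where
  toFun : Fin n → PowerSeries ℂ
  constantCoeff_eq_zero : ∀ i, MvPowerSeries.constantCoeff (toFun i) = 0

/-- The truncation `π_m(σ)` of an arc. -/
def Arc.truncate {n : ℕ} (σ : Arc n) (m : ℕ) : Jet n m :=
  fun j i => PowerSeries.coeff (j : ℕ) (σ.toFun i)

/-- The arc as a morphism `Spec ℂ⟦t⟧ ⟶ Spec A`, given by substituting the arc into the power series
in `A`. -/
def Arc.toHom {n : ℕ} (σ : Arc n) (A : GermRing n) :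
    Spec (CommRingCat.of (PowerSeries ℂ)) ⟶ A.base :=
  Spec.map (CommRingCat.ofHom
    (((MvPowerSeries.substAlgHom
      (MvPowerSeries.hasSubst_of_constantCoeff_zero σ.constantCoeff_eq_zero) :
        MvPowerSeries (Fin n) ℂ →ₐ[ℂ] PowerSeries ℂ).comp A.carrier.val).toRingHom))

namespace Model

variable {n : ℕ} {A : GermRing n}

/-- The piece `𝒳_{m,E}` of the contact locus: the jets `γ ∈ 𝒳_m` that are truncations of an arc `σ`
whose lift `σ'` to `X` sends the closed point into `E`, where `E` is the `i`-th divisor. -/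
def piece (M : Model A) (f : A.carrier) (m : ℕ) (i : M.Idx) : Set (Jet n m) :=
  {γ ∈ contactLocus (f : MvPowerSeries (Fin n) ℂ) m | ∃ σ : Arc n, σ.truncate m = γ ∧
    ∃ σ' : Spec (CommRingCat.of (PowerSeries ℂ)) ⟶ M.X, σ' ≫ M.μ = σ.toHom A ∧
      σ' (IsLocalRing.closedPoint (PowerSeries ℂ)) ∈ (M.divisor i).support}

/-- The filtration `G_p 𝒳_m`, `p ∈ ℤ`, attached to the divisor `∑ b_E E`: the union of the
`𝒳_{m,E}` over the `m`-divisors `E` with `m b_E / N_E ≤ p`. -/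
def divisorFiltration (M : Model A) (f : A.carrier) (m : ℕ) (b : M.Idx → ℤ) (p : ℤ) :
    Set (Jet n m) :=
  ⋃ (i : M.Idx) (_ : M.N f i ∣ m) (_ : (m : ℚ) * (b i : ℚ) / (M.N f i : ℚ) ≤ (p : ℚ)),
    M.piece f m i

end Model

/-- The label `(m - ρd, ρ) / gcd(m - ρd, ρ)` of the `m`-divisor `E_{-ρ}`, for `ρd ≤ m`. -/
def mLabel (d m ρ : ℕ) : ℕ × ℕ :=
  ((m - ρ * d) / Nat.gcd (m - ρ * d) ρ, ρ / Nat.gcd (m - ρ * d) ρ)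

end ContactLocus

end

/-!
The theorem rests on the fact that the pair of numbers (order of an arc, order of `f` along it)
determines which divisor of an `m`-separating resolution is met by the lift of the arc.

*Orders along the chain.* On every iterated blow-up, the total transforms of the origin and of the
hypersurface are `∏ E_(κ,r) ^ r` and `∏ E_(κ,r) ^ (κ + r d)`, where the products run over the chain.
If a lifted arc has order `v_i` along the `i`-th divisor, this gives `∑ v_i (κ_i, r_i) = (κ, ρ)`,
where `ρ` is the order of the arc and `κ + ρ d` the order of `f` along it
(`IsGoodModel.exists_valuation`). For `κ + ρ d = m` and a separating resolution, two positive `v_i`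
would belong to meeting divisors, so that `m < N_i + N_j ≤ ∑ v_i N_i = m`. Hence the lift meets a
single divisor, and its label is the primitive vector on the ray through `(m - ρ d, ρ)`
(`IsGoodModel.exists_unique_divisor`).

*Multiplicities.* That `N_i` equals `κ_i + r_i d` is part of the claim. The product formula gives
`≥`. For `≤` one tests on arcs: for all `κ ≥ 0`, `r ≥ 1` there are arcs of order `r` along which `f`
has order `κ + r d` (`exists_arc`, by Newton's method at a smooth point of the cone `h = 0`), and an
arc whose type is the label of a divisor meets this divisor transversally and no other one
(`IsGoodModel.valuation_eq_one`), because divisors separated by a third one in the chain are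
disjoint.

*The blow-ups.* The product formulas, the disjointness and the existence of lifts are carried
through the construction by the structure `IsGoodModel`. The blow-ups are only given by their
universal property and the strict transforms are scheme-theoretic closures, over a base ring that
need not be Noetherian. The universal property makes the local ring of the blow-up at a point a
retract of a localization of the affine chart `A[I/y]` (`IsBlowUp.exists_chart`). Retracts inherit
statements of the form "`a` is regular modulo `b`", and these suffice to compute the strict
transforms (`stalkIdeal_strictTransform_of_regular`): in the chart of the blow-up of `(x, y)`, with
`y` regular modulo `x`, the element `y` is regular modulo `x / y`; in the chart of the blow-up of
the origin, `x_j` is regular modulo `f / x_j ^ d` since orders of power series are additive.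

*The filtrations.* As `ρ` grows, the divisor of `ρ` moves towards `E_(0,1)` (`cross_mLabel_pos`), so
the numbers `m b / N` strictly decrease, and `ι` interpolates them
(`exists_strictMono_reindex`).
-/

noncomputable section

namespace ContactLocus

open Scheme IdealSheafData

/-! ### Pullbacks and stalks of ideal sheaves -/

theorem ideal_comap_of_isAffine {X Y : Scheme.{0}} [IsAffine X] [IsAffine Y] (f : X ⟶ Y)
    (I : Y.IdealSheafData) :
    (I.comap f).ideal ⟨⊤, isAffineOpen_top X⟩ =
      (I.ideal ⟨⊤, isAffineOpen_top Y⟩).map f.appTop.hom := by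
  apply le_antisymm
  · have : I.comap f ≤ ofIdealTop ((I.ideal ⟨⊤, isAffineOpen_top Y⟩).map f.appTop.hom) := by
      rw [← le_map_iff_comap_le]
      apply le_of_isAffine
      rw [ideal_map_of_isAffineHom]
      have e : (ofIdealTop ((I.ideal ⟨⊤, isAffineOpen_top Y⟩).map f.appTop.hom)).ideal
          ⟨⊤, isAffineOpen_top X⟩ = (I.ideal ⟨⊤, isAffineOpen_top Y⟩).map f.appTop.hom := by simp
      exact (Ideal.le_comap_map).trans (Ideal.comap_mono e.ge)
    simpa using this ⟨⊤, isAffineOpen_top X⟩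
  · rw [Ideal.map_le_iff_le_comap]
    have := (le_map_comap I f) ⟨⊤, isAffineOpen_top Y⟩
    rwa [ideal_map_of_isAffineHom] at this

/-- The ideal of `R` that defines the inverse image, under `φ : Spec R ⟶ X`, of the closed
subscheme with ideal sheaf `I`. -/
def idealAlong {X : Scheme.{0}} (I : X.IdealSheafData) {R : CommRingCat.{0}} (φ : Spec R ⟶ X) :
    Ideal R :=
  ((I.comap φ).ideal ⟨⊤, isAffineOpen_top _⟩).map (Scheme.ΓSpecIso R).hom.hom

section IdealAlong

variable {X Y : Scheme.{0}} {R S : CommRingCat.{0}}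

theorem idealAlong_comap (I : Y.IdealSheafData) (f : X ⟶ Y) (φ : Spec R ⟶ X) :
    idealAlong (I.comap f) φ = idealAlong I (φ ≫ f) := by
  rw [idealAlong, idealAlong, comap_comp]

theorem idealAlong_specMap (I : X.IdealSheafData) (φ : Spec R ⟶ X) (g : R ⟶ S) :
    idealAlong I (Spec.map g ≫ φ) = (idealAlong I φ).map g.hom := by
  rw [idealAlong, comap_comp, ideal_comap_of_isAffine, idealAlong, Ideal.map_map, Ideal.map_map]
  congr 1
  rw [← CommRingCat.hom_comp, ← CommRingCat.hom_comp, Scheme.ΓSpecIso_naturality]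

theorem idealAlong_fromSpec (I : X.IdealSheafData) {U : X.Opens} (hU : IsAffineOpen U) :
    idealAlong I hU.fromSpec = I.ideal ⟨U, hU⟩ := by
  have hU' : U = hU.fromSpec ''ᵁ ⊤ := by
    rw [Scheme.Hom.image_top_eq_opensRange, hU.opensRange_fromSpec]
  rw [idealAlong, ideal_comap_of_isOpenImmersion,
    ← I.map_ideal' (V := ⟨U, hU⟩) (eqToHom (congrArg _ hU'))]
  have h : Ideal.comap (Hom.appIso hU.fromSpec ⊤).inv.hom =
      Ideal.map (Hom.appIso hU.fromSpec ⊤).hom.hom := by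
    funext K
    exact (Ideal.map_comap_of_equiv (Hom.appIso hU.fromSpec ⊤).commRingCatIsoToRingEquiv).symm
  rw [h, Ideal.map_map, Ideal.map_map, ← CommRingCat.hom_comp, ← CommRingCat.hom_comp]
  convert Ideal.map_id _
  rw [← CommRingCat.hom_id]
  congr 1
  rw [Scheme.Hom.appIso_hom', ← Category.assoc, Scheme.Hom.map_appLE]
  have : hU.fromSpec.appLE U ⊤ hU.fromSpec_preimage_self.ge = (Scheme.ΓSpecIso _).inv := by
    rw [Scheme.Hom.appLE, hU.fromSpec_app_self, Category.assoc, ← Functor.map_comp]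
    convert Category.comp_id _
    exact CategoryTheory.Functor.map_id _ _
  rw [this, Iso.inv_hom_id]

theorem ideal_comap_eq_map (f : X ⟶ Y) (I : Y.IdealSheafData) (U : X.affineOpens)
    (V : Y.affineOpens) (h : U.1 ≤ f ⁻¹ᵁ V.1) :
    (I.comap f).ideal U = (I.ideal V).map (f.appLE V.1 U.1 h).hom := by
  obtain ⟨U, hU⟩ := U
  obtain ⟨V, hV⟩ := V
  have hV' : IsAffineOpen V := hV
  rw [← idealAlong_fromSpec _ hU, idealAlong_comap, ← hV'.SpecMap_appLE_fromSpec f hU h,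
    idealAlong_specMap, idealAlong_fromSpec]

theorem comap_mul (f : X ⟶ Y) (I J : Y.IdealSheafData) :
    (I * J).comap f = I.comap f * J.comap f := by
  have key : ∀ x : X, ∃ U : X.affineOpens, ∃ V : Y.affineOpens, x ∈ U.1 ∧ U.1 ≤ f ⁻¹ᵁ V.1 := by
    intro x
    obtain ⟨_, ⟨V, hV, rfl⟩, hxV, -⟩ :=
      Y.isBasis_affineOpens.exists_subset_of_mem_open (Set.mem_univ (f x)) isOpen_univ
    obtain ⟨_, ⟨U, hU, rfl⟩, hxU, hUV⟩ :=
      X.isBasis_affineOpens.exists_subset_of_mem_open (a := x) (u := f ⁻¹ᵁ V) hxV (f ⁻¹ᵁ V).2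
    exact ⟨⟨U, hU⟩, ⟨V, hV⟩, hxU, hUV⟩
  choose U V hxU hUV using key
  refine ext_of_iSup_eq_top U ?_ ?_
  · rw [eq_top_iff]
    intro x _
    exact TopologicalSpace.Opens.mem_iSup.mpr ⟨x, hxU x⟩
  · intro x
    rw [ideal_mul, Pi.mul_apply, ideal_comap_eq_map f _ _ _ (hUV x),
      ideal_comap_eq_map f _ _ _ (hUV x), ideal_comap_eq_map f _ _ _ (hUV x), ideal_mul,
      Pi.mul_apply, Ideal.map_mul]

theorem idealAlong_mul (I J : X.IdealSheafData) (φ : Spec R ⟶ X) :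
    idealAlong (I * J) φ = idealAlong I φ * idealAlong J φ := by
  rw [idealAlong, comap_mul, ideal_mul, Pi.mul_apply, Ideal.map_mul]; rfl

theorem idealAlong_sup (I J : X.IdealSheafData) (φ : Spec R ⟶ X) :
    idealAlong (I ⊔ J) φ = idealAlong I φ ⊔ idealAlong J φ := by
  rw [idealAlong, comap_sup, ideal_sup, Pi.sup_apply, Ideal.map_sup]; rfl

theorem idealAlong_top (φ : Spec R ⟶ X) :
    idealAlong (⊤ : X.IdealSheafData) φ = ⊤ := by
  rw [idealAlong, comap_top, ideal_top, Pi.top_apply, Ideal.map_top]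

theorem idealAlong_mono {I J : X.IdealSheafData} (h : I ≤ J) (φ : Spec R ⟶ X) :
    idealAlong I φ ≤ idealAlong J φ :=
  Ideal.map_mono (comap_mono φ h _)

theorem idealAlong_pow (I : X.IdealSheafData) (k : ℕ) (φ : Spec R ⟶ X) :
    idealAlong (I ^ k) φ = idealAlong I φ ^ k := by
  induction k with
  | zero => rw [pow_zero, pow_zero, one_eq_top, idealAlong_top, Ideal.one_eq_top]
  | succ k ih => rw [pow_succ, pow_succ, idealAlong_mul, ih]

theorem idealAlong_listProd (L : List X.IdealSheafData) (φ : Spec R ⟶ X) :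
    idealAlong L.prod φ = (L.map (idealAlong · φ)).prod := by
  induction L with
  | nil => rw [List.prod_nil, one_eq_top, idealAlong_top, List.map_nil, List.prod_nil,
      Ideal.one_eq_top]
  | cons a L ih => rw [List.prod_cons, idealAlong_mul, ih, List.map_cons, List.prod_cons]

/-- A morphism from the spectrum of a ring along which an ideal sheaf becomes the principal ideal
of a nonzerodivisor pulls it back to an effective Cartier divisor. -/
theorem isEffectiveCartier_comap_of_idealAlong {I : X.IdealSheafData} {φ : Spec R ⟶ X} {s : R}
    (hs : s ∈ nonZeroDivisors R) (h : idealAlong I φ = Ideal.span {s}) :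
    IsEffectiveCartier (I.comap φ) := by
  intro x
  refine ⟨⟨⊤, isAffineOpen_top _⟩, trivial, (Scheme.ΓSpecIso R).inv.hom s, ?_, ?_⟩
  · have := MulEquivClass.map_nonZeroDivisors (Scheme.ΓSpecIso R).symm.commRingCatIsoToRingEquiv
    exact this.le ⟨s, hs, rfl⟩
  · have := congrArg (Ideal.map (Scheme.ΓSpecIso R).inv.hom) h
    rw [idealAlong, Ideal.map_map, Ideal.map_span, Set.image_singleton,
      ← CommRingCat.hom_comp, Iso.hom_inv_id, CommRingCat.hom_id, Ideal.map_id] at this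
    exact this

/-- The stalk at `x` of an ideal sheaf, as an ideal of the local ring at `x`. -/
def stalkIdeal (I : X.IdealSheafData) (x : X) : Ideal (X.presheaf.stalk x) :=
  idealAlong I (X.fromSpecStalk x)

theorem stalkIdeal_eq_map (I : X.IdealSheafData) {x : X} (U : X.affineOpens) (hx : x ∈ U.1) :
    stalkIdeal I x = (I.ideal U).map (X.presheaf.germ U.1 x hx).hom := by
  obtain ⟨U, hU⟩ := U
  have hU' : IsAffineOpen U := hU
  rw [stalkIdeal, ← hU'.fromSpecStalk_eq_fromSpecStalk hx, IsAffineOpen.fromSpecStalk,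
    idealAlong_specMap, idealAlong_fromSpec]

theorem stalkIdeal_comap (I : Y.IdealSheafData) (f : X ⟶ Y) (x : X) :
    stalkIdeal (I.comap f) x = (stalkIdeal I (f x)).map (f.stalkMap x).hom := by
  rw [stalkIdeal, idealAlong_comap, ← Scheme.SpecMap_stalkMap_fromSpecStalk, idealAlong_specMap]
  rfl

theorem mem_ideal_of_germ_mem {I : X.IdealSheafData} {U : X.affineOpens} {g : Γ(X, U)}
    (h : ∀ (x : X) (hx : x ∈ U.1), X.presheaf.germ U.1 x hx g ∈ stalkIdeal I x) :
    g ∈ I.ideal U := by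
  have := (IsAffineOpen.ideal_le_iff U.2 (I := Ideal.span {g}) (J := I.ideal U)).mpr ?_
  · exact this (Ideal.mem_span_singleton_self g)
  · intro x hx
    rw [Ideal.map_span, Set.image_singleton, Ideal.span_singleton_le_iff_mem,
      ← stalkIdeal_eq_map]
    exact h x hx

theorem le_of_stalkIdeal_le {I J : X.IdealSheafData}
    (h : ∀ x, stalkIdeal I x ≤ stalkIdeal J x) : I ≤ J := by
  intro U g hg
  refine mem_ideal_of_germ_mem fun x hx => h x ?_
  rw [stalkIdeal_eq_map I U hx]
  exact Ideal.mem_map_of_mem _ hg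

theorem stalkIdeal_of_isEffectiveCartier {I : X.IdealSheafData} (hI : IsEffectiveCartier I)
    (x : X) : ∃ s ∈ nonZeroDivisors (X.presheaf.stalk x), stalkIdeal I x = Ideal.span {s} := by
  obtain ⟨U, hx, s, hs, h⟩ := hI x
  refine ⟨X.presheaf.germ U.1 x hx s, ?_, ?_⟩
  · let _ : Algebra Γ(X, U) (X.presheaf.stalk x) := (X.presheaf.germ U.1 x hx).hom.toAlgebra
    have := U.2.isLocalization_stalk ⟨x, hx⟩
    exact IsLocalization.map_nonZeroDivisors_le (U.2.primeIdealOf ⟨x, hx⟩).asIdeal.primeCompl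
      (X.presheaf.stalk x) ⟨s, hs, rfl⟩
  · rw [stalkIdeal_eq_map I U hx, h, Ideal.map_span, Set.image_singleton]

theorem exists_mem_affineOpens (x : X) : ∃ U : X.affineOpens, x ∈ U.1 := by
  obtain ⟨_, ⟨U, hU, rfl⟩, hxU, -⟩ :=
    X.isBasis_affineOpens.exists_subset_of_mem_open (Set.mem_univ x) isOpen_univ
  exact ⟨⟨U, hU⟩, hxU⟩

theorem mem_support_iff_stalkIdeal {I : X.IdealSheafData} {x : X} :
    x ∈ I.support ↔ stalkIdeal I x ≠ ⊤ := by
  obtain ⟨U, hx⟩ := exists_mem_affineOpens x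
  rw [mem_support_iff_of_mem hx, Scheme.mem_zeroLocus_iff, stalkIdeal_eq_map I U hx]
  constructor
  · intro h htop
    have : (I.ideal U).map (X.presheaf.germ U.1 x hx).hom ≤ IsLocalRing.maximalIdeal _ := by
      rw [Ideal.map_le_iff_le_comap]
      intro g hg
      have := h g hg
      rw [Scheme.mem_basicOpen _ _ _ hx] at this
      exact this
    rw [htop, top_le_iff] at this
    exact (IsLocalRing.maximalIdeal.isMaximal _).ne_top this
  · intro h g hg hgx
    rw [Scheme.mem_basicOpen _ _ _ hx] at hgx
    exact h (Ideal.eq_top_of_isUnit_mem _ (Ideal.mem_map_of_mem _ hg) hgx)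

theorem idealAlong_eq_map_stalkIdeal [IsLocalRing R] (I : X.IdealSheafData) (φ : Spec R ⟶ X) :
    idealAlong I φ = (stalkIdeal I (φ (IsLocalRing.closedPoint R))).map
      (Scheme.stalkClosedPointTo φ).hom := by
  rw [stalkIdeal, ← idealAlong_specMap, Scheme.Spec_stalkClosedPointTo_fromSpecStalk]

theorem closedPoint_mem_support_iff [IsLocalRing R] (I : X.IdealSheafData) (φ : Spec R ⟶ X) :
    φ (IsLocalRing.closedPoint R) ∈ I.support ↔ idealAlong I φ ≠ ⊤ := by
  rw [mem_support_iff_stalkIdeal, idealAlong_eq_map_stalkIdeal]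
  refine not_congr ⟨fun h => by rw [h, Ideal.map_top], fun h => ?_⟩
  by_contra hne
  have h1 := IsLocalRing.le_maximalIdeal hne
  have h2 := (Ideal.map_mono h1).trans
    (((IsLocalRing.local_hom_TFAE (Scheme.stalkClosedPointTo φ).hom).out 0 2).mp
      (show IsLocalHom (Scheme.stalkClosedPointTo φ).hom from inferInstance))
  rw [h, top_le_iff] at h2
  exact (IsLocalRing.maximalIdeal.isMaximal _).ne_top h2

end IdealAlong

/-! ### The charts of a blow-up -/

section Chart

variable {A : Type} [CommRing A] (I : Ideal A) {y : A} (hy : y ∈ I)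

/-- The affine blow-up algebra `A[I/y]`: the fractions `a / y ^ N` in `A[1/y]` with `a ∈ I ^ N`. -/
def blowUpChart : Subalgebra A (Localization.Away y) where
  carrier := {c | ∃ N : ℕ, ∃ a ∈ I ^ N,
    algebraMap A (Localization.Away y) (y ^ N) * c = algebraMap A _ a}
  mul_mem' := by
    rintro c c' ⟨N, a, ha, hc⟩ ⟨N', a', ha', hc'⟩
    refine ⟨N + N', a * a', pow_add I N N' ▸ Ideal.mul_mem_mul ha ha', ?_⟩
    rw [map_mul, ← hc, ← hc', pow_add, map_mul]; ring
  add_mem' := by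
    rintro c c' ⟨N, a, ha, hc⟩ ⟨N', a', ha', hc'⟩
    refine ⟨N + N', y ^ N' * a + y ^ N * a', Ideal.add_mem _ ?_ ?_, ?_⟩
    · rw [add_comm N, pow_add]; exact Ideal.mul_mem_mul (Ideal.pow_mem_pow hy _) ha
    · rw [pow_add]; exact Ideal.mul_mem_mul (Ideal.pow_mem_pow hy _) ha'
    · rw [map_add, map_mul, map_mul, ← hc, ← hc', pow_add, map_mul]; ring
  algebraMap_mem' r := ⟨0, r, by simp, by simp⟩

variable {I}

theorem isUnit_algebraMap_away_pow (N : ℕ) :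
    IsUnit (algebraMap A (Localization.Away y) (y ^ N)) := by
  rw [map_pow]; exact (IsLocalization.Away.algebraMap_isUnit y).pow N

/-- The fraction `a / y ^ N` for `a ∈ I ^ N`. -/
def blowUpChart.frac (N : ℕ) (a : A) (ha : a ∈ I ^ N) : blowUpChart I hy :=
  ⟨(isUnit_algebraMap_away_pow (y := y) N).unit⁻¹ * algebraMap A _ a, N, a, ha, by
    rw [← mul_assoc, IsUnit.mul_val_inv, one_mul]⟩

theorem blowUpChart.pow_mul_frac (N : ℕ) (a : A) (ha : a ∈ I ^ N) :
    algebraMap A (blowUpChart I hy) (y ^ N) * blowUpChart.frac hy N a ha =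
      algebraMap A (blowUpChart I hy) a := by
  apply Subtype.ext
  change algebraMap A (Localization.Away y) (y ^ N) * _ = algebraMap A (Localization.Away y) a
  rw [blowUpChart.frac, ← mul_assoc, IsUnit.mul_val_inv, one_mul]

theorem blowUpChart.exists_rep (c : blowUpChart I hy) : ∃ N : ℕ, ∃ a ∈ I ^ N,
    algebraMap A (blowUpChart I hy) (y ^ N) * c = algebraMap A (blowUpChart I hy) a := by
  obtain ⟨c, N, a, ha, h⟩ := c
  exact ⟨N, a, ha, Subtype.ext h⟩

theorem blowUpChart.pow_mul_cancel (N : ℕ) {c c' : blowUpChart I hy}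
    (h : algebraMap A (blowUpChart I hy) (y ^ N) * c =
      algebraMap A (blowUpChart I hy) (y ^ N) * c') : c = c' := by
  apply Subtype.ext
  exact (isUnit_algebraMap_away_pow N).mul_left_cancel (congrArg Subtype.val h)

theorem blowUpChart.mul_cancel {c c' : blowUpChart I hy}
    (h : algebraMap A (blowUpChart I hy) y * c = algebraMap A (blowUpChart I hy) y * c') :
    c = c' :=
  blowUpChart.pow_mul_cancel hy 1 (by rwa [pow_one])

theorem blowUpChart.algebraMap_injective (hreg : y ∈ nonZeroDivisors A) :
    Function.Injective (algebraMap A (blowUpChart I hy)) := by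
  intro a b h
  exact IsLocalization.injective (Localization.Away y) (M := Submonoid.powers y)
    (Submonoid.powers_le.mpr hreg) (congrArg Subtype.val h)

theorem blowUpChart.map_ideal :
    I.map (algebraMap A (blowUpChart I hy)) = Ideal.span {algebraMap A (blowUpChart I hy) y} := by
  apply le_antisymm
  · rw [Ideal.map_le_iff_le_comap]
    intro a ha
    rw [Ideal.mem_comap, Ideal.mem_span_singleton]
    refine ⟨blowUpChart.frac hy 1 a (by rwa [pow_one]), ?_⟩
    rw [← blowUpChart.pow_mul_frac hy 1 a (by rwa [pow_one]), pow_one]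
  · rw [Ideal.span_singleton_le_iff_mem]
    exact Ideal.mem_map_of_mem _ hy

/-- A ring homomorphism from `A` under which `I` becomes the principal ideal generated by the image
of `y`, a nonzerodivisor, extends to `A[I/y]`. -/
theorem blowUpChart.exists_lift {R : Type} [CommRing R] (α : A →+* R)
    (hα : α y ∈ nonZeroDivisors R) (hgen : I.map α = Ideal.span {α y}) :
    ∃ χ : blowUpChart I hy →+* R, ∀ a, χ (algebraMap A _ a) = α a := by
  have hex : ∀ c : blowUpChart I hy, ∃ r : R, ∃ N : ℕ, ∃ a : A, α y ^ N * r = α a ∧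
      algebraMap A (blowUpChart I hy) (y ^ N) * c = algebraMap A (blowUpChart I hy) a := by
    intro c
    obtain ⟨N, a, ha, h⟩ := blowUpChart.exists_rep hy c
    have : α a ∈ Ideal.span {α y ^ N} := by
      rw [← Ideal.span_singleton_pow, ← hgen, ← Ideal.map_pow]
      exact Ideal.mem_map_of_mem _ ha
    obtain ⟨r, hr⟩ := Ideal.mem_span_singleton.mp this
    exact ⟨r, N, a, hr.symm, h⟩
  have key : ∀ (N : ℕ) (a : A) (c : blowUpChart I hy) (r : R), α y ^ N * r = α a →
      algebraMap A (blowUpChart I hy) (y ^ N) * c = algebraMap A (blowUpChart I hy) a →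
      ∀ (N' : ℕ) (a' : A) (r' : R), α y ^ N' * r' = α a' →
      algebraMap A (blowUpChart I hy) (y ^ N') * c = algebraMap A (blowUpChart I hy) a' →
      r = r' := by
    intro N a c r h1 h2 N' a' r' h1' h2'
    have h3 : algebraMap A (blowUpChart I hy) (y ^ N' * a) =
        algebraMap A (blowUpChart I hy) (y ^ N * a') := by
      rw [map_mul, map_mul, ← h2, ← h2']; ring
    have h4 : algebraMap A (Localization.Away y) (y ^ N' * a) =
        algebraMap A (Localization.Away y) (y ^ N * a') := congrArg Subtype.val h3
    obtain ⟨⟨_, K, rfl⟩, hK⟩ := (IsLocalization.eq_iff_exists (Submonoid.powers y) _).mp h4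
    have h5 := congrArg α hK
    simp only [map_mul, map_pow, ← h1, ← h1'] at h5
    have h6 : α y ^ (K + N + N') * r = α y ^ (K + N + N') * r' := by
      rw [pow_add, pow_add]; linear_combination h5
    exact (mul_cancel_left_mem_nonZeroDivisors (pow_mem hα _)).mp h6
  choose χ N a hχ hc using hex
  refine ⟨⟨⟨⟨χ, ?_⟩, ?_⟩, ?_, ?_⟩, ?_⟩
  · exact key _ _ 1 _ (hχ 1) (hc 1) 0 1 1 (by simp) (by simp)
  · intro c c'
    refine key _ _ _ _ (hχ _) (hc _) (N c + N c') (a c * a c') _ ?_ ?_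
    · rw [map_mul, ← hχ, ← hχ, pow_add]; ring
    · rw [map_mul, ← hc, ← hc, pow_add, map_mul]; ring
  · exact key _ _ 0 _ (hχ 0) (hc 0) 0 0 0 (by simp) (by simp)
  · intro c c'
    refine key _ _ _ _ (hχ _) (hc _) (N c + N c') (y ^ N c' * a c + y ^ N c * a c') _ ?_ ?_
    · change α y ^ (N c + N c') * (χ c + χ c') = _
      rw [map_add, map_mul, map_mul, ← hχ, ← hχ, pow_add, map_pow, map_pow]; ring
    · rw [map_add, map_mul, map_mul, ← hc, ← hc, pow_add, map_mul]; ring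
  · intro b
    exact key _ _ _ _ (hχ _) (hc _) 0 b _ (by simp) (by simp)

end Chart

/-- Regularity of a pair in a ring `C` passes to every retract `R` of a localization `B` of `C`. -/
theorem mem_span_of_retract {C B R : Type} [CommRing C] [CommRing B] [CommRing R] [Algebra C B]
    (M : Submonoid C) [IsLocalization M B] (ψ : R →+* B) (χ : B →+* R) (hχψ : ∀ r, χ (ψ r) = r)
    (χ₀ : C →+* R) (hψ : ∀ c, ψ (χ₀ c) = algebraMap C B c) {a b : C}
    (hab : ∀ c, a * c ∈ Ideal.span {b} → c ∈ Ideal.span {b}) {g : R}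
    (hg : χ₀ a * g ∈ Ideal.span {χ₀ b}) : g ∈ Ideal.span {χ₀ b} := by
  obtain ⟨h, hh⟩ := Ideal.mem_span_singleton.mp hg
  have h1 : algebraMap C B a * ψ g = algebraMap C B b * ψ h := by
    rw [← hψ, ← hψ, ← map_mul, ← map_mul, hh]
  obtain ⟨⟨p, s⟩, hp⟩ := IsLocalization.surj M (ψ g)
  obtain ⟨⟨q, t⟩, hq⟩ := IsLocalization.surj M (ψ h)
  simp only at hp hq
  have h2 : algebraMap C B (a * p * t) = algebraMap C B (b * q * s) := by
    simp only [map_mul, ← hp, ← hq]; linear_combination (algebraMap C B s * algebraMap C B t) * h1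
  obtain ⟨u, hu⟩ := (IsLocalization.eq_iff_exists M B).mp h2
  obtain ⟨k, hk⟩ := Ideal.mem_span_singleton.mp (hab (u * t * p)
    (Ideal.mem_span_singleton.mpr ⟨u * q * s, by linear_combination hu⟩))
  have hunit := IsLocalization.map_units B (u * t * s)
  have h3 : algebraMap C B (u * t * s : M) * ψ g = algebraMap C B b * algebraMap C B k := by
    rw [← map_mul, ← hk]
    simp only [Submonoid.coe_mul, map_mul, ← hp]; ring
  have h4 := congrArg χ h3
  have hχ₀ : ∀ c, χ (algebraMap C B c) = χ₀ c := fun c => by rw [← hψ, hχψ]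
  rw [map_mul, map_mul, hχψ, hχ₀ b] at h4
  obtain ⟨v, hv⟩ := (hunit.map χ).exists_left_inv
  refine Ideal.mem_span_singleton.mpr ⟨v * χ (algebraMap C B k), ?_⟩
  linear_combination v * h4 - g * hv

theorem mem_nonZeroDivisors_of_span_eq {R : Type*} [CommRing R] {a b : R}
    (ha : a ∈ nonZeroDivisors R) (h : Ideal.span {a} = Ideal.span {b}) :
    b ∈ nonZeroDivisors R := by
  obtain ⟨c, hc⟩ := Ideal.mem_span_singleton.mp (h ▸ Ideal.mem_span_singleton_self a)
  rw [mem_nonZeroDivisors_iff_right] at ha ⊢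
  intro z hz
  refine ha z ?_
  rw [hc, ← mul_assoc, hz, zero_mul]

theorem exists_specMap_comp_fromSpecStalk {X : Scheme.{0}} {R : CommRingCat.{0}} [IsLocalRing R]
    (ε : Spec R ⟶ X) {w : X} (h : ε (IsLocalRing.closedPoint R) = w) :
    ∃ ψ : X.presheaf.stalk w ⟶ R, Spec.map ψ ≫ X.fromSpecStalk w = ε := by
  subst h
  exact ⟨Scheme.stalkClosedPointTo ε, Scheme.Spec_stalkClosedPointTo_fromSpecStalk ε⟩

/-- If `Spec 𝒪_{X,w} ⟶ X` factors through `σ : Spec C ⟶ X`, then `𝒪_{X,w}` is a retract of a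
localization `B` of `C`. -/
theorem exists_retract_of_factorization {X : Scheme.{0}} {w : X} {C : CommRingCat.{0}}
    (σ : Spec C ⟶ X) (χ₀ : C ⟶ X.presheaf.stalk w) (h : Spec.map χ₀ ≫ σ = X.fromSpecStalk w) :
    ∃ (M : Submonoid C) (ψ : X.presheaf.stalk w ⟶ CommRingCat.of (Localization M))
      (χ : CommRingCat.of (Localization M) ⟶ X.presheaf.stalk w), ψ ≫ χ = 𝟙 _ ∧
      Spec.map ψ ≫ X.fromSpecStalk w =
        Spec.map (CommRingCat.ofHom (algebraMap C (Localization M))) ≫ σ := by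
  -- `B` is the local ring of `C` at the image of the closed point, and `ψ` is obtained from the map
  -- of `Spec B` to `X`, which sends the closed point to `w`
  let 𝔮 : Ideal C := (IsLocalRing.maximalIdeal (X.presheaf.stalk w)).comap χ₀.hom
  let χ' : Localization 𝔮.primeCompl →+* X.presheaf.stalk w :=
    IsLocalization.lift (M := 𝔮.primeCompl) (g := χ₀.hom) (by
      intro c
      by_contra h
      exact c.2 h)
  let χ : CommRingCat.of (Localization 𝔮.primeCompl) ⟶ X.presheaf.stalk w := CommRingCat.ofHom χ'
  have hχ : ∀ c, χ' (algebraMap C _ c) = χ₀.hom c := fun c => IsLocalization.lift_eq _ c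
  have hχε : Spec.map χ ≫ Spec.map (CommRingCat.ofHom (algebraMap C (Localization 𝔮.primeCompl))) ≫
      σ = X.fromSpecStalk w := by
    rw [← h, ← Category.assoc, ← Spec.map_comp]
    congr 2
    ext c
    exact hχ c
  have hlocal : IsLocalRing (CommRingCat.of (Localization 𝔮.primeCompl)) :=
    inferInstanceAs (IsLocalRing (Localization.AtPrime 𝔮))
  have hloc : IsLocalHom χ.hom := by
    refine ⟨fun b hb => ?_⟩
    obtain ⟨c, t, rfl⟩ := IsLocalization.exists_mk'_eq 𝔮.primeCompl b
    refine (IsLocalization.AtPrime.isUnit_mk'_iff (Localization.AtPrime 𝔮) 𝔮 c t).mpr fun hc => ?_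
    have h1 : χ₀.hom c = χ' (IsLocalization.mk' _ c t) * χ₀.hom t := by
      rw [← hχ, ← hχ, ← map_mul, IsLocalization.mk'_spec]
    have hb' : IsUnit (χ' (IsLocalization.mk' _ c t)) := hb
    have ht : IsUnit (χ₀.hom t) := by
      by_contra h
      exact t.2 h
    exact (IsLocalRing.mem_maximalIdeal _).mp hc (h1 ▸ hb'.mul ht)
  have hw : (Spec.map (CommRingCat.ofHom (algebraMap C (Localization 𝔮.primeCompl))) ≫ σ)
      (IsLocalRing.closedPoint (CommRingCat.of (Localization 𝔮.primeCompl))) = w := by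
    have h1 : Spec.map χ (IsLocalRing.closedPoint (X.presheaf.stalk w)) =
        IsLocalRing.closedPoint (CommRingCat.of (Localization 𝔮.primeCompl)) :=
      IsLocalRing.comap_closedPoint χ.hom
    rw [← h1]
    have h2 := congrArg (fun f => f (IsLocalRing.closedPoint (X.presheaf.stalk w))) hχε
    exact h2.trans Scheme.fromSpecStalk_closedPoint
  obtain ⟨ψ, hψ⟩ := exists_specMap_comp_fromSpecStalk _ hw
  refine ⟨𝔮.primeCompl, ψ, χ, ?_, hψ⟩
  apply Spec.map_injective
  rw [← cancel_mono (X.fromSpecStalk w), Spec.map_comp, Category.assoc, hψ, hχε, Spec.map_id]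
  exact (Category.id_comp _).symm

/-- The local ring of a blow-up at a point `w` where the inverse image of the center is generated by
`y` is governed by the chart `A[I/y]`: regularity of pairs in the chart passes to the local ring.
The reason is that the universal property of the blow-up makes the local ring a retract of a
localization of the chart. The base may be replaced by any `Spec A₀ ⟶ X` through which
`Spec 𝒪_{X',w} ⟶ X` factors, for example the spectrum of a local ring of `X`. -/
theorem IsBlowUp.exists_chart {X' X : Scheme.{0}} {π : X' ⟶ X} {Z : X.IdealSheafData}
    (hπ : IsBlowUp π Z) (w : X') {A₀ : CommRingCat.{0}} (φ₀ : Spec A₀ ⟶ X) [Mono φ₀]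
    (α : A₀ ⟶ X'.presheaf.stalk w) (hα : Spec.map α ≫ φ₀ = X'.fromSpecStalk w ≫ π) {y : A₀}
    (hy : y ∈ idealAlong Z φ₀)
    (hgen : (idealAlong Z φ₀).map α.hom = Ideal.span {α.hom y}) :
    ∃ χ₀ : blowUpChart (idealAlong Z φ₀) hy →+* X'.presheaf.stalk w,
      (∀ a, χ₀ (algebraMap A₀ _ a) = α.hom a) ∧
      ∀ a b, (∀ c, a * c ∈ Ideal.span {b} → c ∈ Ideal.span {b}) →
        ∀ g, χ₀ a * g ∈ Ideal.span {χ₀ b} → g ∈ Ideal.span {χ₀ b} := by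
  obtain ⟨s, hs, hsZ⟩ := stalkIdeal_of_isEffectiveCartier hπ.1 w
  rw [stalkIdeal, idealAlong_comap, ← hα, idealAlong_specMap, hgen] at hsZ
  have hy0 : α.hom y ∈ nonZeroDivisors _ := mem_nonZeroDivisors_of_span_eq hs hsZ.symm
  obtain ⟨χ₀, hχ₀⟩ := blowUpChart.exists_lift hy α.hom hy0 hgen
  refine ⟨χ₀, hχ₀, ?_⟩
  have hyC : ∀ N, algebraMap A₀ (blowUpChart (idealAlong Z φ₀) hy) (y ^ N) ∈
      nonZeroDivisors (blowUpChart (idealAlong Z φ₀) hy) := by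
    intro N
    rw [mem_nonZeroDivisors_iff_right]
    intro c hc
    refine blowUpChart.pow_mul_cancel hy N ?_
    rw [mul_zero, mul_comm]; exact hc
  -- `σ` maps the chart to `X'`, by existence in the universal property
  obtain ⟨ι, hι⟩ : ∃ ι : A₀ ⟶ CommRingCat.of (blowUpChart (idealAlong Z φ₀) hy),
    ι = CommRingCat.ofHom (algebraMap A₀ _) := ⟨_, rfl⟩
  have hιa : ∀ a, algebraMap A₀ (blowUpChart (idealAlong Z φ₀) hy) a = ι.hom a := by
    intro a; rw [hι]; rfl
  have hq : IsEffectiveCartier (Z.comap (Spec.map ι ≫ φ₀)) := by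
    refine isEffectiveCartier_comap_of_idealAlong (s := ι.hom y) ?_ ?_
    · have := hyC 1
      rwa [pow_one, hιa] at this
    · rw [idealAlong_specMap, hι]; exact blowUpChart.map_ideal hy
  obtain ⟨σ, hσ, -⟩ := hπ.2 _ _ hq
  have hια : ι ≫ CommRingCat.ofHom χ₀ = α := by
    ext a
    rw [← hχ₀, hι]; rfl
  -- `Spec 𝒪_{X',w} ⟶ X'` factors through `σ`, by uniqueness in the universal property
  have hCR : Spec.map (CommRingCat.ofHom χ₀) ≫ σ = X'.fromSpecStalk w := by
    have hcart : IsEffectiveCartier (Z.comap (X'.fromSpecStalk w ≫ π)) := by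
      rw [← hα]
      refine isEffectiveCartier_comap_of_idealAlong hy0 ?_
      rw [idealAlong_specMap, hgen]
    refine (hπ.2 _ _ hcart).unique ?_ rfl
    rw [Category.assoc, hσ, ← hα, ← Category.assoc, ← Spec.map_comp, hια]
  obtain ⟨M, ψ, χ, hψχ, hψ⟩ := exists_retract_of_factorization σ (CommRingCat.ofHom χ₀) hCR
  have hψα : α ≫ ψ = ι ≫ CommRingCat.ofHom (algebraMap _ (Localization M)) := by
    apply Spec.map_injective
    rw [← cancel_mono φ₀, Spec.map_comp, Category.assoc, hα, ← Category.assoc, hψ, Category.assoc,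
      hσ, Spec.map_comp, Category.assoc]
  have hα' : ∀ a, ψ.hom (α.hom a) = algebraMap _ (Localization M) (ι.hom a) := fun a =>
    congrArg (fun f => f.hom a) hψα
  have hψχ₀ : ∀ c, ψ.hom (χ₀ c) = algebraMap _ (Localization M) c := by
    intro c
    obtain ⟨N, a, -, h⟩ := blowUpChart.exists_rep hy c
    have h0 := congrArg χ₀ h
    rw [map_mul, hχ₀, hχ₀] at h0
    have h1 := congrArg ψ.hom h0
    rw [map_mul, hα', hα', ← hιa, ← hιa, ← h, map_mul] at h1
    exact (mul_cancel_left_mem_nonZeroDivisors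
      (IsLocalization.map_nonZeroDivisors_le M (Localization M) ⟨_, hyC N, rfl⟩)).mp h1
  intro a b hab g hg
  exact mem_span_of_retract M ψ.hom χ.hom (fun r => congrArg (fun f => f.hom r) hψχ) χ₀ hψχ₀
    hab hg

/-! ### Stalks of strict transforms -/

section StrictTransform

variable {X : Scheme.{0}}

/-- The complement of the closed subset defined by an ideal sheaf. -/
def complOpens (D : X.IdealSheafData) : X.Opens := D.support.compl

theorem complOpens_inf_eq_basicOpen {D : X.IdealSheafData} {W : X.affineOpens} {d : Γ(X, W.1)}
    (h : D.ideal W = Ideal.span {d}) : complOpens D ⊓ W.1 = X.basicOpen d := by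
  have h1 := coe_support_inter D W
  rw [h, Scheme.zeroLocus_span, Scheme.zeroLocus_singleton] at h1
  ext x
  have h2 := Set.ext_iff.mp h1 x
  have h3 : x ∈ X.basicOpen d → x ∈ W.1 := fun hx => X.basicOpen_le d hx
  simp only [Set.mem_inter_iff, Set.mem_compl_iff, SetLike.mem_coe] at h2
  have h4 : x ∈ complOpens D ↔ x ∉ D.support := Iff.rfl
  simp only [TopologicalSpace.Opens.coe_inf, Set.mem_inter_iff, SetLike.mem_coe, h4]
  tauto

/-- The inclusion of the complement of an effective Cartier divisor is quasi-compact. -/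
theorem quasiCompact_complOpens_ι {D : X.IdealSheafData} (hD : IsEffectiveCartier D) :
    QuasiCompact (complOpens D).ι := by
  choose W hxW d hd hW using hD
  refine instHasAffinePropertyQuasiCompactCompactSpaceCarrierCarrierCommRingCat.of_iSup_eq_top
    W ?_ ?_
  · rw [eq_top_iff]
    intro x _
    exact TopologicalSpace.Opens.mem_iSup.mpr ⟨x, hxW x⟩
  · intro x
    refine isCompact_iff_compactSpace.mp ?_
    rw [(complOpens D).ι.isOpenEmbedding.isInducing.isCompact_iff]
    have h1 := (IsAffineOpen.basicOpen (W x).2 (d x)).isCompact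
    rw [← complOpens_inf_eq_basicOpen (hW x)] at h1
    convert h1
    have := (complOpens D).ι.image_preimage_eq_opensRange_inf (W x).1
    rw [Scheme.Opens.opensRange_ι] at this
    exact congrArg SetLike.coe this

/-- A section over a quasi-compact open set `V` vanishes on the locus `O ∩ V` where `d` is
invertible if and only if it is killed by a power of `d`. -/
theorem ι_app_eq_zero_iff {O V : X.Opens} (hV : IsCompact V.1) {d : Γ(X, V)}
    (h : O ⊓ V = X.basicOpen d) (x : Γ(X, V)) :
    (O.ι.app V).hom x = 0 ↔ ∃ k : ℕ, d ^ k * x = 0 := by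
  have hO : O.ι ''ᵁ O.ι ⁻¹ᵁ V = X.basicOpen d := by
    rw [Scheme.Hom.image_preimage_eq_opensRange_inf, Scheme.Opens.opensRange_ι, h]
  have key : ∀ (B : X.Opens) (hB : B = X.basicOpen d) (hBV : B ≤ V),
      (X.presheaf.map (homOfLE hBV).op).hom x = 0 ↔ ∃ k : ℕ, d ^ k * x = 0 := by
    rintro _ rfl hBV
    constructor
    · exact fun h0 => exists_pow_mul_eq_zero_of_res_basicOpen_eq_zero_of_isCompact X hV x d h0
    · rintro ⟨k, hk⟩
      have h1 := congrArg (X.presheaf.map (homOfLE hBV).op).hom hk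
      rw [map_mul, map_zero, map_pow] at h1
      have h2 : IsUnit ((X.presheaf.map (homOfLE hBV).op).hom d) :=
        RingedSpace.isUnit_res_basicOpen X.toRingedSpace d
      exact (h2.pow k).mul_right_eq_zero.mp h1
  exact key _ hO _

/-- Over an affine open set on which the divisor `D` is defined by `d`, the closure of
the part of a closed subscheme outside `D` is defined by the saturation with respect to `d`. -/
theorem mem_ker_restrict_subscheme_iff {D J : X.IdealSheafData} (hD : IsEffectiveCartier D)
    {W : X.affineOpens} {d : Γ(X, W.1)} (h : D.ideal W = Ideal.span {d}) (g : Γ(X, W.1)) :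
    g ∈ (Scheme.Hom.ker ((J.subschemeι ⁻¹ᵁ complOpens D).ι ≫ J.subschemeι)).ideal W ↔
      ∃ k : ℕ, d ^ k * g ∈ J.ideal W := by
  have : QuasiCompact (J.subschemeι ⁻¹ᵁ complOpens D).ι := by
    have := quasiCompact_complOpens_ι hD
    exact MorphismProperty.of_isPullback (P := @QuasiCompact.{0})
      (isPullback_morphismRestrict J.subschemeι _) this
  rw [Scheme.Hom.ker_apply, ← ker_subschemeι_app, RingHom.mem_ker, Scheme.Hom.comp_app]
  simp only [RingHom.mem_ker, map_mul, map_pow]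
  refine ι_app_eq_zero_iff ?_ ?_ _
  · exact (IsAffineOpen.preimage W.2 J.subschemeι).isCompact
  · rw [← Scheme.preimage_basicOpen, ← complOpens_inf_eq_basicOpen h]
    rfl

/-- The stalks of a strict transform: the saturation of the inverse image with respect to a local
equation `e` of the exceptional divisor. -/
theorem stalkIdeal_strictTransform {X' X : Scheme.{0}} {π : X' ⟶ X} {Z I : X.IdealSheafData}
    (hZ : IsEffectiveCartier (Z.comap π)) {w : X'} {e : X'.presheaf.stalk w}
    (he : stalkIdeal (Z.comap π) w = Ideal.span {e}) (g : X'.presheaf.stalk w) :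
    g ∈ stalkIdeal (strictTransform π Z I) w ↔
      ∃ k : ℕ, e ^ k * g ∈ stalkIdeal (I.comap π) w := by
  obtain ⟨W, hw, d, hd, hW⟩ := hZ w
  have key : ∀ g, g ∈ (strictTransform π Z I).ideal W ↔ ∃ k : ℕ, d ^ k * g ∈ (I.comap π).ideal W :=
    mem_ker_restrict_subscheme_iff hZ hW
  rw [stalkIdeal_eq_map _ W hw, hW, Ideal.map_span, Set.image_singleton] at he
  set γ := (X'.presheaf.germ W.1 w hw).hom with hγ
  -- the two generators of the stalk of the center differ by a factor in each direction
  obtain ⟨p, hp⟩ := Ideal.mem_span_singleton.mp (he ▸ Ideal.mem_span_singleton_self (γ d))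
  obtain ⟨q, hq⟩ := Ideal.mem_span_singleton.mp (he ▸ Ideal.mem_span_singleton_self e)
  have hswap : (∃ k : ℕ, e ^ k * g ∈ stalkIdeal (I.comap π) w) ↔
      ∃ k : ℕ, γ d ^ k * g ∈ stalkIdeal (I.comap π) w := by
    constructor
    · rintro ⟨k, hk⟩
      refine ⟨k, ?_⟩
      rw [hp, mul_pow, mul_right_comm]
      exact Ideal.mul_mem_right _ _ hk
    · rintro ⟨k, hk⟩
      refine ⟨k, ?_⟩
      rw [hq, mul_pow, mul_right_comm]
      exact Ideal.mul_mem_right _ _ hk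
  rw [hswap, stalkIdeal_eq_map _ W hw, stalkIdeal_eq_map _ W hw]
  let _ : Algebra Γ(X', W) (X'.presheaf.stalk w) := γ.toAlgebra
  have : IsLocalization.AtPrime (X'.presheaf.stalk w)
      (IsAffineOpen.primeIdealOf W.2 ⟨w, hw⟩).asIdeal :=
    IsAffineOpen.isLocalization_stalk W.2 ⟨w, hw⟩
  set M := (IsAffineOpen.primeIdealOf W.2 ⟨w, hw⟩).asIdeal.primeCompl
  have hmem : ∀ (K : Ideal Γ(X', W)) (z : X'.presheaf.stalk w), z ∈ K.map γ ↔
      ∃ a ∈ K, ∃ t ∈ M, z * γ t = γ a := by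
    intro K z
    refine (IsLocalization.mem_map_algebraMap_iff M (X'.presheaf.stalk w)).trans ?_
    constructor
    · rintro ⟨⟨a, t⟩, h⟩
      exact ⟨a, a.2, t, t.2, h⟩
    · rintro ⟨a, ha, t, ht, h⟩
      exact ⟨⟨⟨a, ha⟩, ⟨t, ht⟩⟩, h⟩
  change g ∈ Ideal.map γ _ ↔ ∃ k : ℕ, γ d ^ k * g ∈ Ideal.map γ _
  simp only [hmem]
  constructor
  · rintro ⟨a, ha, t, ht, h⟩
    obtain ⟨k, hk⟩ := (key a).mp ha
    exact ⟨k, d ^ k * a, hk, t, ht, by rw [map_mul, map_pow, ← h]; ring⟩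
  · rintro ⟨k, a, ha, t, ht, h⟩
    obtain ⟨⟨b, u⟩, hb⟩ := IsLocalization.surj M g
    have hb' : g * γ u = γ b := hb
    obtain ⟨c, hc⟩ := (IsLocalization.eq_iff_exists M (X'.presheaf.stalk w)
      (x := d ^ k * b * t) (y := a * u)).mp (by
        change γ _ = γ _
        rw [map_mul, map_mul, map_mul, map_pow, ← hb', ← h]; ring)
    refine ⟨c * t * b, (key _).mpr ⟨k, ?_⟩, c * t * u, M.mul_mem (M.mul_mem c.2 ht) u.2, ?_⟩
    · have : d ^ k * (c * t * b) = (c * u) * a := by linear_combination hc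
      rw [this]
      exact Ideal.mul_mem_left _ _ ha
    · rw [map_mul, map_mul, map_mul, map_mul, ← hb']; ring

end StrictTransform

/-! ### The blow-up of the intersection of two divisors -/

section Ring

variable {A : Type} [CommRing A]

theorem sup_pow_succ_le (x y : A) (N : ℕ) :
    (Ideal.span {x} ⊔ Ideal.span {y}) ^ (N + 1) ≤
      Ideal.span {y ^ (N + 1)} ⊔ Ideal.span {x} * (Ideal.span {x} ⊔ Ideal.span {y}) ^ N := by
  induction N with
  | zero => simp [sup_comm]
  | succ N ih =>
    rw [pow_succ' _ (N + 1), Ideal.sup_mul]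
    refine sup_le le_sup_right ((Ideal.mul_mono_right ih).trans ?_)
    rw [Ideal.mul_sup, Ideal.span_singleton_mul_span_singleton, ← pow_succ']
    refine sup_le_sup_left ?_ _
    rw [← mul_assoc, mul_comm (Ideal.span {y}), mul_assoc, pow_succ' _ N]
    exact Ideal.mul_mono_right (Ideal.mul_mono_left le_sup_right)

/-- In the chart `A[I/y]` of the blow-up of an ideal `I` generated by a regular sequence `y, x`,
the exceptional divisor `y` is regular modulo the strict transform `x / y`. -/
theorem blowUpChart.mem_span_frac_of_mul_mem {x y : A} {I : Ideal A} (hy : y ∈ I)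
    (hI : I = Ideal.span {x} ⊔ Ideal.span {y}) (hxI : x ∈ I ^ 1)
    (hy0 : y ∈ nonZeroDivisors A) (hyx : ∀ g, y * g ∈ Ideal.span {x} → g ∈ Ideal.span {x})
    (c : blowUpChart I hy)
    (hc : algebraMap A (blowUpChart I hy) y * c ∈ Ideal.span {blowUpChart.frac hy 1 x hxI}) :
    c ∈ Ideal.span {blowUpChart.frac hy 1 x hxI} := by
  set u := blowUpChart.frac hy 1 x hxI with hu
  have hyu : algebraMap A (blowUpChart I hy) y * u = algebraMap A (blowUpChart I hy) x := by
    have := blowUpChart.pow_mul_frac hy 1 x hxI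
    rwa [pow_one] at this
  -- every element of the chart is congruent to an element of `A` modulo `u`
  have hrep : ∃ r : A, c - algebraMap A (blowUpChart I hy) r ∈ Ideal.span {u} := by
    obtain ⟨N, a, ha, h⟩ := blowUpChart.exists_rep hy c
    cases N with
    | zero =>
      refine ⟨a, ?_⟩
      rw [pow_zero, map_one, one_mul] at h
      rw [h, sub_self]
      exact Ideal.zero_mem _
    | succ N =>
      obtain ⟨p, hp, q, hq, hpq⟩ := Submodule.mem_sup.mp (sup_pow_succ_le x y N (hI ▸ ha))
      obtain ⟨r, rfl⟩ := Ideal.mem_span_singleton.mp hp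
      obtain ⟨b, hb, rfl⟩ := Ideal.mem_span_singleton_mul.mp hq
      rw [← hI] at hb
      refine ⟨r, Ideal.mem_span_singleton.mpr ⟨blowUpChart.frac hy N b hb, ?_⟩⟩
      refine blowUpChart.pow_mul_cancel hy (N + 1) ?_
      rw [mul_sub, h, ← hpq, map_add, map_mul, map_mul, add_sub_cancel_left,
        ← blowUpChart.pow_mul_frac hy N b hb, ← hyu, pow_succ, map_mul]
      ring
  obtain ⟨r, hr⟩ := hrep
  -- descending `y * r ∈ (u)` to `A`
  have h1 : algebraMap A (blowUpChart I hy) (y * r) ∈ Ideal.span {u} := by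
    have h2 := Ideal.sub_mem _ hc (Ideal.mul_mem_left _ (algebraMap A (blowUpChart I hy) y) hr)
    rwa [mul_sub, sub_sub_cancel, ← map_mul] at h2
  obtain ⟨c', hc'⟩ := Ideal.mem_span_singleton.mp h1
  obtain ⟨N, a, ha, h⟩ := blowUpChart.exists_rep hy c'
  have h3 : y ^ (N + 2) * r = x * a := by
    apply blowUpChart.algebraMap_injective hy hy0
    have : algebraMap A (blowUpChart I hy) (y ^ (N + 2) * r) =
        algebraMap A (blowUpChart I hy) (y ^ (N + 1)) * algebraMap A (blowUpChart I hy) (y * r) := by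
      rw [← map_mul]; congr 1; ring
    rw [this, hc', map_mul, ← h, ← hyu, pow_succ, map_mul]; ring
  have h4 : ∀ k : ℕ, ∀ g, y ^ k * g ∈ Ideal.span {x} → g ∈ Ideal.span {x} := by
    intro k
    induction k with
    | zero => intro g hg; rwa [pow_zero, one_mul] at hg
    | succ k ih => intro g hg; exact ih g (hyx _ (by rwa [← mul_assoc, ← pow_succ']))
  obtain ⟨r', rfl⟩ := Ideal.mem_span_singleton.mp
    (h4 (N + 2) r (h3 ▸ Ideal.mul_mem_right _ _ (Ideal.mem_span_singleton_self x)))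
  have h5 : algebraMap A (blowUpChart I hy) (x * r') ∈ Ideal.span {u} := by
    rw [map_mul, ← hyu]
    exact Ideal.mul_mem_right _ _ (Ideal.mul_mem_left _ _ (Ideal.mem_span_singleton_self u))
  have := Ideal.add_mem _ hr h5
  rwa [sub_add_cancel] at this

theorem blowUpChart.algebraMap_mem_nonZeroDivisors {y : A} {I : Ideal A} (hy : y ∈ I)
    (hy0 : y ∈ nonZeroDivisors A) {z : A} (hz : z ∈ nonZeroDivisors A) (c : blowUpChart I hy)
    (hc : algebraMap A (blowUpChart I hy) z * c = 0) : c = 0 := by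
  obtain ⟨N, a, ha, h⟩ := blowUpChart.exists_rep hy c
  have h1 : z * a = 0 := by
    apply blowUpChart.algebraMap_injective hy hy0
    rw [map_mul, ← h, mul_left_comm, hc, mul_zero, map_zero]
  have h2 : a = 0 := (mul_left_mem_nonZeroDivisors_eq_zero_iff hz).mp h1
  refine blowUpChart.pow_mul_cancel hy N ?_
  rw [h, h2, map_zero, mul_zero]

/-- Two elements of a local ring that generate a principal ideal with a regular generator are
comparable for divisibility. -/
theorem dvd_or_dvd_of_span_sup {R : Type*} [CommRing R] [IsLocalRing R] {a b e : R}
    (he : e ∈ nonZeroDivisors R) (h : Ideal.span {a} ⊔ Ideal.span {b} = Ideal.span {e}) :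
    a ∣ b ∨ b ∣ a := by
  obtain ⟨p, hp⟩ := Ideal.mem_span_singleton.mp
    (h ▸ Ideal.mem_sup_left (Ideal.mem_span_singleton_self a) : a ∈ Ideal.span {e})
  obtain ⟨q, hq⟩ := Ideal.mem_span_singleton.mp
    (h ▸ Ideal.mem_sup_right (Ideal.mem_span_singleton_self b) : b ∈ Ideal.span {e})
  obtain ⟨_, ha, _, hb, hab⟩ := Submodule.mem_sup.mp (h.ge (Ideal.mem_span_singleton_self e))
  obtain ⟨r, rfl⟩ := Ideal.mem_span_singleton.mp ha
  obtain ⟨s, rfl⟩ := Ideal.mem_span_singleton.mp hb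
  have h1 : p * r + q * s = 1 := by
    have : e * (p * r + q * s) = e * 1 := by
      rw [mul_one]; conv_rhs => rw [← hab, hp, hq]
      ring
    exact (mul_cancel_left_mem_nonZeroDivisors he).mp this
  rcases IsLocalRing.isUnit_or_isUnit_of_add_one h1 with h2 | h2
  · left
    obtain ⟨t, ht⟩ := (isUnit_of_mul_isUnit_left h2).exists_right_inv
    exact ⟨t * q, by rw [hp, hq]; linear_combination (-e * q) * ht⟩
  · right
    obtain ⟨t, ht⟩ := (isUnit_of_mul_isUnit_left h2).exists_right_inv
    exact ⟨t * p, by rw [hp, hq]; linear_combination (-e * p) * ht⟩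

end Ring

/-- Every stalk of the ideal sheaf is generated by a nonzerodivisor. -/
def IsStalkwiseCartier {X : Scheme.{0}} (I : X.IdealSheafData) : Prop :=
  ∀ x : X, ∃ s ∈ nonZeroDivisors (X.presheaf.stalk x), stalkIdeal I x = Ideal.span {s}

/-- `J` is regular modulo `I`: at every point, `I : J = I`. For two divisors, this says that they
have no common component, scheme-theoretically. -/
def IsRegularModulo {X : Scheme.{0}} (J I : X.IdealSheafData) : Prop :=
  ∀ (x : X) (g : X.presheaf.stalk x), (∀ a ∈ stalkIdeal J x, a * g ∈ stalkIdeal I x) →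
    g ∈ stalkIdeal I x

theorem IsRegularModulo.mem_span {X : Scheme.{0}} {I J : X.IdealSheafData}
    (h : IsRegularModulo J I) {p : X} {x y : X.presheaf.stalk p}
    (hx : stalkIdeal I p = Ideal.span {x}) (hy : stalkIdeal J p = Ideal.span {y})
    (g : X.presheaf.stalk p) (hg : y * g ∈ Ideal.span {x}) : g ∈ Ideal.span {x} := by
  rw [← hx]
  refine h p g fun a ha => ?_
  rw [hy] at ha
  obtain ⟨b, rfl⟩ := Ideal.mem_span_singleton.mp ha
  rw [hx, mul_right_comm]
  exact Ideal.mul_mem_right _ _ hg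

theorem IsRegularModulo.symm {X : Scheme.{0}} {I J : X.IdealSheafData} (hI : IsStalkwiseCartier I)
    (hJ : IsStalkwiseCartier J) (h : IsRegularModulo J I) : IsRegularModulo I J := by
  intro p g hg
  obtain ⟨x, hx, hxI⟩ := hI p
  obtain ⟨y, hy, hyJ⟩ := hJ p
  have h1 := hg x (hxI ▸ Ideal.mem_span_singleton_self x)
  rw [hyJ] at h1 ⊢
  obtain ⟨b, hb⟩ := Ideal.mem_span_singleton.mp h1
  obtain ⟨c, rfl⟩ := Ideal.mem_span_singleton.mp
    (h.mem_span hxI hyJ b (Ideal.mem_span_singleton.mpr ⟨g, hb.symm⟩))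
  refine Ideal.mem_span_singleton.mpr ⟨c, ?_⟩
  refine (mul_cancel_left_mem_nonZeroDivisors hx).mp ?_
  rw [hb]; ring

section Step

variable {X' X : Scheme.{0}} {π : X' ⟶ X}

/-- The blow-up of the intersection of two divisors `E : x = 0` and `F : y = 0` without common
component, at a point where `y` generates the exceptional divisor. -/
theorem IsBlowUp.local_of_dvd {E F : X.IdealSheafData} (hπ : IsBlowUp π (E ⊔ F)) {w : X'}
    {x y : X.presheaf.stalk (π w)} (hy0 : y ∈ nonZeroDivisors _)
    (hx : stalkIdeal E (π w) = Ideal.span {x}) (hy : stalkIdeal F (π w) = Ideal.span {y})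
    (hreg : IsRegularModulo F E) (hdvd : (π.stalkMap w).hom y ∣ (π.stalkMap w).hom x) :
    (∃ u, (π.stalkMap w).hom x = (π.stalkMap w).hom y * u ∧
      ∀ g, (π.stalkMap w).hom y * g ∈ Ideal.span {u} → g ∈ Ideal.span {u}) ∧
    ∀ z ∈ nonZeroDivisors (X.presheaf.stalk (π w)),
      (π.stalkMap w).hom z ∈ nonZeroDivisors (X'.presheaf.stalk w) := by
  have hZ : idealAlong (E ⊔ F) (X.fromSpecStalk (π w)) = Ideal.span {x} ⊔ Ideal.span {y} := by
    rw [idealAlong_sup, ← hx, ← hy]; rfl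
  have hyZ : y ∈ idealAlong (E ⊔ F) (X.fromSpecStalk (π w)) := by
    rw [hZ]; exact Ideal.mem_sup_right (Ideal.mem_span_singleton_self y)
  have hxZ : x ∈ idealAlong (E ⊔ F) (X.fromSpecStalk (π w)) ^ 1 := by
    rw [hZ, pow_one]; exact Ideal.mem_sup_left (Ideal.mem_span_singleton_self x)
  obtain ⟨χ, hχ, htr⟩ := hπ.exists_chart w (X.fromSpecStalk (π w)) (π.stalkMap w)
    (Scheme.SpecMap_stalkMap_fromSpecStalk π) hyZ (by
      rw [hZ, Ideal.map_sup, Ideal.map_span, Ideal.map_span, Set.image_singleton,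
        Set.image_singleton, sup_eq_right]
      exact Ideal.span_singleton_le_span_singleton.mpr hdvd)
  refine ⟨⟨χ (blowUpChart.frac hyZ 1 x hxZ), ?_, ?_⟩, ?_⟩
  · have := congrArg χ (blowUpChart.pow_mul_frac hyZ 1 x hxZ)
    rw [map_mul, hχ, hχ, pow_one] at this
    exact this.symm
  · rw [← hχ]
    refine htr _ _ fun c hc => ?_
    exact blowUpChart.mem_span_frac_of_mul_mem hyZ hZ hxZ hy0
      (fun g hg => hreg.mem_span hx hy g hg) c hc
  · intro z hz
    rw [mem_nonZeroDivisors_iff_right]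
    intro g hg
    have h1 := htr (algebraMap _ _ z) 0 (fun c hc => by
      rw [Ideal.mem_span_singleton, zero_dvd_iff] at hc ⊢
      exact blowUpChart.algebraMap_mem_nonZeroDivisors hyZ hy0 hz c hc) g
    rw [map_zero, hχ, Ideal.mem_span_singleton, Ideal.mem_span_singleton, zero_dvd_iff,
      zero_dvd_iff] at h1
    exact h1 (by rw [mul_comm]; exact hg)

theorem stalkIdeal_comap_of_span {I : X.IdealSheafData} {w : X'} {x : X.presheaf.stalk (π w)}
    (hx : stalkIdeal I (π w) = Ideal.span {x}) :
    stalkIdeal (I.comap π) w = Ideal.span {(π.stalkMap w).hom x} := by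
  rw [stalkIdeal_comap, hx, Ideal.map_span, Set.image_singleton]

theorem stalkIdeal_sup (I J : X.IdealSheafData) (x : X) :
    stalkIdeal (I ⊔ J) x = stalkIdeal I x ⊔ stalkIdeal J x := idealAlong_sup I J _

theorem stalkIdeal_mul (I J : X.IdealSheafData) (x : X) :
    stalkIdeal (I * J) x = stalkIdeal I x * stalkIdeal J x := idealAlong_mul I J _

/-- The blow-up of the intersection of two divisors `E` and `F` without common component: at every
point, the exceptional divisor has an equation `e`, and the equations of `E` and `F` become `e * u`
and `e * v`, with `u` or `v` a unit and `e` regular modulo both. -/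
theorem IsBlowUp.local_structure {E F : X.IdealSheafData} (hπ : IsBlowUp π (E ⊔ F))
    (hE : IsStalkwiseCartier E) (hF : IsStalkwiseCartier F) (hFE : IsRegularModulo F E) (w : X') :
    (∃ e u v : X'.presheaf.stalk w, u ∈ nonZeroDivisors _ ∧ v ∈ nonZeroDivisors _ ∧
      stalkIdeal ((E ⊔ F).comap π) w = Ideal.span {e} ∧
      stalkIdeal (E.comap π) w = Ideal.span {e * u} ∧
      stalkIdeal (F.comap π) w = Ideal.span {e * v} ∧
      (∀ g, e * g ∈ Ideal.span {u} → g ∈ Ideal.span {u}) ∧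
      (∀ g, e * g ∈ Ideal.span {v} → g ∈ Ideal.span {v}) ∧ (IsUnit u ∨ IsUnit v)) ∧
    ∀ z ∈ nonZeroDivisors (X.presheaf.stalk (π w)),
      (π.stalkMap w).hom z ∈ nonZeroDivisors (X'.presheaf.stalk w) := by
  obtain ⟨x, hx0, hx⟩ := hE (π w)
  obtain ⟨y, hy0, hy⟩ := hF (π w)
  obtain ⟨s, hs, hZs⟩ := stalkIdeal_of_isEffectiveCartier hπ.1 w
  have hZ : stalkIdeal ((E ⊔ F).comap π) w =
      Ideal.span {(π.stalkMap w).hom x} ⊔ Ideal.span {(π.stalkMap w).hom y} := by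
    rw [comap_sup, stalkIdeal_sup, stalkIdeal_comap_of_span hx, stalkIdeal_comap_of_span hy]
  have hmem : ∀ g : X'.presheaf.stalk w, g ∈ Ideal.span {(1 : X'.presheaf.stalk w)} :=
    fun g => by rw [Ideal.span_singleton_one]; trivial
  have hnzd : ∀ {a u : X'.presheaf.stalk w}, a * u ∈ nonZeroDivisors (X'.presheaf.stalk w) →
      u ∈ nonZeroDivisors (X'.presheaf.stalk w) := fun h => (mul_mem_nonZeroDivisors.mp h).2
  rcases dvd_or_dvd_of_span_sup hs (hZ ▸ hZs) with hdvd | hdvd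
  · obtain ⟨⟨v, hv, hvreg⟩, hz⟩ := IsBlowUp.local_of_dvd (sup_comm E F ▸ hπ) hx0 hy hx
      (hFE.symm hE hF) hdvd
    refine ⟨⟨(π.stalkMap w).hom x, 1, v, one_mem _, ?_, ?_, ?_, ?_, ?_, hvreg, Or.inl isUnit_one⟩,
      hz⟩
    · exact hnzd (hv ▸ hz y hy0)
    · rw [hZ, sup_eq_left]
      exact Ideal.span_singleton_le_span_singleton.mpr hdvd
    · rw [mul_one, stalkIdeal_comap_of_span hx]
    · rw [← hv, stalkIdeal_comap_of_span hy]
    · exact fun g _ => hmem g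
  · obtain ⟨⟨u, hu, hureg⟩, hz⟩ := IsBlowUp.local_of_dvd hπ hy0 hx hy hFE hdvd
    refine ⟨⟨(π.stalkMap w).hom y, u, 1, ?_, one_mem _, ?_, ?_, ?_, hureg, ?_, Or.inr isUnit_one⟩,
      hz⟩
    · exact hnzd (hu ▸ hz x hx0)
    · rw [hZ, sup_eq_right]
      exact Ideal.span_singleton_le_span_singleton.mpr hdvd
    · rw [← hu, stalkIdeal_comap_of_span hx]
    · rw [mul_one, stalkIdeal_comap_of_span hy]
    · exact fun g _ => hmem g

/-- If the inverse image of a divisor is `e * u` with `e` the exceptional divisor and `e` regular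
modulo `u`, then the strict transform is `u`. -/
theorem stalkIdeal_strictTransform_of_regular {Z I : X.IdealSheafData}
    (hZ : IsEffectiveCartier (Z.comap π)) {w : X'} {e u : X'.presheaf.stalk w} {k : ℕ}
    (he : stalkIdeal (Z.comap π) w = Ideal.span {e})
    (hI : stalkIdeal (I.comap π) w = Ideal.span {e ^ k * u})
    (hreg : ∀ g, e * g ∈ Ideal.span {u} → g ∈ Ideal.span {u}) :
    stalkIdeal (strictTransform π Z I) w = Ideal.span {u} := by
  have hpow : ∀ j : ℕ, ∀ g, e ^ j * g ∈ Ideal.span {u} → g ∈ Ideal.span {u} := by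
    intro j
    induction j with
    | zero => intro g hg; rwa [pow_zero, one_mul] at hg
    | succ j ih => intro g hg; exact ih g (hreg _ (by rwa [← mul_assoc, ← pow_succ']))
  ext g
  rw [stalkIdeal_strictTransform hZ he, hI]
  constructor
  · rintro ⟨j, hj⟩
    refine hpow j g ?_
    obtain ⟨c, hc⟩ := Ideal.mem_span_singleton.mp hj
    exact Ideal.mem_span_singleton.mpr ⟨e ^ k * c, by rw [hc]; ring⟩
  · intro hg
    obtain ⟨c, rfl⟩ := Ideal.mem_span_singleton.mp hg
    exact ⟨k, Ideal.mem_span_singleton.mpr ⟨c, by ring⟩⟩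

theorem ext_of_stalkIdeal_eq {I J : X.IdealSheafData} (h : ∀ x, stalkIdeal I x = stalkIdeal J x) :
    I = J :=
  le_antisymm (le_of_stalkIdeal_le fun x => (h x).le) (le_of_stalkIdeal_le fun x => (h x).ge)

theorem stalkIdeal_top (x : X) : stalkIdeal (⊤ : X.IdealSheafData) x = ⊤ := idealAlong_top _

theorem stalkIdeal_eq_top_or_of_sup_eq_top {I J : X.IdealSheafData} (h : I ⊔ J = ⊤) (x : X) :
    stalkIdeal I x = ⊤ ∨ stalkIdeal J x = ⊤ := by
  by_contra! hne
  have h1 := sup_le (IsLocalRing.le_maximalIdeal hne.1) (IsLocalRing.le_maximalIdeal hne.2)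
  rw [← stalkIdeal_sup, h, stalkIdeal_top, top_le_iff] at h1
  exact (IsLocalRing.maximalIdeal.isMaximal _).ne_top h1

/-- The strict transform of a closed subscheme that does not meet the center is its inverse
image. -/
theorem strictTransform_eq_comap {Z G : X.IdealSheafData} (hZ : IsEffectiveCartier (Z.comap π))
    (h : G ⊔ Z = ⊤) : strictTransform π Z G = G.comap π := by
  refine ext_of_stalkIdeal_eq fun w => ?_
  obtain ⟨e, -, he⟩ := stalkIdeal_of_isEffectiveCartier hZ w
  have h' : G.comap π ⊔ Z.comap π = ⊤ := by rw [← comap_sup, h, comap_top]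
  ext g
  rw [stalkIdeal_strictTransform hZ he]
  rcases stalkIdeal_eq_top_or_of_sup_eq_top h' w with h1 | h1
  · simp [h1]
  · rw [he, Ideal.span_singleton_eq_top] at h1
    constructor
    · rintro ⟨k, hk⟩
      exact (Ideal.unit_mul_mem_iff_mem _ (h1.pow k)).mp hk
    · exact fun hg => ⟨0, by rwa [pow_zero, one_mul]⟩

theorem stalkIdeal_strictTransform_of_notMem_center {Z G : X.IdealSheafData}
    (hZ : IsEffectiveCartier (Z.comap π)) {w : X'} (h : stalkIdeal (Z.comap π) w = ⊤) :
    stalkIdeal (strictTransform π Z G) w = stalkIdeal (G.comap π) w := by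
  ext g
  rw [stalkIdeal_strictTransform hZ (e := 1) (by rw [h, Ideal.span_singleton_one])]
  simp

/-- Outside of the center, a blow-up does not change the relative position of divisors. -/
theorem IsBlowUp.regular_of_notMem_center {Z : X.IdealSheafData} (hπ : IsBlowUp π Z) {w : X'}
    (hw : stalkIdeal (Z.comap π) w = ⊤) {x y : X.presheaf.stalk (π w)}
    (h : ∀ g, y * g ∈ Ideal.span {x} → g ∈ Ideal.span {x}) (g : X'.presheaf.stalk w)
    (hg : (π.stalkMap w).hom y * g ∈ Ideal.span {(π.stalkMap w).hom x}) :
    g ∈ Ideal.span {(π.stalkMap w).hom x} := by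
  have hZ : stalkIdeal Z (π w) = ⊤ := by
    by_contra h
    rw [← ne_eq, ← mem_support_iff_stalkIdeal] at h
    have : w ∈ (Z.comap π).support := by rw [support_comap]; exact h
    exact mem_support_iff_stalkIdeal.mp this hw
  have h1 : (1 : X.presheaf.stalk (π w)) ∈ idealAlong Z (X.fromSpecStalk (π w)) := by
    change _ ∈ stalkIdeal Z (π w)
    rw [hZ]; trivial
  obtain ⟨χ, hχ, htr⟩ := hπ.exists_chart w (X.fromSpecStalk (π w)) (π.stalkMap w)
    (Scheme.SpecMap_stalkMap_fromSpecStalk π) h1 (by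
      change Ideal.map _ (stalkIdeal Z (π w)) = _
      rw [hZ, Ideal.map_top, map_one, Ideal.span_singleton_one])
  rw [← hχ, ← hχ] at hg
  rw [← hχ]
  refine htr _ _ (fun c hc => ?_) g hg
  have hrep : ∀ c : blowUpChart (idealAlong Z (X.fromSpecStalk (π w))) h1,
      ∃ a : X.presheaf.stalk (π w), c = algebraMap (X.presheaf.stalk (π w)) _ a := by
    intro c
    obtain ⟨N, a, -, hN⟩ := blowUpChart.exists_rep h1 c
    exact ⟨a, by rwa [one_pow, map_one, one_mul] at hN⟩
  obtain ⟨a, rfl⟩ := hrep c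
  obtain ⟨d, hd⟩ := Ideal.mem_span_singleton.mp hc
  obtain ⟨b, rfl⟩ := hrep d
  rw [← map_mul, ← map_mul] at hd
  have h2 := h a (Ideal.mem_span_singleton.mpr
    ⟨b, blowUpChart.algebraMap_injective h1 (one_mem _) hd⟩)
  obtain ⟨r, rfl⟩ := Ideal.mem_span_singleton.mp h2
  exact Ideal.mem_span_singleton.mpr ⟨algebraMap (X.presheaf.stalk (π w)) _ r, map_mul _ _ _⟩

end Step

/-! ### Strict transforms of divisors -/

section Divisors

variable {X' X : Scheme.{0}} {π : X' ⟶ X}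

theorem sup_eq_top_of_stalkIdeal {I J : X.IdealSheafData}
    (h : ∀ x, stalkIdeal I x = ⊤ ∨ stalkIdeal J x = ⊤) : I ⊔ J = ⊤ := by
  refine ext_of_stalkIdeal_eq fun x => ?_
  rw [stalkIdeal_sup, stalkIdeal_top]
  rcases h x with h | h <;> simp [h]

theorem isStalkwiseCartier_of_isEffectiveCartier {I : X.IdealSheafData}
    (h : IsEffectiveCartier I) : IsStalkwiseCartier I :=
  fun x => stalkIdeal_of_isEffectiveCartier h x

theorem isRegularModulo_of_sup_eq_top {I J : X.IdealSheafData} (h : J ⊔ I = ⊤) :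
    IsRegularModulo J I := by
  intro x g hg
  rcases stalkIdeal_eq_top_or_of_sup_eq_top h x with h1 | h1
  · simpa using hg 1 (by rw [h1]; trivial)
  · rw [h1]; trivial

theorem comap_le_strictTransform {Z I : X.IdealSheafData}
    (hZ : IsEffectiveCartier (Z.comap π)) : I.comap π ≤ strictTransform π Z I := by
  refine le_of_stalkIdeal_le fun w g hg => ?_
  obtain ⟨e, -, he⟩ := stalkIdeal_of_isEffectiveCartier hZ w
  rw [stalkIdeal_strictTransform hZ he]
  exact ⟨0, by rwa [pow_zero, one_mul]⟩

theorem strictTransform_sup_eq_top {Z I J : X.IdealSheafData}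
    (hZ : IsEffectiveCartier (Z.comap π)) (h : I ⊔ J = ⊤) :
    strictTransform π Z I ⊔ strictTransform π Z J = ⊤ := by
  rw [eq_top_iff, ← comap_top (f := π), ← h, comap_sup]
  exact sup_le_sup (comap_le_strictTransform hZ) (comap_le_strictTransform hZ)

theorem strictTransform_sup_center_eq_top {Z I : X.IdealSheafData}
    (hZ : IsEffectiveCartier (Z.comap π)) (h : I ⊔ Z = ⊤) :
    strictTransform π Z I ⊔ Z.comap π = ⊤ := by
  rw [strictTransform_eq_comap hZ h, ← comap_sup, h, comap_top]

/-- Strict transforms that are disjoint along the exceptional divisor are regular modulo each other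
if the original divisors are. -/
theorem IsBlowUp.isRegularModulo_strictTransform {Z I J : X.IdealSheafData} (hπ : IsBlowUp π Z)
    (hI : IsStalkwiseCartier I) (hJ : IsStalkwiseCartier J) (h : IsRegularModulo J I)
    (hdisj : ∀ w, stalkIdeal (Z.comap π) w = ⊤ ∨ stalkIdeal (strictTransform π Z J) w = ⊤ ∨
      stalkIdeal (strictTransform π Z I) w = ⊤) :
    IsRegularModulo (strictTransform π Z J) (strictTransform π Z I) := by
  intro w g hg
  rcases hdisj w with hw | hw | hw
  · obtain ⟨x, -, hx⟩ := hI (π w)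
    obtain ⟨y, -, hy⟩ := hJ (π w)
    rw [stalkIdeal_strictTransform_of_notMem_center hπ.1 hw, stalkIdeal_comap_of_span hx]
    rw [stalkIdeal_strictTransform_of_notMem_center hπ.1 hw,
      stalkIdeal_strictTransform_of_notMem_center hπ.1 hw, stalkIdeal_comap_of_span hx,
      stalkIdeal_comap_of_span hy] at hg
    exact hπ.regular_of_notMem_center hw (fun g hg => h.mem_span hx hy g hg) g
      (hg _ (Ideal.mem_span_singleton_self _))
  · simpa using hg 1 (by rw [hw]; trivial)
  · rw [hw]; trivial

variable {E F : X.IdealSheafData}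

theorem IsBlowUp.comap_eq_mul_strictTransform (hπ : IsBlowUp π (E ⊔ F))
    (hE : IsStalkwiseCartier E) (hF : IsStalkwiseCartier F) (hFE : IsRegularModulo F E) :
    E.comap π = (E ⊔ F).comap π * strictTransform π (E ⊔ F) E := by
  refine ext_of_stalkIdeal_eq fun w => ?_
  obtain ⟨⟨e, u, v, hu, hv, hZ, hEw, hFw, hureg, hvreg, huv⟩, -⟩ := hπ.local_structure hE hF hFE w
  rw [stalkIdeal_mul, stalkIdeal_strictTransform_of_regular (k := 1) hπ.1 hZ
    (by rw [pow_one]; exact hEw) hureg, hZ, hEw, Ideal.span_singleton_mul_span_singleton]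

theorem IsBlowUp.isStalkwiseCartier_strictTransform (hπ : IsBlowUp π (E ⊔ F))
    (hE : IsStalkwiseCartier E) (hF : IsStalkwiseCartier F) (hFE : IsRegularModulo F E) :
    IsStalkwiseCartier (strictTransform π (E ⊔ F) E) := by
  intro w
  obtain ⟨⟨e, u, v, hu, hv, hZ, hEw, hFw, hureg, hvreg, huv⟩, -⟩ := hπ.local_structure hE hF hFE w
  exact ⟨u, hu, stalkIdeal_strictTransform_of_regular (k := 1) hπ.1 hZ
    (by rw [pow_one]; exact hEw) hureg⟩

theorem IsBlowUp.isRegularModulo_exceptional (hπ : IsBlowUp π (E ⊔ F))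
    (hE : IsStalkwiseCartier E) (hF : IsStalkwiseCartier F) (hFE : IsRegularModulo F E) :
    IsRegularModulo ((E ⊔ F).comap π) (strictTransform π (E ⊔ F) E) := by
  intro w g hg
  obtain ⟨⟨e, u, v, hu, hv, hZ, hEw, hFw, hureg, hvreg, huv⟩, -⟩ := hπ.local_structure hE hF hFE w
  rw [stalkIdeal_strictTransform_of_regular (k := 1) hπ.1 hZ
    (by rw [pow_one]; exact hEw) hureg] at hg ⊢
  exact hureg g (hg e (hZ ▸ Ideal.mem_span_singleton_self e))

theorem IsBlowUp.strictTransform_sup_strictTransform (hπ : IsBlowUp π (E ⊔ F))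
    (hE : IsStalkwiseCartier E) (hF : IsStalkwiseCartier F) (hFE : IsRegularModulo F E) :
    strictTransform π (E ⊔ F) E ⊔ strictTransform π (E ⊔ F) F = ⊤ := by
  refine sup_eq_top_of_stalkIdeal fun w => ?_
  obtain ⟨⟨e, u, v, hu, hv, hZ, hEw, hFw, hureg, hvreg, huv⟩, -⟩ := hπ.local_structure hE hF hFE w
  rw [stalkIdeal_strictTransform_of_regular (k := 1) hπ.1 hZ (by rw [pow_one]; exact hEw) hureg,
    stalkIdeal_strictTransform_of_regular (k := 1) hπ.1 hZ (by rw [pow_one]; exact hFw) hvreg]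
  exact huv.imp Ideal.span_singleton_eq_top.mpr Ideal.span_singleton_eq_top.mpr

theorem IsBlowUp.isStalkwiseCartier_comap (hπ : IsBlowUp π (E ⊔ F))
    (hE : IsStalkwiseCartier E) (hF : IsStalkwiseCartier F) (hFE : IsRegularModulo F E)
    {G : X.IdealSheafData} (hG : IsStalkwiseCartier G) : IsStalkwiseCartier (G.comap π) := by
  intro w
  obtain ⟨z, hz, hGz⟩ := hG (π w)
  exact ⟨_, (hπ.local_structure hE hF hFE w).2 z hz, stalkIdeal_comap_of_span hGz⟩

theorem comap_pow (π : X' ⟶ X) (I : X.IdealSheafData) (k : ℕ) :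
    (I ^ k).comap π = I.comap π ^ k := by
  induction k with
  | zero => rw [pow_zero, pow_zero, one_eq_top, one_eq_top, comap_top]
  | succ k ih => rw [pow_succ, pow_succ, comap_mul, ih]

theorem comap_listProd (π : X' ⟶ X) (L : List X.IdealSheafData) :
    L.prod.comap π = (L.map (·.comap π)).prod := by
  induction L with
  | nil => rw [List.prod_nil, one_eq_top, comap_top, List.map_nil, List.prod_nil, one_eq_top]
  | cons a L ih => rw [List.prod_cons, comap_mul, ih, List.map_cons, List.prod_cons]

end Divisors

/-! ### The chain of divisors of an iterated blow-up -/

/-- The determinant `κ' r - κ r'` of two labels `(κ, r)` and `(κ', r')`: it is positive if `(κ, r)`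
comes first in the order of the chain, which is the order of the slopes `κ / r`. -/
def cross (a b : ℕ × ℕ) : ℤ := b.1 * a.2 - a.1 * b.2

theorem cross_self (a : ℕ × ℕ) : cross a a = 0 := sub_self _

theorem cross_swap (a b : ℕ × ℕ) : cross b a = - cross a b := by
  simp only [cross]; ring

theorem cross_add_left (a b c : ℕ × ℕ) : cross (a + b) c = cross a c + cross b c := by
  simp only [cross, Prod.fst_add, Prod.snd_add]; push_cast; ring

theorem cross_add_right (a b c : ℕ × ℕ) : cross a (b + c) = cross a b + cross a c := by
  simp only [cross, Prod.fst_add, Prod.snd_add]; push_cast; ring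

/-- The properties of the chain of labels that are preserved by inserting the sum of two
neighbours. -/
structure IsLabelChain (l : List (ℕ × ℕ)) : Prop where
  pairwise : l.Pairwise fun a b => 0 < cross a b
  isChain : l.IsChain fun a b => cross a b = 1
  coprime : ∀ a ∈ l, Nat.Coprime a.1 a.2
  last_mem : (1, 0) ∈ l

theorem coprime_of_cross_eq_one {a b : ℕ × ℕ} (h : cross a b = 1) : Nat.Coprime b.1 b.2 := by
  rw [← Nat.isCoprime_iff_coprime]
  exact ⟨a.2, -a.1, by rw [← h, cross]; ring⟩

theorem isLabelChain_origin : IsLabelChain [(0, 1), (1, 0)] where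
  pairwise := by simp [cross]
  isChain := by simp [cross]
  coprime := by simp
  last_mem := by simp

theorem IsLabelChain.insert {L R : List (ℕ × ℕ)} {a b : ℕ × ℕ}
    (h : IsLabelChain (L ++ a :: b :: R)) : IsLabelChain (L ++ a :: (a + b) :: b :: R) := by
  have h1 := h.pairwise
  have h2 := h.isChain
  rw [List.pairwise_append, List.pairwise_cons, List.pairwise_cons] at h1
  obtain ⟨hL, ⟨ha, hb, hR⟩, hLR⟩ := h1
  have hab : cross a b = 1 := by
    rw [List.isChain_append] at h2
    exact (List.isChain_cons_cons.mp h2.2.1).1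
  have e1 : cross a (a + b) = 1 := by rw [cross_add_right, cross_self, hab, zero_add]
  have e2 : cross (a + b) b = 1 := by rw [cross_add_left, cross_self, hab, add_zero]
  refine ⟨?_, ?_, ?_, ?_⟩
  · rw [List.pairwise_append, List.pairwise_cons, List.pairwise_cons, List.pairwise_cons]
    refine ⟨hL, ⟨?_, ?_, hb, hR⟩, ?_⟩
    · intro c hc
      rcases List.mem_cons.mp hc with rfl | hc
      · omega
      · exact ha c hc
    · intro c hc
      rcases List.mem_cons.mp hc with rfl | hc
      · omega
      · rw [cross_add_left]
        exact add_pos (ha c (List.mem_cons_of_mem _ hc)) (hb c hc)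
    · intro c hc c' hc'
      rcases List.mem_cons.mp hc' with rfl | hc'
      · exact hLR c hc _ (by simp)
      · rcases List.mem_cons.mp hc' with rfl | hc'
        · rw [cross_add_right]
          exact add_pos (hLR c hc _ (by simp)) (hLR c hc _ (by simp))
        · exact hLR c hc c' (List.mem_cons_of_mem _ hc')
  · rw [List.isChain_append] at h2 ⊢
    refine ⟨h2.1, ?_, by simpa using h2.2.2⟩
    have h3 := (List.isChain_cons_cons.mp h2.2.1).2
    exact List.isChain_cons_cons.mpr ⟨e1, List.isChain_cons_cons.mpr ⟨e2, h3⟩⟩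
  · intro c hc
    by_cases hc' : c = a + b
    · rw [hc']; exact coprime_of_cross_eq_one e1
    · refine h.coprime c ?_
      simp only [List.mem_append, List.mem_cons] at hc ⊢
      tauto
  · have := h.last_mem
    simp only [List.mem_append, List.mem_cons] at this ⊢
    tauto

/-! ### Models of the hypersurface -/

section Models

variable {n : ℕ} {A : GermRing n}

/-- The properties of a model of the hypersurface `f = 0` that are preserved by blowing up the
intersection of two neighbours of the chain. -/
structure IsGoodModel (d : ℕ) (f : A.carrier) (M : Model A) : Prop where
  labels : IsLabelChain (M.chain.map Prod.fst)
  cartier : ∀ D ∈ M.chain, IsStalkwiseCartier D.2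
  /-- Distinct divisors have no common component. -/
  regular : ∀ D ∈ M.chain, ∀ D' ∈ M.chain, D.1 ≠ D'.1 → IsRegularModulo D.2 D'.2
  /-- Two divisors that are separated by a third one in the chain are disjoint. -/
  disjoint : ∀ a ∈ M.chain, ∀ c ∈ M.chain, ∀ b ∈ M.chain, 0 < cross a.1 c.1 → 0 < cross c.1 b.1 →
    a.2 ⊔ b.2 = ⊤
  /-- The order of vanishing of the maximal ideal of the origin along `E_(κ,r)` is `r`. -/
  origin_eq : A.origin.comap M.μ = (M.chain.map fun D => D.2 ^ D.1.2).prod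
  /-- The order of vanishing of `f` along `E_(κ,r)` is `κ + r d`. -/
  hypersurface_eq : (A.hypersurface f).comap M.μ =
    (M.chain.map fun D => D.2 ^ (D.1.1 + D.1.2 * d)).prod
  /-- Formal arcs that are not contained in the hypersurface lift to the model. -/
  exists_lift : ∀ φ : Spec (CommRingCat.of (PowerSeries ℂ)) ⟶ A.base,
    idealAlong (A.hypersurface f) φ ≠ ⊥ → ∃ φ', φ' ≫ M.μ = φ

/-- A blow-up admits a lift of every formal arc that is not contained in the center. -/
theorem IsBlowUp.exists_lift_arc {X' X : Scheme.{0}} {π : X' ⟶ X} {Z : X.IdealSheafData}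
    (hπ : IsBlowUp π Z) (φ : Spec (CommRingCat.of (PowerSeries ℂ)) ⟶ X)
    (h : idealAlong Z φ ≠ ⊥) : ∃ φ', φ' ≫ π = φ := by
  obtain ⟨s, hs⟩ := (IsPrincipalIdealRing.principal
    (show Ideal (PowerSeries ℂ) from idealAlong Z φ)).principal
  have hs0 : s ≠ 0 := by
    rintro rfl
    refine h (hs.trans ?_)
    exact Ideal.span_singleton_eq_bot.mpr rfl
  obtain ⟨φ', hφ', -⟩ := hπ.2 _ φ
    (isEffectiveCartier_comap_of_idealAlong (mem_nonZeroDivisors_of_ne_zero hs0) hs)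
  exact ⟨φ', hφ'⟩

section Step

variable {d : ℕ} {f : A.carrier} {M : Model A} {X' : Scheme.{0}} {π : X' ⟶ M.X}
  {L R : List (LabelledDivisor M.X)} {E F : LabelledDivisor M.X}

theorem Model.mem_chain_blowUp (hchain : M.chain = L ++ E :: F :: R) {D : LabelledDivisor X'} :
    D ∈ (M.blowUp π L E F R).chain ↔
      (∃ a ∈ M.chain, D = (a.1, strictTransform π (E.2 ⊔ F.2) a.2)) ∨
        D = (E.1 + F.1, (E.2 ⊔ F.2).comap π) := by
  rw [hchain]
  let st : LabelledDivisor M.X → LabelledDivisor X' :=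
    fun D => (D.1, strictTransform π (E.2 ⊔ F.2) D.2)
  change D ∈ (L.map st ++ st E :: (E.1 + F.1, (E.2 ⊔ F.2).comap π) :: st F :: R.map st :
    List (LabelledDivisor X')) ↔ _
  simp only [List.mem_append, List.mem_map, List.mem_cons]
  constructor
  · rintro (⟨a, ha, rfl⟩ | rfl | rfl | rfl | ⟨a, ha, rfl⟩)
    exacts [Or.inl ⟨a, by tauto, rfl⟩, Or.inl ⟨E, by tauto, rfl⟩, Or.inr rfl,
      Or.inl ⟨F, by tauto, rfl⟩, Or.inl ⟨a, by tauto, rfl⟩]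
  · rintro (⟨a, ha | rfl | rfl | ha, rfl⟩ | rfl)
    exacts [Or.inl ⟨a, ha, rfl⟩, Or.inr (Or.inl rfl), Or.inr (Or.inr (Or.inr (Or.inl rfl))),
      Or.inr (Or.inr (Or.inr (Or.inr ⟨a, ha, rfl⟩))), Or.inr (Or.inr (Or.inl rfl))]

theorem mul_mul_pow_eq {T : Type*} [CommMonoid T] (l r D a b : T) (i j : ℕ) :
    l * ((D * a) ^ i * ((D * b) ^ j * r)) = l * (a ^ i * (D ^ (i + j) * (b ^ j * r))) := by
  rw [mul_pow, mul_pow, pow_add]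
  ac_rfl

theorem Model.comap_prod_chain (hchain : M.chain = L ++ E :: F :: R)
    (hL : ∀ a ∈ L, a.2.comap π = strictTransform π (E.2 ⊔ F.2) a.2)
    (hR : ∀ a ∈ R, a.2.comap π = strictTransform π (E.2 ⊔ F.2) a.2)
    (hE : E.2.comap π = (E.2 ⊔ F.2).comap π * strictTransform π (E.2 ⊔ F.2) E.2)
    (hF : F.2.comap π = (E.2 ⊔ F.2).comap π * strictTransform π (E.2 ⊔ F.2) F.2)
    (wt : ℕ × ℕ → ℕ) (hwt : wt (E.1 + F.1) = wt E.1 + wt F.1) :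
    (M.chain.map fun D : LabelledDivisor M.X => D.2 ^ wt D.1).prod.comap π =
      ((M.blowUp π L E F R).chain.map fun D : LabelledDivisor X' => D.2 ^ wt D.1).prod := by
  have h : ∀ l : List (LabelledDivisor M.X),
      (∀ a ∈ l, a.2.comap π = strictTransform π (E.2 ⊔ F.2) a.2) →
      (l.map fun D => D.2.comap π ^ wt D.1) =
        l.map fun D => strictTransform π (E.2 ⊔ F.2) D.2 ^ wt D.1 := by
    intro l hl
    refine List.map_congr_left fun a ha => ?_
    rw [hl a ha]
  let st : LabelledDivisor M.X → LabelledDivisor X' :=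
    fun D => (D.1, strictTransform π (E.2 ⊔ F.2) D.2)
  change _ = ((L.map st ++ st E :: (E.1 + F.1, (E.2 ⊔ F.2).comap π) :: st F :: R.map st :
    List (LabelledDivisor X')).map fun D => D.2 ^ wt D.1).prod
  rw [comap_listProd, hchain]
  simp only [st, List.map_append, List.map_cons, List.prod_append, List.prod_cons,
    List.map_map, Function.comp_def, h L hL, h R hR, comap_pow, hE, hF, hwt]
  exact mul_mul_pow_eq _ _ _ _ _ _ _

/-- Blowing up the intersection of the neighbours `E` and `F` separates their strict transforms. By
the disjointness property, the other divisors do not meet the center, so that they are not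
changed. -/
theorem IsGoodModel.blowUp (hd : 1 ≤ d) (h : IsGoodModel d f M)
    (hchain : M.chain = L ++ E :: F :: R) (hπ : IsBlowUp π (E.2 ⊔ F.2)) :
    IsGoodModel d f (M.blowUp π L E F R) := by
  have hmem : ∀ a, a ∈ M.chain ↔ a ∈ L ∨ a = E ∨ a = F ∨ a ∈ R := by
    intro a; rw [hchain]; simp
  have hEm : E ∈ M.chain := (hmem E).mpr (by tauto)
  have hFm : F ∈ M.chain := (hmem F).mpr (by tauto)
  have hlab := h.labels
  have hpw := hlab.pairwise
  have hch := hlab.isChain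
  rw [hchain, List.map_append, List.map_cons, List.map_cons] at hlab hpw hch
  have hEF : cross E.1 F.1 = 1 := by
    rw [List.isChain_append] at hch
    exact (List.isChain_cons_cons.mp hch.2.1).1
  rw [List.pairwise_append, List.pairwise_cons, List.pairwise_cons] at hpw
  obtain ⟨-, ⟨hE, hF, -⟩, hLR⟩ := hpw
  have hLE : ∀ a ∈ L, 0 < cross a.1 E.1 := fun a ha =>
    hLR _ (List.mem_map_of_mem ha) _ (by simp)
  have hLF : ∀ a ∈ L, 0 < cross a.1 F.1 := fun a ha =>
    hLR _ (List.mem_map_of_mem ha) _ (by simp)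
  have hLR' : ∀ a ∈ L, ∀ b ∈ R, 0 < cross a.1 b.1 := fun a ha b hb =>
    hLR _ (List.mem_map_of_mem ha) _
      (List.mem_cons_of_mem _ (List.mem_cons_of_mem _ (List.mem_map_of_mem hb)))
  have hER : ∀ a ∈ R, 0 < cross E.1 a.1 := fun a ha =>
    hE _ (List.mem_cons_of_mem _ (List.mem_map_of_mem ha))
  have hFR : ∀ a ∈ R, 0 < cross F.1 a.1 := fun a ha => hF _ (List.mem_map_of_mem ha)
  have hne : E.1 ≠ F.1 := by intro h; rw [h, cross_self] at hEF; omega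
  have hEc := h.cartier E hEm
  have hFc := h.cartier F hFm
  have hreg := h.regular F hFm E hEm hne.symm
  have hreg' := h.regular E hEm F hFm hne
  have hπ' : IsBlowUp π (F.2 ⊔ E.2) := sup_comm E.2 F.2 ▸ hπ
  -- every divisor other than `E` and `F` is separated by one of them from the other one
  have hEFm : ∀ a ∈ M.chain, a = E ∨ a = F ∨ a.2 ⊔ (E.2 ⊔ F.2) = ⊤ := by
    intro a ha
    rcases (hmem a).mp ha with h1 | h1 | h1 | h1
    · refine Or.inr (Or.inr (top_le_iff.mp ?_))
      rw [← h.disjoint a ha E hEm F hFm (hLE a h1) (by omega)]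
      exact sup_le_sup_left le_sup_right _
    · exact Or.inl h1
    · exact Or.inr (Or.inl h1)
    · refine Or.inr (Or.inr (top_le_iff.mp ?_))
      rw [← h.disjoint E hEm F hFm a ha (by omega) (hFR a h1), sup_comm]
      exact sup_le_sup_left le_sup_left _
  have hLfar : ∀ a ∈ L, a.2 ⊔ (E.2 ⊔ F.2) = ⊤ := by
    intro a ha
    rcases hEFm a ((hmem a).mpr (Or.inl ha)) with rfl | rfl | h1
    · have := hLE _ ha; rw [cross_self] at this; omega
    · have := hLF _ ha; rw [cross_self] at this; omega
    · exact h1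
  have hRfar : ∀ a ∈ R, a.2 ⊔ (E.2 ⊔ F.2) = ⊤ := by
    intro a ha
    rcases hEFm a ((hmem a).mpr (by tauto)) with rfl | rfl | h1
    · have := hER _ ha; rw [cross_self] at this; omega
    · have := hFR _ ha; rw [cross_self] at this; omega
    · exact h1
  have hcE := hπ.comap_eq_mul_strictTransform hEc hFc hreg
  have hcF := hπ'.comap_eq_mul_strictTransform hFc hEc hreg'
  rw [sup_comm F.2 E.2] at hcF
  have hrE := hπ.isRegularModulo_exceptional hEc hFc hreg
  have hrF := hπ'.isRegularModulo_exceptional hFc hEc hreg'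
  rw [sup_comm F.2 E.2] at hrF
  have hsE := hπ.isStalkwiseCartier_strictTransform hEc hFc hreg
  have hsF := hπ'.isStalkwiseCartier_strictTransform hFc hEc hreg'
  rw [sup_comm F.2 E.2] at hsF
  have hsD := isStalkwiseCartier_of_isEffectiveCartier hπ.1
  have hst := hπ.strictTransform_sup_strictTransform hEc hFc hreg
  have hcart : ∀ a ∈ M.chain, IsStalkwiseCartier (strictTransform π (E.2 ⊔ F.2) a.2) := by
    intro a ha
    rcases hEFm a ha with rfl | rfl | h1
    · exact hsE
    · exact hsF
    · rw [strictTransform_eq_comap hπ.1 h1]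
      exact hπ.isStalkwiseCartier_comap hEc hFc hreg (h.cartier a ha)
  have hexc : ∀ a ∈ M.chain,
      IsRegularModulo ((E.2 ⊔ F.2).comap π) (strictTransform π (E.2 ⊔ F.2) a.2) := by
    intro a ha
    rcases hEFm a ha with rfl | rfl | h1
    · exact hrE
    · exact hrF
    · refine isRegularModulo_of_sup_eq_top ?_
      rw [sup_comm]
      exact strictTransform_sup_center_eq_top hπ.1 h1
  -- the sign of `cross` with the new label `E.1 + F.1` tells on which side of it a divisor lies
  have key : ∀ x ∈ M.chain, (0 < cross x.1 (E.1 + F.1) → x ∈ L ∨ x = E) ∧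
        (0 < cross (E.1 + F.1) x.1 → x = F ∨ x ∈ R) := by
    have hsw := cross_swap E.1 F.1
    intro x hx
    rw [cross_add_left, cross_add_right, cross_swap x.1 E.1, cross_swap x.1 F.1]
    rcases (hmem x).mp hx with h1 | rfl | rfl | h1
    · have := hLE x h1; have := hLF x h1; refine ⟨fun _ => by tauto, fun _ => by omega⟩
    · rw [cross_self]; refine ⟨fun _ => by tauto, fun _ => by omega⟩
    · rw [cross_self]; refine ⟨fun _ => by omega, fun _ => by tauto⟩
    · have h2 := hER x h1
      have h3 := hFR x h1
      rw [cross_swap] at h2 h3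
      refine ⟨fun _ => by omega, fun _ => by tauto⟩
  have keyL : ∀ x ∈ M.chain, ∀ y ∈ M.chain, (y ∈ L ∨ y = E) → 0 < cross x.1 y.1 → x ∈ L := by
    intro x hx y hy hyL hxy
    rw [cross_swap] at hxy
    rcases hyL with h1 | rfl <;> rcases (hmem x).mp hx with h2 | rfl | rfl | h2
    · exact h2
    · have := hLE y h1; omega
    · have := hLF y h1; omega
    · have := hLR' y h1 x h2; omega
    · exact h2
    · rw [cross_self] at hxy; omega
    · omega
    · have := hER x h2; omega
  have keyR : ∀ x ∈ M.chain, ∀ y ∈ M.chain, (y = F ∨ y ∈ R) → 0 < cross y.1 x.1 → x ∈ R := by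
    intro x hx y hy hyR hxy
    rw [cross_swap] at hxy
    rcases hyR with rfl | h1 <;> rcases (hmem x).mp hx with h2 | rfl | rfl | h2
    · have := hLF x h2; omega
    · omega
    · rw [cross_self] at hxy; omega
    · exact h2
    · have := hLR' x h2 y h1; omega
    · have := hER y h1; omega
    · have := hFR y h1; omega
    · exact h2
  refine ⟨?_, ?_, ?_, ?_, ?_, ?_, ?_⟩
  · convert hlab.insert using 1
    simp [Model.blowUp, Function.comp_def]
  · intro D hD
    rcases (Model.mem_chain_blowUp hchain).mp hD with ⟨a, ha, rfl⟩ | rfl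
    exacts [hcart a ha, hsD]
  · intro D hD D' hD' hDD'
    rcases (Model.mem_chain_blowUp hchain).mp hD with ⟨a, ha, rfl⟩ | rfl <;>
      rcases (Model.mem_chain_blowUp hchain).mp hD' with ⟨b, hb, rfl⟩ | rfl
    · refine hπ.isRegularModulo_strictTransform (h.cartier b hb) (h.cartier a ha)
        (h.regular a ha b hb hDD') fun w => ?_
      rcases hEFm a ha with rfl | rfl | h1
      · rcases hEFm b hb with rfl | rfl | h2
        · exact absurd rfl hDD'
        · exact Or.inr (stalkIdeal_eq_top_or_of_sup_eq_top hst w)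
        · have := stalkIdeal_eq_top_or_of_sup_eq_top
            (strictTransform_sup_center_eq_top hπ.1 h2) w
          tauto
      · rcases hEFm b hb with rfl | rfl | h2
        · exact Or.inr (stalkIdeal_eq_top_or_of_sup_eq_top hst w).symm
        · exact absurd rfl hDD'
        · have := stalkIdeal_eq_top_or_of_sup_eq_top
            (strictTransform_sup_center_eq_top hπ.1 h2) w
          tauto
      · have := stalkIdeal_eq_top_or_of_sup_eq_top (strictTransform_sup_center_eq_top hπ.1 h1) w
        tauto
    · exact (hexc a ha).symm (hcart a ha) hsD
    · exact hexc b hb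
    · exact absurd rfl hDD'
  · intro D₁ hD₁ D₂ hD₂ D₃ hD₃ h12 h23
    rcases (Model.mem_chain_blowUp hchain).mp hD₂ with ⟨c, hc, rfl⟩ | rfl
    · rcases (Model.mem_chain_blowUp hchain).mp hD₁ with ⟨a, ha, rfl⟩ | rfl
      · rcases (Model.mem_chain_blowUp hchain).mp hD₃ with ⟨b, hb, rfl⟩ | rfl
        · exact strictTransform_sup_eq_top hπ.1 (h.disjoint a ha c hc b hb h12 h23)
        · have : a.2 ⊔ (E.2 ⊔ F.2) = ⊤ :=
            hLfar a (keyL a ha c hc ((key c hc).1 h23) h12)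
          exact strictTransform_sup_center_eq_top hπ.1 this
      · rcases (Model.mem_chain_blowUp hchain).mp hD₃ with ⟨b, hb, rfl⟩ | rfl
        · have : b.2 ⊔ (E.2 ⊔ F.2) = ⊤ :=
            hRfar b (keyR b hb c hc ((key c hc).2 h12) h23)
          rw [sup_comm]
          exact strictTransform_sup_center_eq_top hπ.1 this
        · rw [cross_swap] at h23
          omega
    · rcases (Model.mem_chain_blowUp hchain).mp hD₁ with ⟨a, ha, rfl⟩ | rfl
      · rcases (Model.mem_chain_blowUp hchain).mp hD₃ with ⟨b, hb, rfl⟩ | rfl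
        · rcases (key a ha).1 h12 with h1 | rfl <;> rcases (key b hb).2 h23 with h2 | h2
          · subst h2
            exact strictTransform_sup_eq_top hπ.1
              (h.disjoint a ha E hEm b hb (hLE a h1) (by omega))
          · exact strictTransform_sup_eq_top hπ.1
              (h.disjoint a ha E hEm b hb (hLE a h1) (hER b h2))
          · subst h2; exact hst
          · exact strictTransform_sup_eq_top hπ.1
              (h.disjoint a ha F hFm b hb (by omega) (hFR b h2))
        · rw [cross_self] at h23; omega
      · rw [cross_self] at h12; omega
  · have := Model.comap_prod_chain hchain
      (fun a ha => (strictTransform_eq_comap hπ.1 (hLfar a ha)).symm)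
      (fun a ha => (strictTransform_eq_comap hπ.1 (hRfar a ha)).symm) hcE hcF (fun a => a.2) rfl
    rw [← h.origin_eq, ← comap_comp] at this
    exact this
  · have := Model.comap_prod_chain hchain
      (fun a ha => (strictTransform_eq_comap hπ.1 (hLfar a ha)).symm)
      (fun a ha => (strictTransform_eq_comap hπ.1 (hRfar a ha)).symm) hcE hcF
      (fun a => a.1 + a.2 * d) (by simp only [Prod.fst_add, Prod.snd_add]; ring)
    rw [← h.hypersurface_eq, ← comap_comp] at this
    exact this
  · intro φ hφ
    obtain ⟨φ', hφ'⟩ := h.exists_lift φ hφ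
    have hbot : idealAlong E.2 φ' ≠ ⊥ := by
      intro hbot
      apply hφ
      rw [← hφ', ← idealAlong_comap, h.hypersurface_eq, idealAlong_listProd]
      refine (List.prod_eq_zero ?_ : _ = (0 : Ideal (PowerSeries ℂ)))
      rw [List.map_map, List.mem_map]
      refine ⟨E, hEm, ?_⟩
      rw [Function.comp_apply, idealAlong_pow, hbot]
      have h0 : E.1.1 + E.1.2 * d ≠ 0 := by
        intro h0
        have h1 : E.1.1 = 0 := by omega
        have h2 : E.1.2 = 0 := by
          have : E.1.2 * d = 0 := by omega
          rcases Nat.mul_eq_zero.mp this with h | h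
          · exact h
          · omega
        simp [cross, h1, h2] at hEF
      exact zero_pow h0
    obtain ⟨φ'', hφ''⟩ := hπ.exists_lift_arc φ' (fun h0 => hbot (by
      rw [idealAlong_sup] at h0
      exact (sup_eq_bot_iff.mp h0).1))
    refine ⟨φ'', ?_⟩
    change φ'' ≫ π ≫ M.μ = φ
    rw [← Category.assoc, hφ'', hφ']

end Step

end Models

/-! ### The blow-up of the origin -/

section Order

variable {n : ℕ} {d : ℕ} {f : MvPowerSeries (Fin n) ℂ}

theorem IsSemihomogeneous.order_eq (hn : 0 < n) (hf : IsSemihomogeneous d f) : f.order = d := by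
  obtain ⟨h, F, hh, hcrit, hF, rfl⟩ := hf
  have : Nonempty (Fin n) := ⟨⟨0, hn⟩⟩
  obtain ⟨x, i, hx⟩ := hcrit.exists
  have h0 : h ≠ 0 := by
    rintro rfl
    simp at hx
  have hord : (h : MvPowerSeries (Fin n) ℂ).order = d := by
    obtain ⟨e, he⟩ := MvPolynomial.exists_coeff_ne_zero h0
    rw [MvPowerSeries.order_eq_nat]
    have hdeg : ∀ e, h.coeff e ≠ 0 → e.degree = d := fun e he => by
      rw [← hh he, Finsupp.degree_eq_weight_one]
      rfl
    refine ⟨⟨e, by rwa [MvPolynomial.coeff_coe], hdeg e he⟩, fun e he => ?_⟩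
    rw [MvPolynomial.coeff_coe]
    by_contra hne
    exact he.ne (hdeg e hne)
  rw [MvPowerSeries.order_add_of_order_ne, hord, min_eq_left hF.le]
  rw [hord]; exact hF.ne

end Order

namespace GermRing

variable {n : ℕ} (A : GermRing n)

/-- The maximal ideal `(x₁, …, xₙ)` of the origin. -/
def maxIdeal : Ideal A.carrier :=
  Ideal.span (Set.range fun i => (⟨MvPowerSeries.X i, A.X_mem i⟩ : A.carrier))

theorem X_mem_maxIdeal (i : Fin n) :
    (⟨MvPowerSeries.X i, A.X_mem i⟩ : A.carrier) ∈ A.maxIdeal :=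
  Ideal.subset_span ⟨i, rfl⟩

theorem le_order_of_mem_maxIdeal_pow (k : ℕ) : ∀ a ∈ A.maxIdeal ^ k,
    (k : ℕ∞) ≤ (a : MvPowerSeries (Fin n) ℂ).order := by
  have h1 : ∀ a ∈ A.maxIdeal, MvPowerSeries.constantCoeff (a : MvPowerSeries (Fin n) ℂ) = 0 := by
    have : A.maxIdeal ≤ RingHom.ker
        ((MvPowerSeries.constantCoeff (σ := Fin n) (R := ℂ)).comp A.carrier.val.toRingHom) := by
      rw [maxIdeal, Ideal.span_le]
      rintro _ ⟨i, rfl⟩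
      exact MvPowerSeries.constantCoeff_X i
    exact fun a ha => this ha
  induction k with
  | zero => intro a _; simp
  | succ k ih =>
    intro a ha
    rw [pow_succ] at ha
    refine Submodule.mul_induction_on ha (fun b hb c hc => ?_) (fun b c hb hc => ?_)
    · change _ ≤ ((b : MvPowerSeries (Fin n) ℂ) * c).order
      rw [MvPowerSeries.order_mul]
      push_cast
      exact add_le_add (ih b hb) (MvPowerSeries.one_le_order_iff_constCoeff_eq_zero.mpr (h1 c hc))
    · exact (le_min hb hc).trans MvPowerSeries.min_order_le_add

/-- Every element of `A` is congruent to a polynomial of degree at most `k` modulo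
`(x₁, …, xₙ) ^ (k + 1)`. -/
theorem exists_polynomial_add (k : ℕ) : ∀ a : A.carrier, ∃ p : MvPolynomial (Fin n) ℂ,
    p.totalDegree ≤ k ∧ ∃ b ∈ A.maxIdeal ^ (k + 1),
      (a : MvPowerSeries (Fin n) ℂ) = (p : MvPowerSeries (Fin n) ℂ) + b := by
  have h0 : ∀ a : A.carrier, ∃ c : ℂ, ∃ b ∈ A.maxIdeal, a = algebraMap ℂ A.carrier c + b := by
    intro a
    refine ⟨MvPowerSeries.constantCoeff (a : MvPowerSeries (Fin n) ℂ),
      a - algebraMap ℂ A.carrier _, A.mem_span _ ?_, (add_sub_cancel _ _).symm⟩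
    change MvPowerSeries.constantCoeff ((a : MvPowerSeries (Fin n) ℂ) - MvPowerSeries.C _) = 0
    rw [map_sub, MvPowerSeries.constantCoeff_C, sub_self]
  have hC : ∀ c : ℂ, ((algebraMap ℂ A.carrier c : A.carrier) : MvPowerSeries (Fin n) ℂ) =
      (MvPolynomial.C c : MvPolynomial (Fin n) ℂ) := by
    intro c
    rw [MvPolynomial.coe_C]; rfl
  induction k with
  | zero =>
    intro a
    obtain ⟨c, b, hb, rfl⟩ := h0 a
    exact ⟨MvPolynomial.C c, by simp, b, by simpa using hb, by rw [← hC]; rfl⟩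
  | succ k ih =>
    intro a
    obtain ⟨c, b, hb, rfl⟩ := h0 a
    obtain ⟨g, rfl⟩ := Ideal.mem_span_range_iff_exists_fun.mp hb
    choose p hp q hq hpq using fun i => ih (g i)
    refine ⟨MvPolynomial.C c + ∑ i, p i * MvPolynomial.X i, ?_,
      ∑ i, q i * ⟨MvPowerSeries.X i, A.X_mem i⟩, ?_, ?_⟩
    · refine (MvPolynomial.totalDegree_add _ _).trans (max_le (by simp) ?_)
      refine MvPolynomial.totalDegree_finsetSum_le fun i _ => ?_
      refine (MvPolynomial.totalDegree_mul _ _).trans ?_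
      rw [MvPolynomial.totalDegree_X]
      exact Nat.add_le_add_right (hp i) 1
    · rw [pow_succ]
      exact Ideal.sum_mem _ fun i _ => Ideal.mul_mem_mul (hq i) (A.X_mem_maxIdeal i)
    · push_cast
      rw [show ((∑ i, p i * MvPolynomial.X i : MvPolynomial (Fin n) ℂ) :
        MvPowerSeries (Fin n) ℂ) = ∑ i, (p i : MvPowerSeries (Fin n) ℂ) * MvPowerSeries.X i from by
          rw [← MvPolynomial.coeToMvPowerSeries.ringHom_apply, map_sum]
          exact Finset.sum_congr rfl fun i _ => by simp, add_assoc, ← Finset.sum_add_distrib]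
      congr 1
      refine Finset.sum_congr rfl fun i _ => ?_
      rw [hpq i, add_mul]

theorem mem_maxIdeal_pow_of_le_order {k : ℕ} {a : A.carrier}
    (h : (k : ℕ∞) ≤ (a : MvPowerSeries (Fin n) ℂ).order) : a ∈ A.maxIdeal ^ k := by
  cases k with
  | zero => simp
  | succ k =>
    obtain ⟨p, hp, b, hb, hab⟩ := A.exists_polynomial_add k a
    have hpo : ((k + 1 : ℕ) : ℕ∞) ≤ (p : MvPowerSeries (Fin n) ℂ).order := by
      rw [← add_sub_cancel_right (p : MvPowerSeries (Fin n) ℂ) (b : MvPowerSeries (Fin n) ℂ), ← hab,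
        sub_eq_add_neg]
      refine (le_min h ?_).trans MvPowerSeries.min_order_le_add
      exact A.le_order_of_mem_maxIdeal_pow _ (-b) (neg_mem hb)
    have hp0 : p = 0 := by
      ext e
      rw [MvPolynomial.coeff_zero]
      by_cases he : e.degree < k + 1
      · rw [← MvPolynomial.coeff_coe]
        exact MvPowerSeries.coeff_of_lt_order (lt_of_lt_of_le (by exact_mod_cast he) hpo)
      · refine MvPolynomial.coeff_eq_zero_of_totalDegree_lt ?_
        change p.totalDegree < e.degree
        omega
    have : a = b := Subtype.ext (by rw [hab, hp0]; simp)
    rwa [this]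

theorem mem_maxIdeal_pow_iff {k : ℕ} {a : A.carrier} :
    a ∈ A.maxIdeal ^ k ↔ (k : ℕ∞) ≤ (a : MvPowerSeries (Fin n) ℂ).order :=
  ⟨A.le_order_of_mem_maxIdeal_pow k a, A.mem_maxIdeal_pow_of_le_order⟩

/-- In the chart `A[𝔪/y]` of the blow-up of the origin, the exceptional divisor `y` is regular modulo
the strict transform `f / y ^ d` of the hypersurface, because orders of power series are
additive under multiplication. -/
theorem mem_span_frac_of_mul_mem {f : A.carrier} {d : ℕ}
    (hf : (f : MvPowerSeries (Fin n) ℂ).order = d) (hfm : f ∈ A.maxIdeal ^ d) {y : A.carrier}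
    (hy : y ∈ A.maxIdeal) (hord : (y : MvPowerSeries (Fin n) ℂ).order = 1)
    (hy0 : y ∈ nonZeroDivisors A.carrier) (c : blowUpChart A.maxIdeal hy)
    (hc : algebraMap A.carrier (blowUpChart A.maxIdeal hy) y * c ∈
      Ideal.span {blowUpChart.frac hy d f hfm}) :
    c ∈ Ideal.span {blowUpChart.frac hy d f hfm} := by
  obtain ⟨c', hc'⟩ := Ideal.mem_span_singleton.mp hc
  obtain ⟨N, a, ha, h⟩ := blowUpChart.exists_rep hy c
  obtain ⟨N', a', ha', h'⟩ := blowUpChart.exists_rep hy c'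
  have key : y ^ (d + N' + 1) * a = f * a' * y ^ N := by
    apply blowUpChart.algebraMap_injective hy hy0
    have e1 : algebraMap A.carrier (blowUpChart A.maxIdeal hy) (y ^ (d + N' + 1) * a) =
        algebraMap _ _ (y ^ d) * algebraMap _ _ (y ^ N') * algebraMap _ _ (y ^ N) *
          (algebraMap _ _ y * c) := by
      rw [map_mul, ← h, pow_add, pow_add, map_mul, map_mul, pow_one]; ring
    rw [e1, hc', map_mul, map_mul, ← h', ← blowUpChart.pow_mul_frac hy d f hfm]; ring
  have ha'' : a' ∈ A.maxIdeal ^ (N' + 1) := by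
    rw [A.mem_maxIdeal_pow_iff] at ha ⊢
    have e2 := congrArg (fun a : A.carrier => (a : MvPowerSeries (Fin n) ℂ).order) key
    have hpow : ∀ k : ℕ, ((y ^ k : A.carrier) : MvPowerSeries (Fin n) ℂ).order = k := by
      intro k
      induction k with
      | zero =>
        rw [pow_zero]
        change (1 : MvPowerSeries (Fin n) ℂ).order = _
        rw [MvPowerSeries.order_eq_nat]
        exact ⟨⟨0, by simp, by simp⟩, by simp⟩
      | succ k ih =>
        rw [pow_succ]
        change (((y ^ k : A.carrier) : MvPowerSeries (Fin n) ℂ) * y).order = _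
        rw [MvPowerSeries.order_mul, ih, hord]; rfl
    have hmul : ∀ a b : A.carrier, ((a * b : A.carrier) : MvPowerSeries (Fin n) ℂ).order =
        (a : MvPowerSeries (Fin n) ℂ).order + (b : MvPowerSeries (Fin n) ℂ).order :=
      fun a b => MvPowerSeries.order_mul _ _
    simp only [hmul, hpow, hf] at e2
    have e3 : ((d + N : ℕ) : ℕ∞) + ((N' + 1 : ℕ) : ℕ∞) ≤ ((d + N : ℕ) : ℕ∞) +
        (a' : MvPowerSeries (Fin n) ℂ).order := by
      calc ((d + N : ℕ) : ℕ∞) + ((N' + 1 : ℕ) : ℕ∞) = ((d + N' + 1 : ℕ) : ℕ∞) + N := by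
            push_cast; ring
        _ ≤ ((d + N' + 1 : ℕ) : ℕ∞) + (a : MvPowerSeries (Fin n) ℂ).order := by gcongr
        _ = _ := by rw [e2]; push_cast; ring
    exact (ENat.add_le_add_iff_left (ENat.natCast_ne_top _)).mp e3
  have hfac : c' = algebraMap _ _ y * blowUpChart.frac hy (N' + 1) a' ha'' := by
    refine blowUpChart.pow_mul_cancel hy N' ?_
    rw [h', ← mul_assoc, ← map_mul, ← pow_succ, blowUpChart.pow_mul_frac]
  refine Ideal.mem_span_singleton.mpr ⟨blowUpChart.frac hy (N' + 1) a' ha'', ?_⟩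
  refine blowUpChart.mul_cancel hy ?_
  rw [hc', hfac]; ring

theorem idealAlong_idealSheaf (I : Ideal A.carrier) {R : CommRingCat.{0}}
    (α : CommRingCat.of A.carrier ⟶ R) :
    idealAlong (A.idealSheaf I) (Spec.map α) = I.map α.hom := by
  have h1 : idealAlong (A.idealSheaf I) (𝟙 (Spec (CommRingCat.of A.carrier))) = I := by
    rw [idealAlong, comap_id, idealSheaf]
    have h2 := (equivOfIsAffine (X := Spec (CommRingCat.of A.carrier))).right_inv
      (I.map (Scheme.ΓSpecIso (CommRingCat.of A.carrier)).inv.hom)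
    change (ofIdealTop (X := Spec (CommRingCat.of A.carrier)) _).ideal ⟨⊤, isAffineOpen_top _⟩ =
      _ at h2
    rw [h2, Ideal.map_map, ← CommRingCat.hom_comp, Iso.inv_hom_id, CommRingCat.hom_id,
      Ideal.map_id]
  rw [← Category.comp_id (Spec.map α), idealAlong_specMap, h1]

end GermRing

/-- A principal ideal of a local ring with a regular generator is generated by one of any given
generators. -/
theorem exists_span_eq_of_isLocalRing {R : Type*} [CommRing R] [IsLocalRing R] {ι : Type*}
    {g : ι → R} {e : R} (he : e ∈ nonZeroDivisors R)
    (h : Ideal.span (Set.range g) = Ideal.span {e}) :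
    ∃ i, Ideal.span (Set.range g) = Ideal.span {g i} := by
  have hdvd : ∀ i, ∃ p, g i = e * p := fun i =>
    Ideal.mem_span_singleton.mp (h ▸ Ideal.subset_span ⟨i, rfl⟩)
  choose p hp using hdvd
  by_cases hu : ∃ i, IsUnit (p i)
  · obtain ⟨i, hi⟩ := hu
    refine ⟨i, ?_⟩
    rw [h, hp i, Ideal.span_singleton_mul_right_unit hi]
  · exfalso
    push Not at hu
    have h1 : Ideal.span (Set.range g) ≤ Ideal.span {e} * IsLocalRing.maximalIdeal R := by
      rw [Ideal.span_le]
      rintro _ ⟨i, rfl⟩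
      rw [hp i]
      exact Ideal.mul_mem_mul (Ideal.mem_span_singleton_self e) (hu i)
    obtain ⟨m, hm, hem⟩ := Ideal.mem_span_singleton_mul.mp
      (h1 (h ▸ Ideal.mem_span_singleton_self e))
    have : m = 1 := (mul_cancel_left_mem_nonZeroDivisors he).mp (by rw [hem, mul_one])
    exact (IsLocalRing.mem_maximalIdeal _).mp hm (this ▸ isUnit_one)

section Origin

variable {n d : ℕ} {A : GermRing n} {f : A.carrier} {X : Scheme.{0}} {β : X ⟶ A.base}

/-- On the blow-up of the origin, `f = e ^ d * u` with `e` the exceptional divisor and `e` regular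
modulo `u`. -/
theorem IsBlowUp.local_structure_origin (hβ : IsBlowUp β A.origin)
    (hf : (f : MvPowerSeries (Fin n) ℂ).order = d) (w : X) :
    ∃ e u : X.presheaf.stalk w, u ∈ nonZeroDivisors _ ∧
      stalkIdeal (A.origin.comap β) w = Ideal.span {e} ∧
      stalkIdeal ((A.hypersurface f).comap β) w = Ideal.span {e ^ d * u} ∧
      ∀ g, e * g ∈ Ideal.span {u} → g ∈ Ideal.span {u} := by
  obtain ⟨α, hα⟩ : ∃ α, Spec.map α = X.fromSpecStalk w ≫ β := ⟨_, Spec.map_preimage _⟩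
  have hst : ∀ I : Ideal A.carrier, stalkIdeal ((A.idealSheaf I).comap β) w = I.map α.hom := by
    intro I
    rw [stalkIdeal, idealAlong_comap, ← hα, A.idealAlong_idealSheaf]
  have hor : stalkIdeal (A.origin.comap β) w = A.maxIdeal.map α.hom := hst _
  obtain ⟨s, hs, hsZ⟩ := stalkIdeal_of_isEffectiveCartier hβ.1 w
  obtain ⟨j, hj⟩ : ∃ j, A.maxIdeal.map α.hom =
      Ideal.span {α.hom ⟨MvPowerSeries.X j, A.X_mem j⟩} := by
    have h1 := hor.symm.trans hsZ
    rw [GermRing.maxIdeal, Ideal.map_span, ← Set.range_comp] at h1 ⊢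
    exact exists_span_eq_of_isLocalRing hs h1
  set y : A.carrier := ⟨MvPowerSeries.X j, A.X_mem j⟩
  have hord : (MvPowerSeries.X j : MvPowerSeries (Fin n) ℂ).order = 1 := by
    rw [MvPowerSeries.X, MvPowerSeries.order_monomial_of_ne_zero one_ne_zero]
    simp
  have hne : ∀ a : A.carrier, (a : MvPowerSeries (Fin n) ℂ).order ≠ ⊤ → a ≠ 0 := by
    rintro _ h rfl
    exact h MvPowerSeries.order_zero
  have hy0 : y ∈ nonZeroDivisors A.carrier :=
    mem_nonZeroDivisors_of_ne_zero (hne y (hord ▸ ENat.one_ne_top))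
  have hf0 : f ∈ nonZeroDivisors A.carrier :=
    mem_nonZeroDivisors_of_ne_zero (hne f (by rw [hf]; exact ENat.natCast_ne_top d))
  have hy : y ∈ A.maxIdeal := A.X_mem_maxIdeal j
  have hfm : f ∈ A.maxIdeal ^ d := A.mem_maxIdeal_pow_iff.mpr hf.ge
  have hZ : idealAlong A.origin (𝟙 A.base) = A.maxIdeal := by
    have := A.idealAlong_idealSheaf A.maxIdeal (𝟙 (CommRingCat.of A.carrier))
    rw [Spec.map_id, CommRingCat.hom_id, Ideal.map_id] at this
    exact this
  have hchart := @IsBlowUp.exists_chart _ _ _ _ hβ w _ (𝟙 A.base) _ α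
    (by rw [hα, Category.comp_id]) y
  rw [hZ] at hchart
  obtain ⟨χ, hχ, htr⟩ := hchart hy hj
  have hfy := congrArg χ (blowUpChart.pow_mul_frac hy d f hfm)
  rw [map_mul, hχ, hχ, map_pow] at hfy
  refine ⟨α.hom y, χ (blowUpChart.frac hy d f hfm), ?_, ?_, ?_, ?_⟩
  · rw [mem_nonZeroDivisors_iff_right]
    intro g hg
    have h1 := htr (blowUpChart.frac hy d f hfm) 0 (fun c hc => by
      rw [Ideal.mem_span_singleton, zero_dvd_iff] at hc ⊢
      refine blowUpChart.algebraMap_mem_nonZeroDivisors hy hy0 hf0 c ?_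
      rw [← blowUpChart.pow_mul_frac hy d f hfm, mul_assoc, hc, mul_zero]) g
    rw [map_zero, Ideal.mem_span_singleton, Ideal.mem_span_singleton, zero_dvd_iff,
      zero_dvd_iff] at h1
    exact h1 (by rw [mul_comm]; exact hg)
  · rw [hor, hj]
  · rw [hfy]
    have := hst (Ideal.span {f})
    rw [Ideal.map_span, Set.image_singleton] at this
    exact this
  · rw [← hχ]
    exact htr _ _ fun c hc => A.mem_span_frac_of_mul_mem hf hfm hy hord hy0 c hc

theorem isGoodModel_ofOrigin (hd : 1 ≤ d) (hf : (f : MvPowerSeries (Fin n) ℂ).order = d)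
    (hβ : IsBlowUp β A.origin) : IsGoodModel d f (Model.ofOrigin f β) := by
  have hst : ∀ w, ∃ e u : X.presheaf.stalk w, u ∈ nonZeroDivisors _ ∧
      stalkIdeal (A.origin.comap β) w = Ideal.span {e} ∧
      stalkIdeal ((A.hypersurface f).comap β) w = Ideal.span {e ^ d * u} ∧
      stalkIdeal (strictTransform β A.origin (A.hypersurface f)) w = Ideal.span {u} ∧
      ∀ g, e * g ∈ Ideal.span {u} → g ∈ Ideal.span {u} := by
    intro w
    obtain ⟨e, u, hu, he, hfw, hreg⟩ := hβ.local_structure_origin hf w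
    exact ⟨e, u, hu, he, hfw, stalkIdeal_strictTransform_of_regular hβ.1 he hfw hreg, hreg⟩
  have hc1 := isStalkwiseCartier_of_isEffectiveCartier hβ.1
  have hc2 : IsStalkwiseCartier (strictTransform β A.origin (A.hypersurface f)) := by
    intro w
    obtain ⟨e, u, hu, -, -, hw, -⟩ := hst w
    exact ⟨u, hu, hw⟩
  have hreg : IsRegularModulo (A.origin.comap β)
      (strictTransform β A.origin (A.hypersurface f)) := by
    intro w g hg
    obtain ⟨e, u, hu, he, -, hw, h⟩ := hst w
    rw [hw] at hg ⊢
    exact h g (hg e (he ▸ Ideal.mem_span_singleton_self e))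
  have hmem : ∀ D ∈ (Model.ofOrigin f β).chain, D = ((0, 1), A.origin.comap β) ∨
      D = ((1, 0), strictTransform β A.origin (A.hypersurface f)) := by
    intro D hD
    exact (List.mem_cons.mp hD).imp id List.mem_singleton.mp
  refine ⟨isLabelChain_origin, ?_, ?_, ?_, ?_, ?_, ?_⟩
  · intro D hD
    rcases hmem D hD with rfl | rfl
    exacts [hc1, hc2]
  · intro D hD D' hD' hne
    rcases hmem D hD with rfl | rfl <;> rcases hmem D' hD' with rfl | rfl
    exacts [absurd rfl hne, hreg, hreg.symm hc2 hc1, absurd rfl hne]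
  · intro a ha c hc b hb
    rcases hmem a ha with rfl | rfl <;> rcases hmem b hb with rfl | rfl <;>
      rcases hmem c hc with rfl | rfl <;> simp [cross]
  · have : (A.origin.comap β) ^ 1 *
        (strictTransform β A.origin (A.hypersurface f) ^ 0 * 1) = A.origin.comap β := by
      rw [pow_zero, pow_one, mul_one, mul_one]
    exact this.symm
  · have : (A.hypersurface f).comap β = (A.origin.comap β) ^ (0 + 1 * d) *
        (strictTransform β A.origin (A.hypersurface f) ^ (1 + 0 * d) * 1) := ?_
    · exact this
    rw [zero_add, one_mul, zero_mul, add_zero, pow_one, mul_one]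
    refine ext_of_stalkIdeal_eq fun w => ?_
    obtain ⟨e, u, hu, he, hf, hw, h⟩ := hst w
    rw [stalkIdeal_mul, stalkIdeal, stalkIdeal, idealAlong_pow]
    change stalkIdeal _ w = stalkIdeal _ w ^ d * stalkIdeal _ w
    rw [he, hf, hw, Ideal.span_singleton_pow, Ideal.span_singleton_mul_span_singleton]
  · intro φ hφ
    refine hβ.exists_lift_arc φ fun h0 => hφ ?_
    obtain ⟨α, rfl⟩ : ∃ α, Spec.map α = φ := ⟨_, Spec.map_preimage _⟩
    rw [GermRing.hypersurface, A.idealAlong_idealSheaf]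
    change idealAlong (A.idealSheaf A.maxIdeal) _ = _ at h0
    rw [A.idealAlong_idealSheaf] at h0
    rw [eq_bot_iff, ← h0]
    refine Ideal.map_mono ?_
    rw [Ideal.span_singleton_le_iff_mem]
    have h1 : f ∈ A.maxIdeal ^ 1 :=
      A.mem_maxIdeal_pow_iff.mpr (by rw [hf]; exact_mod_cast hd)
    rwa [pow_one] at h1

theorem Model.IsIteratedBlowUp.isGoodModel {m : ℕ} (hd : 1 ≤ d)
    (hf : (f : MvPowerSeries (Fin n) ℂ).order = d) {M : Model A}
    (hM : M.IsIteratedBlowUp f m) : IsGoodModel d f M := by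
  induction hM with
  | origin β hβ => exact isGoodModel_ofOrigin hd hf hβ
  | step M hM L E F R hchain hne hN π hπ ih => exact ih.blowUp hd hchain hπ

end Origin

/-! ### Arcs and their truncations -/

section PowerSeries

theorem exists_span_X_pow {I : Ideal (PowerSeries ℂ)} (hI : I ≠ ⊥) :
    ∃ k : ℕ, I = Ideal.span {(PowerSeries.X : PowerSeries ℂ) ^ k} :=
  IsDiscreteValuationRing.ideal_eq_span_pow_irreducible hI PowerSeries.X_irreducible

theorem span_X_pow_le_iff {a b : ℕ} :
    Ideal.span {(PowerSeries.X : PowerSeries ℂ) ^ a} ≤ Ideal.span {PowerSeries.X ^ b} ↔ b ≤ a := by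
  rw [Ideal.span_singleton_le_span_singleton,
    pow_dvd_pow_iff PowerSeries.X_ne_zero PowerSeries.X_irreducible.not_isUnit]

theorem span_X_pow_inj {a b : ℕ} :
    Ideal.span {(PowerSeries.X : PowerSeries ℂ) ^ a} = Ideal.span {PowerSeries.X ^ b} ↔ a = b := by
  rw [le_antisymm_iff, span_X_pow_le_iff, span_X_pow_le_iff, le_antisymm_iff, and_comm]

theorem span_eq_span_X_pow {g : PowerSeries ℂ} {k : ℕ} (h0 : ∀ j < k, PowerSeries.coeff j g = 0)
    (hk : PowerSeries.coeff k g ≠ 0) : Ideal.span {g} = Ideal.span {PowerSeries.X ^ k} := by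
  obtain ⟨u, rfl⟩ := PowerSeries.X_pow_dvd_iff.mpr h0
  refine Ideal.span_singleton_mul_right_unit ?_ _
  rw [PowerSeries.isUnit_iff_constantCoeff, isUnit_iff_ne_zero,
    ← PowerSeries.coeff_zero_eq_constantCoeff_apply]
  have := PowerSeries.coeff_X_pow_mul u k 0
  rw [zero_add] at this
  rwa [← this]

end PowerSeries

section Arc

variable {n : ℕ} (A : GermRing n) (σ : Arc n)

/-- Substitution of an arc into the elements of `A`. -/
def Arc.eval : A.carrier →+* PowerSeries ℂ :=
  ((MvPowerSeries.substAlgHom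
    (MvPowerSeries.hasSubst_of_constantCoeff_zero σ.constantCoeff_eq_zero) :
      MvPowerSeries (Fin n) ℂ →ₐ[ℂ] PowerSeries ℂ).comp A.carrier.val).toRingHom

theorem Arc.eval_apply (a : A.carrier) :
    σ.eval A a = MvPowerSeries.subst σ.toFun (a : MvPowerSeries (Fin n) ℂ) := by
  change MvPowerSeries.substAlgHom (MvPowerSeries.hasSubst_of_constantCoeff_zero
    σ.constantCoeff_eq_zero) (a : MvPowerSeries (Fin n) ℂ) = _
  rw [MvPowerSeries.coe_substAlgHom]

theorem Arc.eval_X (i : Fin n) : σ.eval A ⟨MvPowerSeries.X i, A.X_mem i⟩ = σ.toFun i := by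
  rw [σ.eval_apply]
  exact MvPowerSeries.subst_X
    (MvPowerSeries.hasSubst_of_constantCoeff_zero σ.constantCoeff_eq_zero) i

theorem Arc.map_maxIdeal :
    A.maxIdeal.map (σ.eval A) = Ideal.span (Set.range σ.toFun) := by
  rw [GermRing.maxIdeal, Ideal.map_span, ← Set.range_comp]
  congr 2
  funext i
  exact σ.eval_X A i

theorem Arc.idealAlong_origin :
    idealAlong A.origin (σ.toHom A) = Ideal.span (Set.range σ.toFun) := by
  rw [← σ.map_maxIdeal A]
  exact A.idealAlong_idealSheaf A.maxIdeal _

theorem Arc.idealAlong_hypersurface (f : A.carrier) :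
    idealAlong (A.hypersurface f) (σ.toHom A) = Ideal.span {σ.eval A f} := by
  rw [← Set.image_singleton, ← Ideal.map_span]
  exact A.idealAlong_idealSheaf (Ideal.span {f}) _

/-- The value of an arc on `a = p + b` with `p` a polynomial and `b` of high order. -/
theorem Arc.exists_eval_eq (k : ℕ) (a : A.carrier) : ∃ p : MvPolynomial (Fin n) ℂ,
    ∃ b : A.carrier, ((k + 1 : ℕ) : ℕ∞) ≤ (b : MvPowerSeries (Fin n) ℂ).order ∧
      (a : MvPowerSeries (Fin n) ℂ) = (p : MvPowerSeries (Fin n) ℂ) + b ∧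
      ∀ σ : Arc n, ∃ c ∈ Ideal.span (Set.range σ.toFun) ^ (k + 1),
        σ.eval A a = MvPolynomial.aeval σ.toFun p + c := by
  obtain ⟨p, -, b, hb, hab⟩ := A.exists_polynomial_add k a
  refine ⟨p, b, A.mem_maxIdeal_pow_iff.mp hb, hab, fun σ => ⟨σ.eval A b, ?_, ?_⟩⟩
  · rw [← σ.map_maxIdeal A, ← Ideal.map_pow]
    exact Ideal.mem_map_of_mem _ hb
  · have hs := MvPowerSeries.hasSubst_of_constantCoeff_zero σ.constantCoeff_eq_zero
    rw [σ.eval_apply, σ.eval_apply, hab, MvPowerSeries.subst_add hs, MvPowerSeries.subst_coe]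

theorem Arc.span_range_le : Ideal.span (Set.range σ.toFun) ≤ Ideal.span {PowerSeries.X} := by
  rw [Ideal.span_le]
  rintro _ ⟨i, rfl⟩
  exact Ideal.mem_span_singleton.mpr (PowerSeries.X_dvd_iff.mpr (σ.constantCoeff_eq_zero i))

/-- The value of an arc modulo `t ^ (m + 1)` depends only on its truncation. -/
theorem Arc.coeff_eval_eq_of_truncate_eq {σ τ : Arc n} {m : ℕ}
    (h : σ.truncate m = τ.truncate m) (a : A.carrier) {k : ℕ} (hk : k ≤ m) :
    PowerSeries.coeff k (σ.eval A a) = PowerSeries.coeff k (τ.eval A a) := by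
  obtain ⟨p, b, -, -, hp⟩ := Arc.exists_eval_eq A m a
  have hI : ∀ σ : Arc n, ∀ c ∈ Ideal.span (Set.range σ.toFun) ^ (m + 1),
      c ∈ Ideal.span {(PowerSeries.X : PowerSeries ℂ) ^ (m + 1)} := by
    intro σ c hc
    rw [← Ideal.span_singleton_pow]
    exact Ideal.pow_right_mono σ.span_range_le _ hc
  obtain ⟨c, hc, hσ⟩ := hp σ
  obtain ⟨c', hc', hτ⟩ := hp τ
  have hq : ∀ i, Ideal.Quotient.mk (Ideal.span {(PowerSeries.X : PowerSeries ℂ) ^ (m + 1)})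
      (σ.toFun i) = Ideal.Quotient.mk _ (τ.toFun i) := by
    intro i
    rw [Ideal.Quotient.mk_eq_mk_iff_sub_mem, Ideal.mem_span_singleton, PowerSeries.X_pow_dvd_iff]
    intro j hj
    have := congrFun (congrFun h ⟨j, hj⟩) i
    rw [map_sub, sub_eq_zero]
    exact this
  have hpp : MvPolynomial.aeval σ.toFun p - MvPolynomial.aeval τ.toFun p ∈
      Ideal.span {(PowerSeries.X : PowerSeries ℂ) ^ (m + 1)} := by
    rw [← Ideal.Quotient.mk_eq_mk_iff_sub_mem, MvPolynomial.aeval_def, MvPolynomial.aeval_def,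
      MvPolynomial.hom_eval₂, MvPolynomial.hom_eval₂]
    congr 1
    funext i
    exact hq i
  have hfin : σ.eval A a - τ.eval A a ∈
      Ideal.span {(PowerSeries.X : PowerSeries ℂ) ^ (m + 1)} := by
    have := Ideal.add_mem _ hpp (Ideal.sub_mem _ (hI σ c hc) (hI τ c' hc'))
    rw [hσ, hτ]
    convert this using 1
    ring
  have := PowerSeries.X_pow_dvd_iff.mp (Ideal.mem_span_singleton.mp hfin) k (by omega)
  rwa [map_sub, sub_eq_zero] at this

/-- A jet through the origin, considered as an arc. -/
def Jet.toArc {m : ℕ} (γ : Jet n m) (h : γ 0 = 0) : Arc n where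
  toFun := γ.toSeries
  constantCoeff_eq_zero i := by
    change PowerSeries.constantCoeff (γ.toSeries i) = 0
    rw [← PowerSeries.coeff_zero_eq_constantCoeff_apply, Jet.toSeries, PowerSeries.coeff_mk,
      dif_pos (Nat.succ_pos m)]
    exact congrFun h i

theorem Jet.truncate_toArc {m : ℕ} (γ : Jet n m) (h : γ 0 = 0) : (γ.toArc h).truncate m = γ := by
  funext j i
  change PowerSeries.coeff (j : ℕ) (γ.toSeries i) = _
  rw [Jet.toSeries, PowerSeries.coeff_mk, dif_pos j.2]

theorem Arc.span_eval_of_mem_contactLocus {σ : Arc n} {m : ℕ} {f : A.carrier}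
    (h : σ.truncate m ∈ contactLocus (f : MvPowerSeries (Fin n) ℂ) m) :
    Ideal.span {σ.eval A f} = Ideal.span {PowerSeries.X ^ m} := by
  obtain ⟨h0, hk⟩ := h
  have key : ∀ k ≤ m, PowerSeries.coeff k (σ.eval A f) = if k = m then 1 else 0 := by
    intro k hkm
    rw [← hk k hkm, Arc.coeff_eval_eq_of_truncate_eq A
      (Jet.truncate_toArc (σ.truncate m) h0).symm f hkm, Arc.eval_apply]
    rfl
  refine span_eq_span_X_pow (fun j hj => ?_) ?_
  · rw [key j hj.le, if_neg hj.ne]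
  · rw [key m le_rfl, if_pos rfl]; exact one_ne_zero

theorem Arc.ord_truncate {σ : Arc n} {m ρ : ℕ} (hρ : ρ ≤ m)
    (h : Ideal.span (Set.range σ.toFun) = Ideal.span {PowerSeries.X ^ ρ}) :
    (σ.truncate m).ord = ρ := by
  have h1 : ∀ i, ∀ j < ρ, PowerSeries.coeff j (σ.toFun i) = 0 := by
    intro i
    have : σ.toFun i ∈ Ideal.span {(PowerSeries.X : PowerSeries ℂ) ^ ρ} :=
      h ▸ Ideal.subset_span ⟨i, rfl⟩
    exact PowerSeries.X_pow_dvd_iff.mp (Ideal.mem_span_singleton.mp this)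
  have h2 : ∃ i, PowerSeries.coeff ρ (σ.toFun i) ≠ 0 := by
    by_contra! hc
    have : Ideal.span {(PowerSeries.X : PowerSeries ℂ) ^ ρ} ≤
        Ideal.span {PowerSeries.X ^ (ρ + 1)} := by
      rw [← h, Ideal.span_le]
      rintro _ ⟨i, rfl⟩
      refine Ideal.mem_span_singleton.mpr (PowerSeries.X_pow_dvd_iff.mpr fun j hj => ?_)
      rcases Nat.lt_succ_iff_lt_or_eq.mp hj with hj | rfl
      exacts [h1 i j hj, hc i]
    rw [span_X_pow_le_iff] at this
    omega
  apply le_antisymm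
  · obtain ⟨i, hi⟩ := h2
    exact iInf₂_le (⟨ρ, by omega⟩ : Fin (m + 1)) fun h0 => hi (congrFun h0 i)
  · refine le_iInf₂ fun j hj => ?_
    by_contra! hlt
    refine hj (funext fun i => h1 i j (by exact_mod_cast hlt))

end Arc

/-! ### Existence of arcs of given order and contact -/

section Zeros

variable {n : ℕ}

theorem aeval_mul_of_isHomogeneous {d : ℕ} {h : MvPolynomial (Fin n) ℂ} (hh : h.IsHomogeneous d)
    {R : Type*} [CommRing R] [Algebra ℂ R] (t : R) (y : Fin n → R) :
    MvPolynomial.aeval (fun i => t * y i) h = t ^ d * MvPolynomial.aeval y h := by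
  rw [MvPolynomial.aeval_def, MvPolynomial.aeval_def, MvPolynomial.eval₂_eq, MvPolynomial.eval₂_eq,
    Finset.mul_sum]
  refine Finset.sum_congr rfl fun e he => ?_
  have hdeg : ∑ i ∈ e.support, e i = d := by
    rw [← hh (MvPolynomial.mem_support_iff.mp he)]
    change e.degree = _
    rw [Finsupp.degree_eq_weight_one]
    rfl
  simp only [mul_pow, Finset.prod_mul_distrib, Finset.prod_pow_eq_pow_sum, hdeg]
  ring

theorem eval_smul_of_isHomogeneous {d : ℕ} {h : MvPolynomial (Fin n) ℂ} (hh : h.IsHomogeneous d)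
    (t : ℂ) (y : Fin n → ℂ) :
    MvPolynomial.eval (t • y) h = t ^ d * MvPolynomial.eval y h :=
  aeval_mul_of_isHomogeneous hh t y

/-- A homogeneous polynomial of positive degree in at least two variables has a nontrivial zero. -/
theorem exists_ne_zero_eval_eq_zero {d : ℕ} (hn : 2 ≤ n) (hd : 1 ≤ d)
    {h : MvPolynomial (Fin n) ℂ} (hh : h.IsHomogeneous d) :
    ∃ a : Fin n → ℂ, a ≠ 0 ∧ MvPolynomial.eval a h = 0 := by
  set i₀ : Fin n := ⟨0, by omega⟩
  set i₁ : Fin n := ⟨1, by omega⟩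
  have hne : i₀ ≠ i₁ := by simp [i₀, i₁, Fin.ext_iff]
  -- the restriction `K` of `h` to the line through `e₀` in direction `e₁`
  let K : Polynomial ℂ := MvPolynomial.aeval
    (fun i => Polynomial.C ((Pi.single i₀ 1 : Fin n → ℂ) i) + Polynomial.C ((Pi.single i₁ 1 : Fin n → ℂ) i) *
      Polynomial.X) h
  have hK : ∀ s, K.eval s = MvPolynomial.eval (Pi.single i₀ 1 + s • Pi.single i₁ 1) h := by
    intro s
    change Polynomial.evalRingHom s (MvPolynomial.aeval _ h) = _
    rw [MvPolynomial.aeval_def, MvPolynomial.hom_eval₂, MvPolynomial.eval,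
      MvPolynomial.coe_eval₂Hom]
    congr 1
    · ext; simp
    · funext i
      simp only [map_add, map_mul, Polynomial.coe_evalRingHom, Polynomial.eval_C,
        Polynomial.eval_X, Pi.add_apply, Pi.smul_apply, smul_eq_mul]
      ring
  by_cases hdeg : K.degree = 0
  · -- `K` is a nonzero constant, so by homogeneity and continuity `h` vanishes at `e₁`
    refine ⟨Pi.single i₁ 1, by simp, ?_⟩
    have hconst : ∀ s, K.eval s = K.coeff 0 := by
      intro s
      rw [Polynomial.eq_C_of_degree_le_zero hdeg.le]
      simp
    have h1 : ∀ t : ℂ, t ≠ 0 →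
        MvPolynomial.eval (t • Pi.single i₀ 1 + Pi.single i₁ 1) h = t ^ d * K.coeff 0 := by
      intro t ht
      rw [← hconst t⁻¹, hK]
      rw [← eval_smul_of_isHomogeneous hh]
      congr 2
      funext i
      simp [mul_add, mul_inv_cancel_left₀ ht]
    have hcont : Continuous fun t : ℂ =>
        MvPolynomial.eval (t • Pi.single i₀ 1 + Pi.single i₁ 1 : Fin n → ℂ) h :=
      (MvPolynomial.continuous_eval h).comp (by fun_prop)
    have hlim1 := (hcont.tendsto 0).mono_left (nhdsWithin_le_nhds (s := {0}ᶜ))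
    have hlim2 : Filter.Tendsto (fun t : ℂ => t ^ d * K.coeff 0) (nhdsWithin 0 {0}ᶜ) (nhds 0) := by
      have : Continuous fun t : ℂ => t ^ d * K.coeff 0 := by fun_prop
      have := (this.tendsto 0).mono_left (nhdsWithin_le_nhds (s := {0}ᶜ))
      rwa [zero_pow (by omega), zero_mul] at this
    have hlim3 := hlim2.congr' (Filter.eventually_of_mem self_mem_nhdsWithin
      fun t ht => (h1 t ht).symm)
    have := tendsto_nhds_unique hlim1 hlim3
    simpa using this
  · obtain ⟨s, hs⟩ := IsAlgClosed.exists_root K hdeg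
    refine ⟨Pi.single i₀ 1 + s • Pi.single i₁ 1, fun h0 => ?_, by rw [← hK]; exact hs⟩
    have := congrFun h0 i₀
    simp [hne] at this

/-- A homogeneous polynomial with an isolated critical point at the origin has nonzero gradient at
every nonzero point. -/
theorem exists_eval_pderiv_ne_zero {d : ℕ} {h : MvPolynomial (Fin n) ℂ} (hh : h.IsHomogeneous d)
    (hcrit : ∀ᶠ x in nhdsWithin (0 : Fin n → ℂ) {0}ᶜ,
      ∃ i, MvPolynomial.eval x (MvPolynomial.pderiv i h) ≠ 0) {a : Fin n → ℂ} (ha : a ≠ 0) :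
    ∃ j, MvPolynomial.eval a (MvPolynomial.pderiv j h) ≠ 0 := by
  have htend : Filter.Tendsto (fun t : ℂ => t • a) (nhdsWithin 0 {0}ᶜ)
      (nhdsWithin (0 : Fin n → ℂ) {0}ᶜ) := by
    refine tendsto_nhdsWithin_iff.mpr ⟨?_, ?_⟩
    · have : Continuous fun t : ℂ => t • a := by fun_prop
      have := (this.tendsto 0).mono_left (nhdsWithin_le_nhds (s := {0}ᶜ))
      rwa [zero_smul] at this
    · filter_upwards [self_mem_nhdsWithin] with t ht
      exact smul_ne_zero ht ha
  obtain ⟨t, j, hj⟩ := (htend.eventually hcrit).exists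
  refine ⟨j, fun h0 => hj ?_⟩
  rw [eval_smul_of_isHomogeneous hh.pderiv, h0, mul_zero]

end Zeros

section Newton

open PowerSeries in
/-- Newton's method: a simple root modulo `t` of a polynomial over `ℂ⟦t⟧` deforms to a point where
the polynomial has any prescribed positive order. -/
theorem exists_eval_eq_X_pow_mul (P : Polynomial (PowerSeries ℂ))
    (h0 : constantCoeff (P.eval 0) = 0) (h1 : constantCoeff (P.derivative.eval 0) ≠ 0) (k : ℕ) :
    ∃ s g : PowerSeries ℂ, constantCoeff s = 0 ∧ P.eval s = X ^ (k + 1) * g ∧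
      constantCoeff g ≠ 0 := by
  have hder : ∀ s : PowerSeries ℂ, constantCoeff s = 0 →
      constantCoeff (P.derivative.eval s) ≠ 0 := by
    intro s hs
    have h2 : constantCoeff (P.derivative.eval s) = constantCoeff (P.derivative.eval 0) := by
      rw [← sub_eq_zero, ← map_sub, ← X_dvd_iff]
      refine (X_dvd_iff.mpr ?_ : X ∣ s - 0).trans (Polynomial.sub_dvd_eval_sub s 0 _)
      rw [sub_zero, hs]
    rwa [h2]
  -- moving a point of order at least `k + 1` by a multiple of `t ^ (k + 1)`
  have hstep : ∀ k : ℕ, ∀ s g : PowerSeries ℂ, constantCoeff s = 0 → P.eval s = X ^ (k + 1) * g →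
      ∀ c : ℂ, ∃ s' g', constantCoeff s' = 0 ∧ P.eval s' = X ^ (k + 1) * g' ∧
        constantCoeff g' = constantCoeff g + c := by
    intro k s g hs hg c
    set D := P.derivative.eval s
    have hD := hder s hs
    obtain ⟨q, hq⟩ := P.binomExpansion s (X ^ (k + 1) * C (c / constantCoeff D))
    refine ⟨s + X ^ (k + 1) * C (c / constantCoeff D), g + D * C (c / constantCoeff D) +
      q * X ^ (k + 1) * C (c / constantCoeff D) ^ 2, ?_, ?_, ?_⟩
    rotate_left
    · rw [hq, hg]; ring
    · simp only [map_add, map_mul, map_pow, constantCoeff_X, constantCoeff_C]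
      rw [zero_pow (Nat.succ_ne_zero k)]
      rw [mul_div_cancel₀ _ hD]
      ring
    · simp [hs]
  have hex : ∀ k : ℕ, ∃ s g : PowerSeries ℂ, constantCoeff s = 0 ∧ P.eval s = X ^ (k + 1) * g := by
    intro k
    induction k with
    | zero =>
      obtain ⟨g, hg⟩ := X_dvd_iff.mpr h0
      exact ⟨0, g, map_zero _, by rw [hg, zero_add, pow_one]⟩
    | succ k ih =>
      obtain ⟨s, g, hs, hg⟩ := ih
      obtain ⟨s', g', hs', hg', h2⟩ := hstep k s g hs hg (-constantCoeff g)
      rw [add_neg_cancel] at h2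
      obtain ⟨g'', rfl⟩ := X_dvd_iff.mpr h2
      exact ⟨s', g'', hs', by rw [hg']; ring⟩
  obtain ⟨s, g, hs, hg⟩ := hex k
  obtain ⟨s', g', hs', hg', h2⟩ := hstep k s g hs hg (1 - constantCoeff g)
  exact ⟨s', g', hs', hg', by rw [h2]; simp⟩

theorem derivative_aeval_line {n : ℕ} {R : Type*} [CommRing R] [Algebra ℂ R] (a : Fin n → R)
    (j : Fin n) (q : MvPolynomial (Fin n) R) :
    Polynomial.derivative (MvPolynomial.aeval (fun i => Polynomial.C (a i) +
      (if i = j then Polynomial.X else 0 : Polynomial R)) q) =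
    MvPolynomial.aeval (fun i => Polynomial.C (a i) + (if i = j then Polynomial.X else 0))
      (MvPolynomial.pderiv j q) := by
  induction q using MvPolynomial.induction_on with
  | C c => simp
  | add p q hp hq => simp only [map_add, hp, hq]
  | mul_X p i hp =>
    rw [map_mul, Polynomial.derivative_mul, hp, MvPolynomial.pderiv_mul, map_add, map_mul, map_mul,
      MvPolynomial.pderiv_X, MvPolynomial.aeval_X]
    congr 2
    by_cases hij : i = j
    · subst hij; simp
    · simp [hij]

end Newton

section Existence

variable {n d : ℕ}

theorem eval_constantCoeff (q : MvPolynomial (Fin n) (PowerSeries ℂ)) (y : Fin n → PowerSeries ℂ) :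
    PowerSeries.constantCoeff (MvPolynomial.eval y q) =
      MvPolynomial.eval (fun i => PowerSeries.constantCoeff (y i))
        (MvPolynomial.map PowerSeries.constantCoeff q) := by
  rw [MvPolynomial.eval_map, ← MvPolynomial.eval₂_id, MvPolynomial.hom_eval₂]
  rfl

/-- For a deformation `q` over `ℂ⟦t⟧` of a homogeneous polynomial with an isolated critical point,
there are points of `q` of every order whose reduction modulo `t` is not the origin. -/
theorem exists_eval_eq_X_pow_mul_of_map_eq (hn : 2 ≤ n) (hd : 1 ≤ d)
    {h : MvPolynomial (Fin n) ℂ} (hh : h.IsHomogeneous d) (hcrit :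
      ∀ᶠ x in nhdsWithin (0 : Fin n → ℂ) {0}ᶜ,
        ∃ i, MvPolynomial.eval x (MvPolynomial.pderiv i h) ≠ 0)
    {q : MvPolynomial (Fin n) (PowerSeries ℂ)}
    (hq : MvPolynomial.map PowerSeries.constantCoeff q = h) (κ : ℕ) :
    ∃ (y : Fin n → PowerSeries ℂ) (g : PowerSeries ℂ),
      (∃ i, PowerSeries.constantCoeff (y i) ≠ 0) ∧
      MvPolynomial.eval y q = PowerSeries.X ^ κ * g ∧ PowerSeries.constantCoeff g ≠ 0 := by
  have h0 : h ≠ 0 := by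
    have : Nonempty (Fin n) := ⟨⟨0, by omega⟩⟩
    obtain ⟨x, i, hx⟩ := hcrit.exists
    rintro rfl
    simp at hx
  cases κ with
  | zero =>
    -- a point outside of the cone `h = 0`; it is not the origin, since `d ≥ 1`
    obtain ⟨a, ha⟩ : ∃ a, MvPolynomial.eval a h ≠ 0 := by
      by_contra! hc
      exact h0 (MvPolynomial.funext fun a => by rw [hc, map_zero])
    have hcc : (fun i => PowerSeries.constantCoeff (PowerSeries.C (a i))) = a := by
      funext i; exact PowerSeries.constantCoeff_C _
    refine ⟨fun i => PowerSeries.C (a i), _, ?_, by rw [pow_zero, one_mul], ?_⟩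
    · by_contra! hc
      refine ha ?_
      have ha0 : a = 0 := by
        rw [← hcc]; funext i; exact hc i
      have := eval_smul_of_isHomogeneous hh (0 : ℂ) a
      rwa [zero_pow (by omega), zero_mul, zero_smul, ← ha0] at this
    · rw [eval_constantCoeff, hq, hcc]
      exact ha
  | succ κ =>
    -- a nonzero point of the cone `h = 0`, which is a smooth point, deformed along a line
    obtain ⟨a, ha, hha⟩ := exists_ne_zero_eval_eq_zero hn hd hh
    obtain ⟨j, hj⟩ := exists_eval_pderiv_ne_zero hh hcrit ha
    let line : Fin n → Polynomial (PowerSeries ℂ) := fun i =>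
      Polynomial.C (PowerSeries.C (a i)) + (if i = j then Polynomial.X else 0)
    have hline : ∀ (p : MvPolynomial (Fin n) (PowerSeries ℂ)) (s : PowerSeries ℂ),
        (MvPolynomial.aeval line p).eval s =
          MvPolynomial.eval (fun i => PowerSeries.C (a i) + if i = j then s else 0) p := by
      intro p s
      change Polynomial.evalRingHom s _ = _
      rw [MvPolynomial.aeval_def, MvPolynomial.hom_eval₂, MvPolynomial.eval,
        MvPolynomial.coe_eval₂Hom]
      congr 1
      · ext; simp
      · funext i
        simp only [line, map_add, Polynomial.coe_evalRingHom, Polynomial.eval_C]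
        split <;> simp
    have hcc : ∀ s : PowerSeries ℂ, PowerSeries.constantCoeff s = 0 →
        (fun i => PowerSeries.constantCoeff (PowerSeries.C (a i) + if i = j then s else 0)) =
          a := by
      intro s hs
      funext i
      rw [map_add, PowerSeries.constantCoeff_C]
      split
      · rw [hs, add_zero]
      · rw [map_zero, add_zero]
    obtain ⟨s, g, hs, hg, hg0⟩ := exists_eval_eq_X_pow_mul (MvPolynomial.aeval line q) (by
        rw [hline, eval_constantCoeff, hq, hcc 0 (map_zero _), hha]) (by
        rw [derivative_aeval_line, hline, eval_constantCoeff, ← MvPolynomial.pderiv_map, hq,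
          hcc 0 (map_zero _)]
        exact hj) κ
    rw [hline] at hg
    refine ⟨_, g, ?_, hg, hg0⟩
    obtain ⟨i, hi⟩ := Function.ne_iff.mp ha
    exact ⟨i, by rw [congrFun (hcc s hs) i]; exact hi⟩

/-- The deformation of `h` to the rescaled polynomial `t ^ (-rd) p(t ^ r y)`, where `p` is the sum
of `h` and terms of degree `> d`. -/
theorem exists_rescaling {h p : MvPolynomial (Fin n) ℂ} (hh : h.IsHomogeneous d)
    (hp : ∀ e, p.coeff e ≠ h.coeff e → d < e.degree) {r : ℕ} (hr : 1 ≤ r) :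
    ∃ q : MvPolynomial (Fin n) (PowerSeries ℂ), MvPolynomial.map PowerSeries.constantCoeff q = h ∧
      ∀ y : Fin n → PowerSeries ℂ,
        MvPolynomial.aeval (fun i => PowerSeries.X ^ r * y i) p =
          PowerSeries.X ^ (r * d) * MvPolynomial.eval y q := by
  have hmon : ∀ e : Fin n →₀ ℕ, d < e.degree → ∀ c : ℂ, ∃ q' : MvPolynomial (Fin n) (PowerSeries ℂ),
      MvPolynomial.map PowerSeries.constantCoeff q' = 0 ∧ ∀ y : Fin n → PowerSeries ℂ,
        MvPolynomial.aeval (fun i => PowerSeries.X ^ r * y i) (MvPolynomial.monomial e c) =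
          PowerSeries.X ^ (r * d) * MvPolynomial.eval y q' := by
    intro e he c
    have hle : r * d + 1 ≤ r * e.degree := by nlinarith
    refine ⟨MvPolynomial.monomial e (PowerSeries.X ^ (r * e.degree - r * d) * PowerSeries.C c),
      ?_, fun y => ?_⟩
    · rw [MvPolynomial.map_monomial, map_mul, map_pow, PowerSeries.constantCoeff_X,
        zero_pow (by omega), zero_mul, map_zero]
    · rw [aeval_mul_of_isHomogeneous (d := e.degree)
        (MvPolynomial.isHomogeneous_monomial c rfl), MvPolynomial.aeval_monomial,
        MvPolynomial.eval_monomial, ← mul_assoc, ← mul_assoc, ← mul_assoc, ← pow_mul, ← pow_add,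
        Nat.add_sub_cancel' (by omega)]
      rfl
  have hsum : ∀ s : Finset (Fin n →₀ ℕ), (∀ e ∈ s, d < e.degree) → ∀ c : (Fin n →₀ ℕ) → ℂ,
      ∃ q' : MvPolynomial (Fin n) (PowerSeries ℂ),
      MvPolynomial.map PowerSeries.constantCoeff q' = 0 ∧ ∀ y : Fin n → PowerSeries ℂ,
        MvPolynomial.aeval (fun i => PowerSeries.X ^ r * y i)
          (∑ e ∈ s, MvPolynomial.monomial e (c e)) =
          PowerSeries.X ^ (r * d) * MvPolynomial.eval y q' := by
    intro s hs c
    choose! q' hq' hq'' using fun e (he : e ∈ s) => hmon e (hs e he) (c e)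
    refine ⟨∑ e ∈ s, q' e, ?_, fun y => ?_⟩
    · rw [map_sum]; exact Finset.sum_eq_zero hq'
    · rw [map_sum, map_sum, Finset.mul_sum]
      exact Finset.sum_congr rfl fun e he => hq'' e he y
  obtain ⟨q', hq', hq''⟩ := hsum (p - h).support (fun e he => hp e (by
    rw [MvPolynomial.mem_support_iff, MvPolynomial.coeff_sub, sub_ne_zero] at he
    exact he)) fun e => (p - h).coeff e
  rw [MvPolynomial.support_sum_monomial_coeff] at hq''
  refine ⟨MvPolynomial.map PowerSeries.C h + q', ?_, fun y => ?_⟩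
  · rw [map_add, hq', add_zero, MvPolynomial.map_map]
    convert MvPolynomial.map_id h
    ext; simp
  · have hy := hq'' y
    rw [map_sub, aeval_mul_of_isHomogeneous hh, sub_eq_iff_eq_add] at hy
    rw [hy, map_add, mul_add, MvPolynomial.eval_map, ← pow_mul, add_comm]
    rfl

/-- For all `κ ≥ 0` and `r ≥ 1` there is an arc of order `r` along which `f` has order
`κ + r d`. -/
theorem exists_arc (hn : 2 ≤ n) (hd : 1 ≤ d) (A : GermRing n) {f : A.carrier}
    (hf : IsSemihomogeneous d (f : MvPowerSeries (Fin n) ℂ)) (κ : ℕ) {r : ℕ} (hr : 1 ≤ r) :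
    ∃ σ : Arc n, Ideal.span (Set.range σ.toFun) = Ideal.span {PowerSeries.X ^ r} ∧
      Ideal.span {σ.eval A f} = Ideal.span {PowerSeries.X ^ (κ + r * d)} := by
  obtain ⟨h, F, hh, hcrit, hF, hfF⟩ := hf
  -- modulo terms that do not affect the order in question, `f` is a polynomial `p`
  obtain ⟨p, b, hb, hfp, hp⟩ := Arc.exists_eval_eq A (κ + r * d) f
  have hdeg : ∀ e, p.coeff e ≠ h.coeff e → d < e.degree := by
    intro e he
    by_contra! hle
    have h1 : MvPowerSeries.coeff e F = 0 :=
      MvPowerSeries.coeff_of_lt_order (lt_of_le_of_lt (by exact_mod_cast hle) hF)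
    have h2 : MvPowerSeries.coeff e (b : MvPowerSeries (Fin n) ℂ) = 0 := by
      refine MvPowerSeries.coeff_of_lt_order (lt_of_lt_of_le ?_ hb)
      have : e.degree < κ + r * d + 1 := by nlinarith
      exact_mod_cast this
    have h3 := congrArg (MvPowerSeries.coeff e) (hfF.symm.trans hfp)
    rw [map_add, map_add, h1, h2, MvPolynomial.coeff_coe, MvPolynomial.coeff_coe, add_zero,
      add_zero] at h3
    exact he h3.symm
  obtain ⟨q, hq, hqy⟩ := exists_rescaling hh hdeg hr
  obtain ⟨y, g, ⟨i, hi⟩, hyg, hg⟩ := exists_eval_eq_X_pow_mul_of_map_eq hn hd hh hcrit hq κ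
  let σ : Arc n := ⟨fun i => PowerSeries.X ^ r * y i, fun i => by
    change PowerSeries.constantCoeff (PowerSeries.X ^ r * y i) = 0
    rw [map_mul, map_pow, PowerSeries.constantCoeff_X, zero_pow (by omega), zero_mul]⟩
  have hσ : Ideal.span (Set.range σ.toFun) = Ideal.span {PowerSeries.X ^ r} := by
    apply le_antisymm
    · rw [Ideal.span_le]
      rintro _ ⟨i, rfl⟩
      exact Ideal.mem_span_singleton.mpr ⟨y i, rfl⟩
    · have hu : IsUnit (y i) :=
        PowerSeries.isUnit_iff_constantCoeff.mpr (isUnit_iff_ne_zero.mpr hi)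
      rw [← Ideal.span_singleton_mul_right_unit hu, Ideal.span_singleton_le_iff_mem]
      exact Ideal.subset_span ⟨i, rfl⟩
  refine ⟨σ, hσ, ?_⟩
  obtain ⟨c, hc, hev⟩ := hp σ
  obtain ⟨c', rfl⟩ : PowerSeries.X ^ (κ + r * d + 1) ∣ c := by
    rw [hσ, Ideal.span_singleton_pow, Ideal.mem_span_singleton, ← pow_mul] at hc
    refine (pow_dvd_pow _ ?_).trans hc
    exact Nat.le_mul_of_pos_left _ hr
  have hval : σ.eval A f = PowerSeries.X ^ (κ + r * d) * (g + PowerSeries.X * c') := by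
    rw [hev, show MvPolynomial.aeval σ.toFun p = _ from hqy y, hyg]
    ring
  rw [hval]
  refine Ideal.span_singleton_mul_right_unit ?_ _
  rw [PowerSeries.isUnit_iff_constantCoeff, isUnit_iff_ne_zero, map_add, map_mul,
    PowerSeries.constantCoeff_X, zero_mul, add_zero]
  exact hg

end Existence

/-! ### Orders of vanishing along the chain -/

section Valuation

variable {n d : ℕ} {A : GermRing n} {f : A.carrier} {M : Model A}

theorem IsGoodModel.cross_pos (h : IsGoodModel d f M) {i j : M.Idx} (hij : i < j) :
    0 < cross (M.label i) (M.label j) :=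
  List.pairwise_iff_get.mp (List.pairwise_map.mp h.labels.pairwise) i j hij

theorem IsGoodModel.le_of_cross_nonneg (h : IsGoodModel d f M) {i j : M.Idx}
    (hij : 0 ≤ cross (M.label i) (M.label j)) : i ≤ j := by
  by_contra! hlt
  have := h.cross_pos hlt
  rw [cross_swap] at this
  omega

theorem IsGoodModel.label_injective (h : IsGoodModel d f M) {i j : M.Idx}
    (hij : M.label i = M.label j) : i = j :=
  le_antisymm (h.le_of_cross_nonneg (by rw [hij, cross_self]))
    (h.le_of_cross_nonneg (by rw [hij, cross_self]))

theorem IsGoodModel.coprime_label (h : IsGoodModel d f M) (i : M.Idx) :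
    Nat.Coprime (M.label i).1 (M.label i).2 :=
  h.labels.coprime _ (List.mem_map_of_mem (List.get_mem M.chain i))

theorem IsGoodModel.divisor_sup_divisor (h : IsGoodModel d f M) {i k j : M.Idx} (hik : i < k)
    (hkj : k < j) : M.divisor i ⊔ M.divisor j = ⊤ :=
  h.disjoint _ (List.get_mem _ _) _ (List.get_mem _ k) _ (List.get_mem _ _) (h.cross_pos hik)
    (h.cross_pos hkj)

theorem IsGoodModel.weight_ne_zero (h : IsGoodModel d f M) (hd : 1 ≤ d) (i : M.Idx) :
    (M.label i).1 + (M.label i).2 * d ≠ 0 := by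
  intro h0
  have h1 : (M.label i).1 = 0 := by omega
  have h2 : (M.label i).2 = 0 := by
    rcases Nat.mul_eq_zero.mp (show (M.label i).2 * d = 0 by omega) with h | h
    exacts [h, by omega]
  have := h.coprime_label i
  rw [h1, h2] at this
  exact absurd this (by decide)

theorem IsGoodModel.exists_label_eq (h : IsGoodModel d f M) : ∃ i : M.Idx, M.label i = (1, 0) := by
  obtain ⟨D, hD, hl⟩ := List.mem_map.mp h.labels.last_mem
  obtain ⟨i, rfl⟩ := List.mem_iff_get.mp hD
  exact ⟨i, hl⟩

theorem IsGoodModel.eq_of_label_snd_eq_zero (h : IsGoodModel d f M) {i j : M.Idx}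
    (hi : (M.label i).2 = 0) (hj : M.label j = (1, 0)) : i = j := by
  refine h.label_injective ?_
  have := h.coprime_label i
  rw [hi, Nat.coprime_zero_right] at this
  rw [hj]
  exact Prod.ext this hi

/-- The orders of vanishing `v_i`, along the divisors of the chain, of an arc of order `ρ` along
which `f` has order `κ + ρ d`, satisfy `∑ v_i (κ_i, r_i) = (κ, ρ)`. -/
theorem IsGoodModel.exists_valuation (h : IsGoodModel d f M) (hd : 1 ≤ d) {κ ρ : ℕ}
    (φ : Spec (CommRingCat.of (PowerSeries ℂ)) ⟶ M.X)
    (ho : idealAlong A.origin (φ ≫ M.μ) = Ideal.span {(PowerSeries.X : PowerSeries ℂ) ^ ρ})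
    (hf : idealAlong (A.hypersurface f) (φ ≫ M.μ) =
      Ideal.span {(PowerSeries.X : PowerSeries ℂ) ^ (κ + ρ * d)}) :
    ∃ v : M.Idx → ℕ,
      (∀ i, idealAlong (M.divisor i) φ = Ideal.span {(PowerSeries.X : PowerSeries ℂ) ^ v i}) ∧
      ∑ i, v i * (M.label i).1 = κ ∧ ∑ i, v i * (M.label i).2 = ρ := by
  have hprod : ∀ wt : ℕ × ℕ → ℕ, idealAlong (M.chain.map fun D => D.2 ^ wt D.1).prod φ =
      ∏ i : M.Idx, idealAlong (M.divisor i) φ ^ wt (M.label i) := by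
    intro wt
    rw [idealAlong_listProd, List.map_map, ← Fin.prod_univ_fun_getElem]
    exact Finset.prod_congr rfl fun i _ => idealAlong_pow _ _ _
  have hspan : ∀ (wt : ℕ × ℕ → ℕ) (v : M.Idx → ℕ),
      (∀ i, idealAlong (M.divisor i) φ = Ideal.span {(PowerSeries.X : PowerSeries ℂ) ^ v i}) →
      idealAlong (M.chain.map fun D => D.2 ^ wt D.1).prod φ =
        Ideal.span {(PowerSeries.X : PowerSeries ℂ) ^ ∑ i, v i * wt (M.label i)} := by
    intro wt v hv
    rw [hprod]
    simp only [hv, Ideal.span_singleton_pow, Ideal.prod_span_singleton, ← pow_mul,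
      Finset.prod_pow_eq_pow_sum]
  rw [← idealAlong_comap, h.hypersurface_eq] at hf
  rw [← idealAlong_comap, h.origin_eq] at ho
  have hne : ∀ i, idealAlong (M.divisor i) φ ≠ ⊥ := by
    intro i h0
    rw [hprod fun a => a.1 + a.2 * d] at hf
    have : ∏ i : M.Idx, idealAlong (M.divisor i) φ ^ ((M.label i).1 + (M.label i).2 * d) = 0 := by
      refine Finset.prod_eq_zero (Finset.mem_univ i) ?_
      rw [h0]
      exact zero_pow (h.weight_ne_zero hd i)
    rw [this] at hf
    have := hf.symm.trans Ideal.zero_eq_bot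
    rw [Ideal.span_singleton_eq_bot] at this
    exact pow_ne_zero _ PowerSeries.X_ne_zero this
  choose v hv using fun i => exists_span_X_pow (hne i)
  refine ⟨v, hv, ?_⟩
  have e1 := span_X_pow_inj.mp ((hspan (fun a => a.2) v hv).symm.trans ho)
  have e2 := span_X_pow_inj.mp ((hspan (fun a => a.1 + a.2 * d) v hv).symm.trans hf)
  refine ⟨?_, e1⟩
  simp only [mul_add, Finset.sum_add_distrib, ← mul_assoc, ← Finset.sum_mul, e1] at e2
  omega

theorem eq_zero_or_eq_zero_of_sup_eq_top {X : Scheme.{0}} {I J : X.IdealSheafData}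
    {φ : Spec (CommRingCat.of (PowerSeries ℂ)) ⟶ X} {a b : ℕ}
    (hI : idealAlong I φ = Ideal.span {(PowerSeries.X : PowerSeries ℂ) ^ a})
    (hJ : idealAlong J φ = Ideal.span {(PowerSeries.X : PowerSeries ℂ) ^ b})
    (h : I ⊔ J = ⊤) : a = 0 ∨ b = 0 := by
  by_contra! hne
  have h1 : idealAlong (I ⊔ J) φ ≤ Ideal.span {(PowerSeries.X : PowerSeries ℂ) ^ 1} := by
    rw [idealAlong_sup, hI, hJ]
    exact sup_le (span_X_pow_le_iff.mpr (by omega)) (span_X_pow_le_iff.mpr (by omega))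
  rw [h, idealAlong_top, top_le_iff, pow_one, Ideal.span_singleton_eq_top] at h1
  exact PowerSeries.X_irreducible.not_isUnit h1

/-- An arc of the type of a divisor of the chain meets this divisor transversally and no other
divisor: divisors on both sides of the chain would have to be met, but these are disjoint. -/
theorem IsGoodModel.valuation_eq_one (h : IsGoodModel d f M) {i : M.Idx} {v : M.Idx → ℕ}
    (hdisj : ∀ j k, M.divisor j ⊔ M.divisor k = ⊤ → v j = 0 ∨ v k = 0)
    (h1 : ∑ j, v j * (M.label j).1 = (M.label i).1)
    (h2 : ∑ j, v j * (M.label j).2 = (M.label i).2) : v i = 1 := by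
  have hsum : ∑ j, (v j : ℤ) * cross (M.label j) (M.label i) = 0 := by
    have e1 : ∑ j, (v j : ℤ) * (M.label j).1 = (M.label i).1 := by exact_mod_cast h1
    have e2 : ∑ j, (v j : ℤ) * (M.label j).2 = (M.label i).2 := by exact_mod_cast h2
    calc ∑ j, (v j : ℤ) * cross (M.label j) (M.label i)
        = (M.label i).1 * ∑ j, (v j : ℤ) * (M.label j).2 -
          (M.label i).2 * ∑ j, (v j : ℤ) * (M.label j).1 := by
          rw [Finset.mul_sum, Finset.mul_sum, ← Finset.sum_sub_distrib]
          exact Finset.sum_congr rfl fun j _ => by rw [cross]; ring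
      _ = 0 := by rw [e1, e2]; ring
  have hzero : ∀ j, j ≠ i → v j = 0 := by
    by_contra! hc
    obtain ⟨j, hji, hj⟩ := hc
    -- all summands have the same weak sign, and one of them is nonzero
    rcases lt_or_gt_of_ne hji with hlt | hlt
    · refine absurd hsum (ne_of_gt (Finset.sum_pos' (fun k _ => ?_) ⟨j, Finset.mem_univ _, ?_⟩))
      · rcases le_or_gt k i with hk | hk
        · refine mul_nonneg (by positivity) ?_
          rcases hk.eq_or_lt with rfl | hk
          exacts [(cross_self _).ge, (h.cross_pos hk).le]
        · have := (hdisj j k (h.divisor_sup_divisor hlt hk)).resolve_left hj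
          simp [this]
      · exact mul_pos (by positivity) (h.cross_pos hlt)
    · refine absurd hsum (ne_of_lt (Finset.sum_neg' (fun k _ => ?_) ⟨j, Finset.mem_univ _, ?_⟩))
      · rcases le_or_gt i k with hk | hk
        · refine mul_nonpos_of_nonneg_of_nonpos (by positivity) ?_
          rcases hk.eq_or_lt with rfl | hk
          · exact (cross_self _).le
          · rw [cross_swap]
            exact neg_nonpos.mpr (h.cross_pos hk).le
        · have := (hdisj k j (h.divisor_sup_divisor hk hlt)).resolve_right hj
          simp [this]
      · rw [cross_swap]
        exact mul_neg_of_pos_of_neg (by positivity) (neg_neg_of_pos (h.cross_pos hlt))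
  rw [Finset.sum_eq_single i (fun j _ hj => by rw [hzero j hj, zero_mul]) (by simp)] at h1 h2
  have hcop := h.coprime_label i
  rcases Nat.eq_zero_or_pos (M.label i).1 with h0 | h0
  · rw [h0, Nat.coprime_zero_left] at hcop
    rwa [hcop, mul_one] at h2
  · exact Nat.eq_of_mul_eq_mul_right h0 (by rw [h1, one_mul])

/-- The multiplicity of `f` along `E_(κ,r)` is `κ + r d`. It is at least this number by the product
formula for the total transform, and at most by testing on suitable arcs. -/
theorem IsGoodModel.N_eq (h : IsGoodModel d f M) (hn : 2 ≤ n) (hd : 1 ≤ d)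
    (hf : IsSemihomogeneous d (f : MvPowerSeries (Fin n) ℂ)) (i : M.Idx) :
    M.N f i = (M.label i).1 + (M.label i).2 * d := by
  have hlow : (A.hypersurface f).comap M.μ ≤
      M.divisor i ^ ((M.label i).1 + (M.label i).2 * d) := by
    rw [h.hypersurface_eq, ← Fin.prod_univ_fun_getElem, ← Finset.mul_prod_erase _ _
      (Finset.mem_univ i)]
    exact mul_le_of_le_one_right' le_top
  have hup : ∀ k, (A.hypersurface f).comap M.μ ≤ M.divisor i ^ k →
      k ≤ (M.label i).1 + (M.label i).2 * d := by
    intro k hk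
    -- testing the inequality on an arc of a given type
    have key : ∀ κ r : ℕ, 1 ≤ r → ∃ v : M.Idx → ℕ,
        (∀ j k, M.divisor j ⊔ M.divisor k = ⊤ → v j = 0 ∨ v k = 0) ∧
        ∑ i, v i * (M.label i).1 = κ ∧ ∑ i, v i * (M.label i).2 = r ∧
        v i * k ≤ κ + r * d := by
      intro κ r hr
      obtain ⟨σ, hσ, hfσ⟩ := exists_arc hn hd A hf κ hr
      have ho := (σ.idealAlong_origin A).trans hσ
      have hh := (σ.idealAlong_hypersurface A f).trans hfσ
      obtain ⟨φ, hφ⟩ := h.exists_lift (σ.toHom A) (by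
        rw [hh]
        exact fun h0 => pow_ne_zero _ PowerSeries.X_ne_zero (Ideal.span_singleton_eq_bot.mp h0))
      rw [← hφ] at ho hh
      obtain ⟨v, hv, h1, h2⟩ := h.exists_valuation hd φ ho hh
      refine ⟨v, fun j k => eq_zero_or_eq_zero_of_sup_eq_top (hv j) (hv k), h1, h2, ?_⟩
      have := idealAlong_mono hk φ
      rw [idealAlong_comap, hh, idealAlong_pow, hv i, Ideal.span_singleton_pow, ← pow_mul] at this
      exact span_X_pow_le_iff.mp this
    rcases Nat.eq_zero_or_pos (M.label i).2 with h0 | h0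
    · -- the strict transform of the hypersurface, tested on an arc of high contact
      obtain ⟨i₀, hi₀⟩ := h.exists_label_eq
      obtain rfl := h.eq_of_label_snd_eq_zero h0 hi₀
      set K := ∑ j, (M.label j).1
      -- `v j ≤ 1` for `j ≠ i` gives `v i ≥ K + d + 1`, more than half of `2 * K + 2 * d + 1`
      obtain ⟨v, -, h1, h2, h3⟩ := key (2 * K + d + 1) 1 le_rfl
      have hle : ∑ j ∈ Finset.univ.erase i, v j * (M.label j).1 ≤ K := by
        calc ∑ j ∈ Finset.univ.erase i, v j * (M.label j).1
            ≤ ∑ j ∈ Finset.univ.erase i, (M.label j).1 := by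
              refine Finset.sum_le_sum fun j hj => ?_
              have hr : (M.label j).2 ≠ 0 := fun hr =>
                (Finset.mem_erase.mp hj).1 (h.eq_of_label_snd_eq_zero hr hi₀)
              have : v j * (M.label j).2 ≤ 1 := h2 ▸ Finset.single_le_sum
                (f := fun j => v j * (M.label j).2) (fun _ _ => Nat.zero_le _) (Finset.mem_univ j)
              have : v j ≤ 1 := le_trans (Nat.le_mul_of_pos_right _ (Nat.pos_of_ne_zero hr)) this
              exact (Nat.mul_le_mul_right _ this).trans (one_mul _).le
          _ ≤ K := Finset.sum_le_sum_of_subset (Finset.erase_subset _ _)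
      rw [← Finset.add_sum_erase _ _ (Finset.mem_univ i), hi₀, mul_one] at h1
      rw [hi₀]
      simp only [one_mul] at h3
      by_contra! hlt
      have : v i * 2 ≤ v i * k := Nat.mul_le_mul_left _ (by omega)
      omega
    · obtain ⟨v, hdisj, h1, h2, h3⟩ := key (M.label i).1 (M.label i).2 h0
      rwa [h.valuation_eq_one hdisj h1 h2, one_mul] at h3
  exact (show IsGreatest {k | (A.hypersurface f).comap M.μ ≤ M.divisor i ^ k} _ from
    ⟨hlow, hup⟩).csSup_eq

/-- On a separating resolution, the lift of an arc along which `f` has order `m` meets exactly one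
divisor of the chain, which is the `m`-divisor determined by the order of the arc. -/
theorem IsGoodModel.exists_unique_divisor (h : IsGoodModel d f M) (hn : 2 ≤ n) (hd : 1 ≤ d)
    {m : ℕ} (hm : 1 ≤ m) (hf : IsSemihomogeneous d (f : MvPowerSeries (Fin n) ℂ))
    (hsep : M.IsSeparating f m) {σ : Arc n}
    (hσ : Ideal.span {σ.eval A f} = Ideal.span {(PowerSeries.X : PowerSeries ℂ) ^ m})
    {φ : Spec (CommRingCat.of (PowerSeries ℂ)) ⟶ M.X} (hφ : φ ≫ M.μ = σ.toHom A) :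
    ∃ ρ, ρ * d ≤ m ∧ Ideal.span (Set.range σ.toFun) = Ideal.span {PowerSeries.X ^ ρ} ∧
      ∃ i, M.label i = mLabel d m ρ ∧ M.N f i ∣ m ∧
        ∀ j, φ (IsLocalRing.closedPoint (PowerSeries ℂ)) ∈ (M.divisor j).support ↔ j = i := by
  have hh := (σ.idealAlong_hypersurface A f).trans hσ
  have hfm : f ∈ A.maxIdeal ^ d := A.mem_maxIdeal_pow_iff.mpr (hf.order_eq (by omega)).ge
  have hfσ : σ.eval A f ∈ Ideal.span (Set.range σ.toFun) ^ d := by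
    rw [← σ.map_maxIdeal A, ← Ideal.map_pow]
    exact Ideal.mem_map_of_mem _ hfm
  have hne : Ideal.span (Set.range σ.toFun) ≠ ⊥ := by
    intro h0
    rw [h0, ← Ideal.zero_eq_bot, zero_pow (by omega), Ideal.zero_eq_bot, Ideal.mem_bot] at hfσ
    rw [hfσ, Ideal.span_singleton_zero] at hσ
    exact pow_ne_zero _ PowerSeries.X_ne_zero (Ideal.span_singleton_eq_bot.mp hσ.symm)
  obtain ⟨ρ, hρ⟩ := exists_span_X_pow hne
  have hρm : ρ * d ≤ m := by
    rw [hρ, Ideal.span_singleton_pow, ← pow_mul, ← Ideal.span_singleton_le_iff_mem, hσ] at hfσ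
    exact span_X_pow_le_iff.mp hfσ
  have ho := (σ.idealAlong_origin A).trans hρ
  rw [← hφ] at ho hh
  obtain ⟨v, hv, h1, h2⟩ := h.exists_valuation hd (κ := m - ρ * d) (ρ := ρ) φ ho
    (by rw [Nat.sub_add_cancel hρm]; exact hh)
  have hN : ∑ i, v i * M.N f i = m := by
    simp only [h.N_eq hn hd hf, mul_add, Finset.sum_add_distrib, ← mul_assoc, ← Finset.sum_mul,
      h1, h2]
    omega
  have huniq : ∀ i j, v i ≠ 0 → v j ≠ 0 → i = j := by
    intro i j hi hj
    by_contra hij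
    have hlt := hsep i j hij fun htop =>
      (eq_zero_or_eq_zero_of_sup_eq_top (hv i) (hv j) htop).elim hi hj
    have h3 : v i * M.N f i + v j * M.N f j ≤ m := by
      rw [← hN, ← Finset.sum_pair (f := fun i => v i * M.N f i) hij]
      exact Finset.sum_le_sum_of_subset (Finset.subset_univ _)
    have h4 := Nat.le_mul_of_pos_left (M.N f i) (Nat.pos_of_ne_zero hi)
    have h5 := Nat.le_mul_of_pos_left (M.N f j) (Nat.pos_of_ne_zero hj)
    omega
  obtain ⟨i, hi⟩ : ∃ i, v i ≠ 0 := by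
    by_contra! hc
    simp only [hc, zero_mul, Finset.sum_const_zero] at hN
    omega
  have hzero : ∀ j, j ≠ i → v j = 0 := fun j hj => by_contra fun hvj => hj (huniq j i hvj hi)
  rw [Finset.sum_eq_single i (fun j _ hj => by rw [hzero j hj, zero_mul]) (by simp)] at h1 h2 hN
  refine ⟨ρ, hρm, hρ, i, ?_, ⟨v i, by rw [← hN, mul_comm]⟩, fun j => ?_⟩
  · have hg : Nat.gcd (m - ρ * d) ρ = v i := by
      rw [← h1, ← h2, Nat.gcd_mul_left, (h.coprime_label i).gcd_eq_one, mul_one]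
    rw [mLabel, hg, ← h1, ← h2, Nat.mul_div_cancel_left _ (Nat.pos_of_ne_zero hi),
      Nat.mul_div_cancel_left _ (Nat.pos_of_ne_zero hi)]
  · have hsupp : φ (IsLocalRing.closedPoint (PowerSeries ℂ)) ∈ (M.divisor j).support ↔
        v j ≠ 0 := by
      refine (closedPoint_mem_support_iff (R := CommRingCat.of (PowerSeries ℂ)) _ φ).trans ?_
      rw [hv j, ne_eq, Ideal.span_singleton_eq_top]
      refine not_congr ⟨fun hu => ?_, fun h0 => by rw [h0, pow_zero]; exact isUnit_one⟩
      by_contra h0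
      exact PowerSeries.X_irreducible.not_isUnit ((isUnit_pow_iff h0).mp hu)
    rw [hsupp]
    exact ⟨fun hj => huniq j i hj hi, fun hj => hj ▸ hi⟩

theorem IsGoodModel.exists_lift_of_span (h : IsGoodModel d f M) {m : ℕ} {σ : Arc n}
    (hσ : Ideal.span {σ.eval A f} = Ideal.span {(PowerSeries.X : PowerSeries ℂ) ^ m}) :
    ∃ φ : Spec (CommRingCat.of (PowerSeries ℂ)) ⟶ M.X, φ ≫ M.μ = σ.toHom A := by
  refine h.exists_lift _ ?_
  rw [σ.idealAlong_hypersurface A f, hσ]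
  exact fun h0 => pow_ne_zero _ PowerSeries.X_ne_zero (Ideal.span_singleton_eq_bot.mp h0)

end Valuation

section Labels

variable {d m : ℕ}

theorem gcd_mul_mLabel_fst (ρ : ℕ) :
    Nat.gcd (m - ρ * d) ρ * (mLabel d m ρ).1 = m - ρ * d :=
  Nat.mul_div_cancel' (Nat.gcd_dvd_left _ _)

theorem gcd_mul_mLabel_snd (ρ : ℕ) : Nat.gcd (m - ρ * d) ρ * (mLabel d m ρ).2 = ρ :=
  Nat.mul_div_cancel' (Nat.gcd_dvd_right _ _)

/-- The labels of the `m`-divisors appear in the chain in the order of decreasing `ρ`. -/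
theorem cross_mLabel_pos (hm : 1 ≤ m) {ρ ρ' : ℕ} (hρ : ρ < ρ') (hρ' : ρ' * d ≤ m) :
    0 < cross (mLabel d m ρ') (mLabel d m ρ) := by
  have hle : ρ * d ≤ m := (Nat.mul_le_mul_right d hρ.le).trans hρ'
  have e1 : (Nat.gcd (m - ρ * d) ρ : ℤ) * (mLabel d m ρ).1 = m - ρ * d := by
    rw [← Nat.cast_mul, gcd_mul_mLabel_fst, Nat.cast_sub hle, Nat.cast_mul]
  have e2 : (Nat.gcd (m - ρ * d) ρ : ℤ) * (mLabel d m ρ).2 = ρ := by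
    rw [← Nat.cast_mul, gcd_mul_mLabel_snd]
  have e3 : (Nat.gcd (m - ρ' * d) ρ' : ℤ) * (mLabel d m ρ').1 = m - ρ' * d := by
    rw [← Nat.cast_mul, gcd_mul_mLabel_fst, Nat.cast_sub hρ', Nat.cast_mul]
  have e4 : (Nat.gcd (m - ρ' * d) ρ' : ℤ) * (mLabel d m ρ').2 = ρ' := by
    rw [← Nat.cast_mul, gcd_mul_mLabel_snd]
  have key : (Nat.gcd (m - ρ * d) ρ : ℤ) * Nat.gcd (m - ρ' * d) ρ' *
      cross (mLabel d m ρ') (mLabel d m ρ) = m * (ρ' - ρ) := by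
    calc _ = (Nat.gcd (m - ρ * d) ρ * (mLabel d m ρ).1 : ℤ) *
          (Nat.gcd (m - ρ' * d) ρ' * (mLabel d m ρ').2) -
          (Nat.gcd (m - ρ' * d) ρ' * (mLabel d m ρ').1) *
          (Nat.gcd (m - ρ * d) ρ * (mLabel d m ρ).2) := by rw [cross]; ring
      _ = _ := by rw [e1, e2, e3, e4]; ring
  have hpos : (0 : ℤ) < m * (ρ' - ρ) :=
    mul_pos (by exact_mod_cast hm) (sub_pos.mpr (by exact_mod_cast hρ))
  rw [← key] at hpos
  exact pos_of_mul_pos_right hpos (by positivity)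

theorem mLabel_injective (hm : 1 ≤ m) {ρ ρ' : ℕ} (hρ : ρ * d ≤ m) (hρ' : ρ' * d ≤ m)
    (h : mLabel d m ρ = mLabel d m ρ') : ρ = ρ' := by
  rcases lt_trichotomy ρ ρ' with hlt | heq | hlt
  · have := cross_mLabel_pos hm hlt hρ'
    rw [h, cross_self] at this
    omega
  · exact heq
  · have := cross_mLabel_pos hm hlt hρ
    rw [h, cross_self] at this
    omega

end Labels

/-- A strictly decreasing finite sequence of integers extends to a strictly increasing function that
compares with it in the prescribed way. -/
theorem exists_strictMono_reindex (R : ℕ) (c : ℕ → ℤ)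
    (hc : ∀ ρ ρ', ρ < ρ' → ρ' ≤ R → c ρ' < c ρ) :
    ∃ ι : ℤ → ℤ, StrictMono ι ∧ ∀ p : ℤ, ∀ ρ ≤ R, c ρ ≤ ι p ↔ (-p).toNat ≤ ρ := by
  have hc' : ∀ ρ ρ', ρ ≤ ρ' → ρ' ≤ R → c ρ' ≤ c ρ := by
    intro ρ ρ' h h'
    rcases h.eq_or_lt with rfl | h
    exacts [le_rfl, (hc _ _ h h').le]
  refine ⟨fun p => if 0 < p then c 0 + p else if p < -R then c R + p + R else c (-p).toNat,
    strictMono_int_of_lt_succ fun p => ?_, fun p ρ hρ => ?_⟩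
  · rcases lt_trichotomy p 0 with hp | rfl | hp
    · rw [if_neg (by omega), if_neg (show ¬0 < p + 1 by omega)]
      rcases lt_trichotomy (p + 1) (-R) with hR | hR | hR
      · rw [if_pos (by omega), if_pos (by omega)]; omega
      · rw [if_pos (by omega), if_neg (by omega), show (-(p + 1)).toNat = R by omega]; omega
      · rw [if_neg (by omega), if_neg (by omega)]
        exact hc _ _ (by omega) (by omega)
    · rw [if_neg (lt_irrefl _), if_neg (by omega), if_pos (by omega)]; simp
    · rw [if_pos hp, if_pos (by omega)]; omega
  · dsimp only
    have h0 := hc' 0 ρ (Nat.zero_le _) hρ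
    have hR := hc' ρ R hρ le_rfl
    split_ifs with h1 h2
    · constructor <;> intro _ <;> omega
    · constructor <;> intro _ <;> omega
    · constructor
      · intro h
        by_contra! hlt
        have := hc ρ (-p).toNat hlt (by omega)
        omega
      · intro h
        exact hc' _ _ h hρ

end ContactLocus

/-! ### The two filtrations of the contact locus -/

open ContactLocus in
theorem mainTheorem8 (n d m : ℕ) (hn : 3 ≤ n) (hd : 1 ≤ d) (hm : 1 ≤ m)
    (A : ContactLocus.GermRing n) (f : A.carrier)
    (hf : ContactLocus.IsSemihomogeneous d (f : MvPowerSeries (Fin n) ℂ))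
    (M : ContactLocus.Model A) (hM : M.IsSeparatingResolution f m)
    (b : M.Idx → ℤ) (hb : M.IsMonotoneAmple f b) :
    (∃ ι : ℤ → ℤ, StrictMono ι ∧
      ∀ p : ℤ, ContactLocus.orderFiltration (f : MvPowerSeries (Fin n) ℂ) m p =
        M.divisorFiltration f m b (ι p)) ∧
    (∀ ρ : ℕ, ρ * d ≤ m → ∃ i : M.Idx, M.label i = ContactLocus.mLabel d m ρ ∧ M.N f i ∣ m ∧
      ∀ γ ∈ ContactLocus.contactLocus (f : MvPowerSeries (Fin n) ℂ) m,
        γ.ord = (ρ : ℕ∞) ↔ γ ∈ M.piece f m i) ∧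
    (∀ γ ∈ ContactLocus.contactLocus (f : MvPowerSeries (Fin n) ℂ) m,
      ∃ ρ : ℕ, ρ * d ≤ m ∧ γ.ord = (ρ : ℕ∞)) := by
  have h : IsGoodModel d f M := hM.1.isGoodModel hd (hf.order_eq (by omega))
  -- the order of a jet determines the divisor met by its lifts
  have hjet : ∀ γ ∈ contactLocus (f : MvPowerSeries (Fin n) ℂ) m,
      ∃ ρ : ℕ, ρ * d ≤ m ∧ γ.ord = (ρ : ℕ∞) ∧
        ∀ i, γ ∈ M.piece f m i ↔ M.label i = mLabel d m ρ := by
    intro γ hγ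
    have harc : ∀ σ : Arc n, σ.truncate m = γ → ∀ φ, φ ≫ M.μ = σ.toHom A →
        ∃ ρ : ℕ, ρ * d ≤ m ∧ γ.ord = (ρ : ℕ∞) ∧
          ∀ i, φ (IsLocalRing.closedPoint (PowerSeries ℂ)) ∈ (M.divisor i).support ↔
            M.label i = mLabel d m ρ := by
      rintro σ rfl φ hφ
      obtain ⟨ρ, hρ, hσ, i, hi, -, hφi⟩ := h.exists_unique_divisor (by omega) hd hm hf hM.2
        (Arc.span_eval_of_mem_contactLocus A hγ) hφ
      refine ⟨ρ, hρ, Arc.ord_truncate (by nlinarith) hσ, fun j => ?_⟩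
      rw [hφi, ← hi]
      exact ⟨fun hj => hj ▸ rfl, fun hj => h.label_injective hj⟩
    have htr := Jet.truncate_toArc γ hγ.1
    obtain ⟨φ, hφ⟩ := h.exists_lift_of_span
      (Arc.span_eval_of_mem_contactLocus A (htr.symm ▸ hγ))
    obtain ⟨ρ, hρ, hord, hφi⟩ := harc _ htr φ hφ
    refine ⟨ρ, hρ, hord, fun i => ⟨?_, fun hi => ⟨hγ, _, htr, φ, hφ, (hφi i).mpr hi⟩⟩⟩
    rintro ⟨-, σ, hσ, φ', hφ', hmem⟩
    obtain ⟨ρ', hρ', hord', hφi'⟩ := harc σ hσ φ' hφ'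
    rw [hord, Nat.cast_inj] at hord'
    rw [hord']
    exact (hφi' i).mp hmem
  -- for `ρ = 0` the divisor is the strict transform of the hypersurface, and for `ρ ≥ 1` it is the
  -- one met by an arc of order `ρ` along which `f` has order `m`
  have hidx : ∀ ρ : ℕ, ρ * d ≤ m → ∃ i : M.Idx, M.label i = mLabel d m ρ ∧ M.N f i ∣ m := by
    intro ρ hρ
    rcases Nat.eq_zero_or_pos ρ with rfl | hρ0
    · obtain ⟨i, hi⟩ := h.exists_label_eq
      refine ⟨i, ?_, ?_⟩
      · rw [hi, mLabel, zero_mul, Nat.sub_zero, Nat.gcd_zero_right, Nat.div_self hm, Nat.zero_div]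
      · rw [h.N_eq (by omega) hd hf, hi]
        simp
    · obtain ⟨σ, hσ, hfσ⟩ := exists_arc (by omega) hd A hf (m - ρ * d) hρ0
      rw [Nat.sub_add_cancel hρ] at hfσ
      obtain ⟨φ, hφ⟩ := h.exists_lift_of_span hfσ
      obtain ⟨ρ', -, hσ', i, hi, hN, -⟩ :=
        h.exists_unique_divisor (by omega) hd hm hf hM.2 hfσ hφ
      obtain rfl := span_X_pow_inj.mp (hσ.symm.trans hσ')
      exact ⟨i, hi, hN⟩
  refine ⟨?_, ?_, ?_⟩
  · have hR : ∀ ρ, ρ * d ≤ m ↔ ρ ≤ m / d := fun ρ => (Nat.le_div_iff_mul_le hd).symm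
    have : Nonempty M.Idx := h.exists_label_eq.nonempty
    choose! idx hlab hdvd using hidx
    have hslope : ∀ i, M.N f i ∣ m →
        (m : ℚ) * (b i : ℚ) / (M.N f i : ℚ) = ((m / M.N f i : ℕ) * b i : ℤ) := by
      intro i hi
      have hN0 : (M.N f i : ℚ) ≠ 0 := by
        rw [Nat.cast_ne_zero]
        rintro h0
        rw [h0, zero_dvd_iff] at hi
        omega
      rw [Int.cast_mul, Int.cast_natCast, Nat.cast_div hi hN0]
      ring
    obtain ⟨ι, hι, hιc⟩ := exists_strictMono_reindex (m / d)
      (fun ρ => (m / M.N f (idx ρ) : ℕ) * b (idx ρ)) (by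
        intro ρ ρ' hlt hρ'
        have h1 := (hR ρ').mpr hρ'
        have h2 := (hR ρ).mpr (hlt.le.trans hρ')
        have hcr := cross_mLabel_pos hm hlt h1
        rw [← hlab ρ' h1, ← hlab ρ h2] at hcr
        have hlt' : idx ρ' < idx ρ := by
          refine lt_of_le_of_ne (h.le_of_cross_nonneg hcr.le) fun heq => ?_
          rw [heq, cross_self] at hcr
          exact hcr.false
        have hs := hb.slope_lt _ _ hlt'
        have hs' := mul_lt_mul_of_pos_left hs (show (0 : ℚ) < m by exact_mod_cast hm)
        rw [← mul_div_assoc, ← mul_div_assoc, hslope _ (hdvd ρ' h1), hslope _ (hdvd ρ h2)] at hs'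
        exact_mod_cast hs')
    refine ⟨ι, hι, fun p => ?_⟩
    ext γ
    simp only [orderFiltration, Model.divisorFiltration, Set.mem_iUnion, exists_prop]
    constructor
    · rintro ⟨hγ, hp⟩
      obtain ⟨ρ, hρ, hord, hpiece⟩ := hjet γ hγ
      rw [hord, Nat.cast_le] at hp
      refine ⟨idx ρ, hdvd ρ hρ, ?_, (hpiece _).mpr (hlab ρ hρ)⟩
      rw [hslope _ (hdvd ρ hρ), Int.cast_le]
      exact (hιc p ρ ((hR ρ).mp hρ)).mpr hp
    · rintro ⟨i, hi, hle, hγ⟩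
      refine ⟨hγ.1, ?_⟩
      obtain ⟨ρ, hρ, hord, hpiece⟩ := hjet γ hγ.1
      obtain rfl : i = idx ρ :=
        h.label_injective (((hpiece i).mp hγ).trans (hlab ρ hρ).symm)
      rw [hslope _ hi, Int.cast_le] at hle
      rw [hord, Nat.cast_le]
      exact (hιc p ρ ((hR ρ).mp hρ)).mp hle
  · intro ρ hρ
    obtain ⟨i, hi, hN⟩ := hidx ρ hρ
    refine ⟨i, hi, hN, fun γ hγ => ?_⟩
    obtain ⟨ρ', hρ', hord, hpiece⟩ := hjet γ hγ
    rw [hpiece, hi, hord, Nat.cast_inj]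
    exact ⟨fun h => h ▸ rfl, fun h => (mLabel_injective hm hρ hρ' h).symm⟩
  · intro γ hγ
    obtain ⟨ρ, hρ, hord, -⟩ := hjet γ hγ
    exact ⟨ρ, hρ, hord⟩
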